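/- Let $B\in L^{3/2}(\mathbb R^3;\mathbb R^3)$ be a magnetic field with a vector potential $A\in L^2_{\mathrm{loc}}(\mathbb R^3;\mathbb R^3)$, that is, $\operatorname{curl}A=B$ in the sense of distributions. Suppose that there are $\beta>0$, $C\ge 0$ and $r_0\ge 0$ such that $|B(x)|\le C|x|^{-2-\beta}$ for almost every $x$ with $|x|\ge r_0$. Let $\mathcal H=L^2(\mathbb R^3;\mathbb C^2)$ and $p=-i\nabla$, let $\sigma=(\sigma_1,\sigma_2,\sigma_3)$ be the Pauli matrices, and let $Q$ be the form domain of $(p-A)^2$, i.e. the closure of $C_c^\infty(\mathbb R^3;\mathbb C^2)$ in the norm $(\|u\|^2+\|(p-A)u\|^2)^{1/2}$. Let $P_A=(p-A)^2-\sigma\cdot B$ (the Pauli operator) and $\widetilde P_A=P_A+|B|$ be the self-adjoint operators in $\mathcal H$ associated with the corresponding quadratic forms on $Q$. Let $\widetilde{\mathcal H}$ be the completion of $Q=\operatorname{Dom}(\widetilde P_A^{1/2})$ in the norm $\|\widetilde P_A^{1/2}u\|=(u,\widetilde P_Au)^{1/2}$, let $U:\mathcal H\to\widetilde{\mathcal H}$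 be the unitary operator extending $\widetilde P_A^{-1/2}$, let $S=|B|^{1/2}U:\mathcal H\to\mathcal H$ be the bounded operator that extends $|B|^{1/2}(P_A+|B|)^{-1/2}$, and let $$\delta(B)=\inf\{\|(1-S^*S)f\| : f\in\mathcal H,\ \|f\|=1,\ Uf\in\mathcal H\},$$ where $Uf\in\mathcal H$ means that $Uf$ belongs to $Q\subset\widetilde{\mathcal H}$. Then $\delta(B)=0$ if and only if $P_A$ has a zero mode, i.e. there is $u\in\operatorname{Dom}(P_A)\subset\mathcal H$, $u\neq0$, with $P_Au=0$. -/

import Mathlib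

open MeasureTheory UniformSpace
open scoped ContDiff InnerProductSpace ENNReal

noncomputable section

namespace Pauli

/-- Physical space `ℝ³` with its Euclidean norm. -/
abbrev Space : Type := EuclideanSpace ℝ (Fin 3)

/-- Two-component spinors `ℂ²`. -/
abbrev Spinor : Type := EuclideanSpace ℂ (Fin 2)

/-- The Hilbert space `𝓗 = L²(ℝ³, ℂ²)`. -/
abbrev Hil : Type := Lp Spinor 2 (volume : Measure Space)

/-- The partial derivative `∂ⱼ φ`. -/
def partialDeriv {F : Type*} [NormedAddCommGroup F] [NormedSpace ℝ F]
    (j : Fin 3) (φ : Space → F) (x : Space) : F :=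
  fderiv ℝ φ x (EuclideanSpace.single j 1)

/-- `A ∈ L²_loc(ℝ³, ℝ³)`. -/
def IsL2Loc (A : Space → Space) : Prop :=
  ∀ K : Set Space, IsCompact K → MemLp A 2 (volume.restrict K)

/-- `curl A = B` in the sense of distributions, componentwise
`Bᵢ = ∂ᵢ₊₁ Aᵢ₊₂ - ∂ᵢ₊₂ Aᵢ₊₁` (indices modulo 3). -/
def HasWeakCurl (A B : Space → Space) : Prop :=
  ∀ ψ : Space → ℝ, ContDiff ℝ ∞ ψ → HasCompactSupport ψ → ∀ i : Fin 3,
    ∫ x, B x i * ψ x =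
      ∫ x, (A x (i + 1) * partialDeriv (i + 2) ψ x - A x (i + 2) * partialDeriv (i + 1) ψ x)

/-- The Hermitian matrix `σ · b`, with `σ` the vector of Pauli matrices. -/
def sigmaDot (b : Space) : Matrix (Fin 2) (Fin 2) ℂ :=
  !![(b 2 : ℂ), (b 0 : ℂ) - Complex.I * (b 1 : ℂ);
     (b 0 : ℂ) + Complex.I * (b 1 : ℂ), -(b 2 : ℂ)]

/-! ### The form domain of `(p - A)²` -/

/-- The graph of `φ ↦ (p - A) φ`, `p = -i∇`, on `C_c^∞(ℝ³, ℂ²)`. -/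
def covGradGraph (A : Space → Space) : Submodule ℂ (Hil × PiLp 2 (fun _ : Fin 3 => Hil)) where
  carrier := {q | ∃ φ : Space → Spinor, ContDiff ℝ ∞ φ ∧ HasCompactSupport φ ∧
    (q.1 =ᵐ[volume] φ) ∧
    ∀ j : Fin 3, q.2 j =ᵐ[volume]
      fun x => (-Complex.I) • partialDeriv j φ x - ((A x j : ℝ) : ℂ) • φ x}
  zero_mem' := by
    refine ⟨0, contDiff_const, HasCompactSupport.zero, Lp.coeFn_zero _ _ _, fun j => ?_⟩
    refine (Lp.coeFn_zero _ _ _).trans (Filter.Eventually.of_forall fun x => ?_)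
    simp [partialDeriv]
  add_mem' := by
    rintro q r ⟨φ, hφ, hφc, hq, hq'⟩ ⟨ψ, hψ, hψc, hr, hr'⟩
    refine ⟨φ + ψ, hφ.add hψ, hφc.add hψc, ?_, fun j => ?_⟩
    · exact (Lp.coeFn_add _ _).trans (hq.add hr)
    · refine (Lp.coeFn_add (q.2 j) (r.2 j)).trans ?_
      filter_upwards [hq' j, hr' j] with x h₁ h₂
      have hd : partialDeriv j (φ + ψ) x = partialDeriv j φ x + partialDeriv j ψ x := by
        simp only [partialDeriv]
        rw [fderiv_add (hφ.differentiable (by simp) x) (hψ.differentiable (by simp) x)]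
        rfl
      simp only [Pi.add_apply, h₁, h₂, hd, smul_add]
      abel
  smul_mem' := by
    rintro c q ⟨φ, hφ, hφc, hq, hq'⟩
    refine ⟨c • φ, hφ.const_smul c, hφc.mono' ?_, ?_, fun j => ?_⟩
    · refine subset_trans ?_ (subset_tsupport φ)
      intro x hx hx0
      exact hx (by simp [hx0])
    · refine (Lp.coeFn_smul _ _).trans ?_
      filter_upwards [hq] with x h₁
      simp [h₁]
    · refine (Lp.coeFn_smul c (q.2 j)).trans ?_
      filter_upwards [hq' j] with x h₁
      have hd : partialDeriv j (c • φ) x = c • partialDeriv j φ x := by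
        simp only [partialDeriv]
        rw [fderiv_const_smul (hφ.differentiable (by simp) x)]
        rfl
      simp only [Pi.smul_apply, h₁, hd, smul_sub]
      rw [smul_comm c, smul_comm c]

/-- The operator `p - A : L²(ℝ³, ℂ²) → L²(ℝ³, ℂ²)³`: the closure of `p - A` on `C_c^∞`. -/
def covGrad (A : Space → Space) : Hil →ₗ.[ℂ] PiLp 2 (fun _ : Fin 3 => Hil) :=
  (covGradGraph A).topologicalClosure.toLinearPMap

/-- The form domain of `S_A = (p - A)²`: the closure of `C_c^∞(ℝ³, ℂ²)` in the form norm
`(‖u‖² + ‖(p - A) u‖²)^{1/2}`. -/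
def formDomain (A : Space → Space) : Submodule ℂ Hil := (covGrad A).domain

/-! ### The operators `P_A` and `P_A + |B|` -/

/-- The Pauli form `(v, P_A u) = ((p - A) v, (p - A) u) - (v, σ · B u)`. -/
def pauliForm (A B : Space → Space) (v u : formDomain A) : ℂ :=
  ⟪covGrad A v, covGrad A u⟫_ℂ -
    ∫ x, ⟪(v : Hil) x, Matrix.toEuclideanLin (sigmaDot (B x)) ((u : Hil) x)⟫_ℂ

/-- The form `(v, P_A u) + (v, |B| u)`. -/
def pauliTildeForm (A B : Space → Space) (v u : formDomain A) : ℂ :=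
  pauliForm A B v u + ∫ x, ((‖B x‖ : ℝ) : ℂ) * ⟪(v : Hil) x, (u : Hil) x⟫_ℂ

/-- The graph of the operator `T` associated with a form `a` on `Q`: `T u = f` iff `u ∈ Q` and
`a(v, u) = (v, f)` for all `v ∈ Q`. -/
def formOperator (Q : Submodule ℂ Hil) (a : Q → Q → ℂ) : Set (Hil × Hil) :=
  {q | ∃ u : Q, (u : Hil) = q.1 ∧ ∀ v : Q, a v u = ⟪(v : Hil), q.2⟫_ℂ}

/-- The (graph of the) Pauli operator `P_A = (p - A)² - σ · B` (Friedrichs extension). -/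
def pauliOperator (A B : Space → Space) : Set (Hil × Hil) :=
  formOperator (formDomain A) (pauliForm A B)

/-- The (graph of the) operator `P_A + |B|` (form sum). -/
def pauliTilde (A B : Space → Space) : Set (Hil × Hil) :=
  formOperator (formDomain A) (pauliTildeForm A B)

/-- `P_A` has a zero mode: some nonzero `u ∈ L²` lies in its domain and `P_A u = 0`. -/
def HasZeroMode (A B : Space → Space) : Prop :=
  ∃ u : Hil, u ≠ 0 ∧ (u, (0 : Hil)) ∈ pauliOperator A B

/-! ### Square roots -/

/-- `D` is a nonnegative self-adjoint operator with `D ∘ D = T` (domains included), where `T` is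
given by its graph. -/
def IsNonnegSqrt (D : Hil →ₗ.[ℂ] Hil) (T : Set (Hil × Hil)) : Prop :=
  IsSelfAdjoint D ∧ (∀ u : D.domain, 0 ≤ RCLike.re ⟪(u : Hil), D u⟫_ℂ) ∧
    ∀ u f : Hil, (u, f) ∈ T ↔ ∃ w : Hil, (u, w) ∈ D.graph ∧ (w, f) ∈ D.graph

open Classical in
/-- The nonnegative self-adjoint square root of an operator given by its graph. It exists and is
unique for every nonnegative self-adjoint operator. -/
def opSqrt (T : Set (Hil × Hil)) : Hil →ₗ.[ℂ] Hil :=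
  if h : ∃ D : Hil →ₗ.[ℂ] Hil, IsNonnegSqrt D T then h.choose else 0

/-! ### The auxiliary space `𝓗~`, the unitary `U`, the operator `S` and `δ(B)` -/

/-- The domain of `D`, to be normed by `‖D u‖`. -/
def PreTilde (D : Hil →ₗ.[ℂ] Hil) : Type := D.domain

instance (D : Hil →ₗ.[ℂ] Hil) : AddCommGroup (PreTilde D) :=
  inferInstanceAs (AddCommGroup D.domain)

instance (D : Hil →ₗ.[ℂ] Hil) : Module ℂ (PreTilde D) :=
  inferInstanceAs (Module ℂ D.domain)

/-- `D` as a linear map on its domain. -/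
def preTildeMap (D : Hil →ₗ.[ℂ] Hil) : PreTilde D →ₗ[ℂ] Hil := D.toFun

instance (D : Hil →ₗ.[ℂ] Hil) : SeminormedAddCommGroup (PreTilde D) :=
  SeminormedAddCommGroup.induced (PreTilde D) Hil (preTildeMap D)

instance (D : Hil →ₗ.[ℂ] Hil) : NormedSpace ℂ (PreTilde D) :=
  NormedSpace.induced ℂ (PreTilde D) Hil (preTildeMap D)

/-- The inclusion of the domain of `D` in `L²`. -/
def preTildeIncl (D : Hil →ₗ.[ℂ] Hil) : PreTilde D →ₗ[ℂ] Hil := D.domain.subtype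

/-- The completion of the domain of `D` in the norm `‖D u‖`. For `D = (P_A + |B|)^{1/2}` the domain
is the form domain and `‖D u‖² = (u, (P_A + |B|) u)`. -/
abbrev Tilde (D : Hil →ₗ.[ℂ] Hil) : Type := Completion (PreTilde D)

open Classical in
/-- The bounded operator `U : 𝓗 → 𝓗~` that extends `D⁻¹`, that is `U (D u) = u`. -/
def tildeU (D : Hil →ₗ.[ℂ] Hil) : Hil →L[ℂ] Tilde D :=
  if h : ∃ U : Hil →L[ℂ] Tilde D, ∀ u : PreTilde D, U (preTildeMap D u) = (u : Tilde D)
  then h.choose else 0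

open Classical in
/-- Multiplication by `|B|^{1/2}` as a bounded operator `𝓗~ → 𝓗`. -/
def tildeMul (B : Space → Space) (D : Hil →ₗ.[ℂ] Hil) : Tilde D →L[ℂ] Hil :=
  if h : ∃ M : Tilde D →L[ℂ] Hil, ∀ u : PreTilde D,
    (M (u : Tilde D) =ᵐ[volume] fun x => ((√‖B x‖ : ℝ) : ℂ) • (preTildeIncl D u) x)
  then h.choose else 0

/-- `(P_A + |B|)^{1/2}`. -/
def pauliTildeSqrt (A B : Space → Space) : Hil →ₗ.[ℂ] Hil := opSqrt (pauliTilde A B)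

/-- `U : 𝓗 → 𝓗~`, the extension of `(P_A + |B|)^{-1/2}`. -/
def opU (A B : Space → Space) : Hil →L[ℂ] Tilde (pauliTildeSqrt A B) :=
  tildeU (pauliTildeSqrt A B)

/-- `S = |B|^{1/2} U`, the extension of `|B|^{1/2} (P_A + |B|)^{-1/2}`. -/
def opS (A B : Space → Space) : Hil →L[ℂ] Hil :=
  (tildeMul B (pauliTildeSqrt A B)).comp (opU A B)

/-- `δ(B) = inf {‖(1 - S* S) f‖ : ‖f‖ = 1, U f ∈ 𝓗}`. Here `U f ∈ 𝓗` means that the element `U f` of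
the completion is an element of the space that was completed, which consists of `L²` functions. -/
def delta (A B : Space → Space) : ℝ :=
  sInf {r : ℝ | ∃ f : Hil, ‖f‖ = 1 ∧
    (∃ u : PreTilde (pauliTildeSqrt A B), opU A B f = (u : Tilde (pauliTildeSqrt A B))) ∧
    r = ‖f - ContinuousLinearMap.adjoint (opS A B) (opS A B f)‖}

end Pauli

end

open MeasureTheory UniformSpace
open scoped ContDiff InnerProductSpace ENNReal

noncomputable section

namespace Pauli

/-! Write `D = (P_A + |B|)^{1/2}`, which is `sqrtMap` on the form domain. Since `S D u = |B|^{1/2}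
u`, the number `⟪D v, (1 - S* S) D u⟫` is the Pauli form of `v` and `u`
(`inner_one_sub_adjoint_opS`). The range of `D` is dense and `D` is injective, so zero modes `u`
correspond to nonzero vectors `D u` fixed by `S* S`. A zero mode thus gives an admissible unit
vector at which the infimum is attained with value zero.

For the converse, `S` is compact (`tendsto_opS_of_weak`). If unit vectors satisfy `f_n - S* S f_n →
0`, then along a weakly convergent subsequence `S* S f_n` converges in norm, hence so does `f_n`,
and the limit `g` is a unit vector with `S* S g = g`. What is left is to show that `g = D u` with
`u` in `L²`. A priori `U g` lies only in the completion, that is, it could be a zero-energy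
resonance.

The decay of `B` excludes resonances. For test functions the Lichnerowicz formula identifies the
Pauli form `q(φ)` with `‖σ · (p - A) φ‖²`. Applied to `ω φ`, with `ω = ⟨x⟩ / (1 + ε ⟨x⟩)`, and
combined with a pointwise sum of squares (`diracSq_shift`), it yields a Hardy inequality for the
Dirac operator (`weighted_dirac`). Far away `|B| ⟨x⟩²` is small and is absorbed, so that `‖(1 + ε
⟨x⟩)⁻¹ φ‖² ≤ 8 ε⁻² q(φ) + K ‖|B|^{1/2} φ‖²` with `K` independent of `ε` (`exists_damped_bound`). For
test functions with `D φ_n → g` the form `q(φ_n)` tends to `‖g‖² - ‖S g‖² = 0`. Letting `n → ∞` and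
then `ε → 0` bounds the `L²` norm of the limit, and a cutoff argument puts the limit in the form
domain (`exists_sqrtMap_eq_of_fixed`).

Compactness rests on the magnetic Sobolev inequality `‖φ‖_6² ≤ C ‖(p - A) φ‖²`, with `C` independent
of `A`. Together with Hölder it bounds `|B|^{1/2}` by the norm `‖D u‖`, with small bound for the
tails of `B`. On balls, `A ∈ L²_loc` gives gradient bounds only in `L¹`. This suffices for a Rellich
argument in `L¹`, and the `L⁶` bound upgrades it to `L²`.

The operator `D` itself comes from the Hilbert space `W` of the form `P_A + |B| + 1` and its
inclusion `ι` in `L²`: the resolvent is `R = ι ι*` and `D² = R⁻¹ - 1`. -/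

/-! ### Self-adjoint square roots of form operators -/

section Abstract

variable {H : Type*} [NormedAddCommGroup H] [InnerProductSpace ℂ H] [CompleteSpace H]
  {W : Type*} [NormedAddCommGroup W] [InnerProductSpace ℂ W] [CompleteSpace W]

/-- A self-adjoint partially defined operator is symmetric. -/
theorem inner_apply_eq_of_isSelfAdjoint {D : H →ₗ.[ℂ] H} (hD : IsSelfAdjoint D)
    (x y : D.domain) : ⟪D x, (y : H)⟫_ℂ = ⟪(x : H), D y⟫_ℂ := by
  have h := LinearPMap.adjoint_isFormalAdjoint hD.dense_domain
  rw [LinearPMap.isSelfAdjoint_def.1 hD] at h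
  exact h x y

/-- A vector that represents the functional `x ↦ ⟪y, D x⟫` is the value at `y` of the self-adjoint
operator `D`. -/
theorem mem_graph_of_isSelfAdjoint {D : H →ₗ.[ℂ] H} (hD : IsSelfAdjoint D) {y z : H}
    (h : ∀ x : D.domain, ⟪z, (x : H)⟫_ℂ = ⟪y, D x⟫_ℂ) : (y, z) ∈ D.graph := by
  have hy := LinearPMap.mem_adjoint_domain_of_exists y ⟨z, h⟩
  have h2 := LinearPMap.adjoint_apply_eq hD.dense_domain ⟨y, hy⟩ h
  have h3 : (y, z) ∈ D.adjoint.graph := by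
    rw [LinearPMap.mem_graph_iff]
    exact ⟨⟨y, hy⟩, rfl, h2⟩
  rwa [LinearPMap.isSelfAdjoint_def.1 hD] at h3

theorem isClosed_graph_of_isSelfAdjoint {D : H →ₗ.[ℂ] H} (hD : IsSelfAdjoint D) :
    IsClosed (D.graph : Set (H × H)) := hD.isClosed

/-- The operator `R⁻¹ - 1` has a nonnegative self-adjoint square root. -/
theorem exists_sqrt_of_resolvent (R : H →L[ℂ] H) (h0 : 0 ≤ R) (h1 : R ≤ 1)
    (hinj : Function.Injective R) :
    ∃ D : H →ₗ.[ℂ] H, IsSelfAdjoint D ∧ (∀ u : D.domain, 0 ≤ RCLike.re ⟪(u : H), D u⟫_ℂ) ∧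
      ∀ u f : H, (∃ k, u = R k ∧ f = k - R k) ↔ ∃ w : H, (u, w) ∈ D.graph ∧ (w, f) ∈ D.graph := by
  set C := CFC.sqrt R with hC
  set E := CFC.sqrt (1 - R) with hE
  have h1' : 0 ≤ 1 - R := sub_nonneg.2 h1
  have hC0 : 0 ≤ C := CFC.sqrt_nonneg _
  have hE0 : 0 ≤ E := CFC.sqrt_nonneg _
  have hCC : C * C = R := CFC.sqrt_mul_sqrt_self R h0
  have hEE : E * E = 1 - R := CFC.sqrt_mul_sqrt_self _ h1'
  have hRE : Commute R E := by
    have : Commute (1 - R) R := (Commute.one_left R).sub_left (Commute.refl R)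
    exact (this.cfcₙ_nnreal _).symm
  have hCE : Commute C E := hRE.cfcₙ_nnreal _
  have hFE : Commute (CFC.sqrt C) E := hCE.cfcₙ_nnreal _
  have hF0 : 0 ≤ CFC.sqrt C := CFC.sqrt_nonneg _
  have hFF : CFC.sqrt C * CFC.sqrt C = C := CFC.sqrt_mul_sqrt_self C hC0
  have sym : ∀ {X : H →L[ℂ] H}, 0 ≤ X → ∀ x y, ⟪X x, y⟫_ℂ = ⟪x, X y⟫_ℂ := by
    intro X hX x y
    exact ((ContinuousLinearMap.nonneg_iff_isPositive X).1 hX).isSymmetric x y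
  have hCCx : ∀ x, C (C x) = R x := fun x => by rw [← hCC]; rfl
  have hEEx : ∀ x, E (E x) = x - R x := fun x => by
    have := congrArg (fun X : H →L[ℂ] H => X x) hEE
    simpa using this
  have hCEx : ∀ x, C (E x) = E (C x) := fun x => congrArg (fun X : H →L[ℂ] H => X x) hCE.eq
  have hCinj : Function.Injective C := fun x y hxy => hinj (by rw [← hCCx, ← hCCx, hxy])
  -- The graph of `E C⁻¹`, with `C = √R` and `E = √(1 - R)`. As `C` and `E` commute, its square is
  -- `(1 - R) R⁻¹`.
  set g : Submodule ℂ (H × H) := LinearMap.range ((C : H →ₗ[ℂ] H).prod (E : H →ₗ[ℂ] H)) with hg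
  have memg : ∀ x y : H, (x, y) ∈ g ↔ ∃ f, C f = x ∧ E f = y := by
    intro x y
    simp [hg, LinearMap.mem_range, Prod.ext_iff]
  have hg0 : ∀ x : H × H, x ∈ g → x.1 = 0 → x.2 = 0 := by
    rintro ⟨x, y⟩ hx (h : x = 0)
    obtain ⟨f, rfl, rfl⟩ := (memg x y).1 hx
    have : f = 0 := hCinj (by simpa using h)
    simp [this]
  have hgraph : g.toLinearPMap.graph = g := Submodule.toLinearPMap_graph_eq g hg0
  set D := g.toLinearPMap with hD
  have hdense : Dense (D.domain : Set H) := by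
    rw [Submodule.dense_iff_topologicalClosure_eq_top, Submodule.topologicalClosure_eq_top_iff,
      Submodule.eq_bot_iff]
    intro y hy
    have h : ∀ f, ⟪f, C y⟫_ℂ = 0 := by
      intro f
      rw [← sym hC0]
      refine (Submodule.mem_orthogonal _ _).1 hy _ ?_
      rw [hD, Submodule.toLinearPMap_domain]
      exact ⟨(C f, E f), (memg _ _).2 ⟨f, rfl, rfl⟩, rfl⟩
    exact hCinj (by rw [map_zero]; exact inner_self_eq_zero.1 (h _))
  have hDx : ∀ x : D.domain, ∃ f, C f = x ∧ E f = D x := by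
    intro x
    have : ((x : H), D x) ∈ D.graph := D.mem_graph x
    rw [hgraph] at this
    exact (memg _ _).1 this
  refine ⟨D, ?_, ?_, ?_⟩
  · rw [LinearPMap.isSelfAdjoint_def]
    apply LinearPMap.eq_of_eq_graph
    rw [LinearPMap.adjoint_graph_eq_graph_adjoint hdense, hgraph]
    ext ⟨x, y⟩
    rw [Submodule.mem_adjoint_iff, memg]
    constructor
    · intro h
      have key : C y = E x := by
        refine ext_inner_left ℂ fun f => ?_
        have := h (C f) (E f) ((memg _ _).2 ⟨f, rfl, rfl⟩)
        rw [sym hC0, sym hE0, sub_eq_zero] at this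
        exact this.symm
      -- Since `C² + E² = 1`, the equations `C f = x` and `E f = y` force `f = C x + E y`.
      refine ⟨C x + E y, ?_, ?_⟩
      · rw [map_add, hCCx, hCEx, key, hEEx]; abel
      · rw [map_add, hEEx, ← hCEx, ← key, hCCx]; abel
    · rintro ⟨f, rfl, rfl⟩ a b hab
      obtain ⟨k, rfl, rfl⟩ := (memg a b).1 hab
      simp only
      rw [sym hE0, sym hC0, hCEx, sub_self]
  · intro u
    obtain ⟨f, hf1, hf2⟩ := hDx u
    rw [← hf1, ← hf2]
    -- A root of `C` is moved to the other side: `⟪C f, E f⟫ = ⟪√C f, E √C f⟫`, because `√C`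
    -- commutes with `E`.
    have : C f = CFC.sqrt C (CFC.sqrt C f) := by rw [← mul_apply_eq_comp, hFF]
    rw [this, sym hF0, ← mul_apply_eq_comp, hFE.eq, mul_apply_eq_comp]
    exact ((ContinuousLinearMap.nonneg_iff_isPositive E).1 hE0).re_inner_nonneg_right _
  · intro u f
    rw [hgraph]
    simp only [memg]
    constructor
    · rintro ⟨k, rfl, rfl⟩
      exact ⟨E (C k), ⟨C k, hCCx k, rfl⟩, ⟨E k, hCEx k, hEEx k⟩⟩
    · rintro ⟨w, ⟨a, rfl, rfl⟩, ⟨b, hb, rfl⟩⟩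
      have ha' : C (C a + E b) = a := by rw [map_add, hCCx, hCEx, hb, hEEx]; abel
      have hb' : E (C a + E b) = b := by rw [map_add, hEEx, ← hCEx, ← hb, hCCx]; abel
      exact ⟨C a + E b, by rw [← hCCx, ha'], by rw [← hEEx, hb']⟩

/-- The resolvent `ι ι*` attached to a bounded injection `ι` of Hilbert spaces is injective when `ι`
has dense range. -/
theorem injective_comp_adjoint {ι : W →L[ℂ] H} (hinj : Function.Injective ι)
    (hdense : DenseRange ι) : Function.Injective (ι ∘L ι.adjoint) := by
  refine (injective_iff_map_eq_zero _).2 fun k hk => ?_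
  have h1 : ι.adjoint k = 0 := hinj (by simpa using hk)
  refine hdense.eq_zero_of_inner_left ℂ fun v => ?_
  rw [← ContinuousLinearMap.adjoint_inner_left, h1, inner_zero_left]

theorem comp_adjoint_nonneg (ι : W →L[ℂ] H) : 0 ≤ ι ∘L ι.adjoint := by
  rw [ContinuousLinearMap.nonneg_iff_isPositive]
  exact ContinuousLinearMap.isPositive_self_comp_adjoint ι

theorem comp_adjoint_le_one {ι : W →L[ℂ] H} (hι : ‖ι‖ ≤ 1) : ι ∘L ι.adjoint ≤ 1 := by
  rw [ContinuousLinearMap.le_def, ContinuousLinearMap.isPositive_def']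
  refine ⟨?_, fun x => ?_⟩
  · exact (IsSelfAdjoint.one _).sub (ContinuousLinearMap.isPositive_self_comp_adjoint ι).isSelfAdjoint
  · rw [ContinuousLinearMap.reApplyInnerSelf_apply]
    simp only [_root_.sub_apply, one_apply_eq_self,
      ContinuousLinearMap.comp_apply, inner_sub_left, map_sub, sub_nonneg]
    rw [← ContinuousLinearMap.adjoint_inner_right, inner_self_eq_norm_sq, inner_self_eq_norm_sq]
    have : ‖ι.adjoint x‖ ≤ ‖x‖ := by
      refine (ι.adjoint.le_opNorm x).trans ?_
      rw [LinearIsometryEquiv.norm_map]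
      exact mul_le_of_le_one_left (norm_nonneg _) hι
    gcongr

theorem denseRange_adjoint {ι : W →L[ℂ] H} (hinj : Function.Injective ι) :
    DenseRange ι.adjoint := by
  have : Dense ((LinearMap.range (ι.adjoint : H →ₗ[ℂ] W)) : Set W) := by
    rw [Submodule.dense_iff_topologicalClosure_eq_top, Submodule.topologicalClosure_eq_top_iff,
      Submodule.eq_bot_iff]
    intro y hy
    refine hinj ?_
    rw [map_zero, ← inner_self_eq_zero (𝕜 := ℂ), ← ContinuousLinearMap.adjoint_inner_left]
    exact (Submodule.mem_orthogonal _ _).1 hy _ ⟨ι y, rfl⟩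
  exact this

/-- A self-adjoint operator `D` with `D² = (ι ι*)⁻¹ - 1` has domain `range ι`, where its form is
given by the inner product of `W`. -/
theorem sqrt_domain_and_form {ι : W →L[ℂ] H} (hinj : Function.Injective ι) {D : H →ₗ.[ℂ] H}
    (hD : IsSelfAdjoint D)
    (hsq : ∀ u f : H, (∃ k, u = ι (ι.adjoint k) ∧ f = k - ι (ι.adjoint k)) ↔
      ∃ w : H, (u, w) ∈ D.graph ∧ (w, f) ∈ D.graph) :
    (∀ u, u ∈ D.domain ↔ u ∈ Set.range ι) ∧
      ∀ (v w : W) (x y : D.domain), (x : H) = ι v → (y : H) = ι w →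
        ⟪D x, D y⟫_ℂ = ⟪v, w⟫_ℂ - ⟪ι v, ι w⟫_ℂ := by
  have hR : ∀ k, ∃ r : D.domain, (r : H) = ι (ι.adjoint k) ∧
      ∀ x : D.domain, ⟪D x, D r⟫_ℂ = ⟪(x : H), k⟫_ℂ - ⟪(x : H), ι (ι.adjoint k)⟫_ℂ := by
    intro k
    obtain ⟨w, h1, h2⟩ := (hsq _ _).1 ⟨k, rfl, rfl⟩
    obtain ⟨r, hr1, hr2⟩ := (LinearPMap.mem_graph_iff _).1 h1
    obtain ⟨r', hr1', hr2'⟩ := (LinearPMap.mem_graph_iff _).1 h2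
    simp only at hr1 hr2 hr1' hr2'
    refine ⟨r, hr1, fun x => ?_⟩
    rw [hr2, ← hr1', inner_apply_eq_of_isSelfAdjoint hD, hr2', inner_sub_right]
  choose r hr1 hr2 using hR
  have hrsub : ∀ k l, r (k - l) = r k - r l := by
    intro k l
    ext
    simp [hr1]
  -- Hence `ι* k ↦ D (r k)` is a contraction on the dense range of `ι*`. Closedness of `D` extends
  -- it to `W`, which puts `range ι` in the domain.
  have hnorm : ∀ k, ‖ι.adjoint k‖ ^ 2 = ‖D (r k)‖ ^ 2 + ‖(r k : H)‖ ^ 2 := by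
    intro k
    have h := hr2 k (r k)
    have h3 : ⟪(r k : H), k⟫_ℂ = ⟪ι.adjoint k, ι.adjoint k⟫_ℂ := by
      rw [hr1, ContinuousLinearMap.adjoint_inner_right]
    rw [← hr1, h3] at h
    have := congrArg RCLike.re h
    simp only [map_sub, inner_self_eq_norm_sq] at this
    linarith
  have hDom : ∀ w : W, ∃ y : D.domain, (y : H) = ι w ∧ ∃ k : ℕ → H,
      Filter.Tendsto (fun n => ι.adjoint (k n)) Filter.atTop (nhds w) ∧
      Filter.Tendsto (fun n => D (r (k n))) Filter.atTop (nhds (D y)) := by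
    intro w
    obtain ⟨a, ha, haw⟩ := mem_closure_iff_seq_limit.1 (denseRange_adjoint hinj w)
    choose k hk using ha
    have hcau : CauchySeq (fun n => D (r (k n))) := by
      have hc := haw.cauchySeq
      rw [Metric.cauchySeq_iff'] at hc ⊢
      intro ε hε
      obtain ⟨N, hN⟩ := hc ε hε
      refine ⟨N, fun n hn => lt_of_le_of_lt ?_ (hN n hn)⟩
      rw [dist_eq_norm, dist_eq_norm, ← hk, ← hk, ← map_sub, ← LinearPMap.map_sub, ← hrsub]
      refine le_of_sq_le_sq ?_ (norm_nonneg _)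
      rw [hnorm]
      nlinarith [sq_nonneg ‖(r (k n - k N) : H)‖]
    obtain ⟨z, hz⟩ := cauchySeq_tendsto_of_complete hcau
    have h1 : Filter.Tendsto (fun n => ((r (k n) : H), D (r (k n)))) Filter.atTop
        (nhds (ι w, z)) := by
      refine Filter.Tendsto.prodMk_nhds ?_ hz
      simp only [hr1, hk]
      exact (ι.continuous.tendsto w).comp haw
    have h2 := (isClosed_graph_of_isSelfAdjoint hD).mem_of_tendsto h1
      (Filter.Eventually.of_forall fun n => D.mem_graph _)
    obtain ⟨y, hy1, hy2⟩ := (LinearPMap.mem_graph_iff _).1 h2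
    refine ⟨y, hy1, k, by simpa only [hk] using haw, ?_⟩
    simp only at hy2
    rwa [hy2]
  have hform : ∀ (v w : W) (x y : D.domain), (x : H) = ι v → (y : H) = ι w →
      ⟪D x, D y⟫_ℂ = ⟪v, w⟫_ℂ - ⟪ι v, ι w⟫_ℂ := by
    intro v w x y hx hy
    obtain ⟨y', hy', k, hk1, hk2⟩ := hDom w
    have : y = y' := Subtype.ext (hy.trans hy'.symm)
    subst this
    have t1 : Filter.Tendsto (fun n => ⟪D x, D (r (k n))⟫_ℂ) Filter.atTop (nhds ⟪D x, D y⟫_ℂ) :=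
      tendsto_const_nhds.inner hk2
    have t2 : Filter.Tendsto (fun n => ⟪v, ι.adjoint (k n)⟫_ℂ - ⟪ι v, ι (ι.adjoint (k n))⟫_ℂ)
        Filter.atTop (nhds (⟪v, w⟫_ℂ - ⟪ι v, ι w⟫_ℂ)) :=
      (tendsto_const_nhds.inner hk1).sub
        (tendsto_const_nhds.inner ((ι.continuous.tendsto w).comp hk1))
    refine tendsto_nhds_unique t1 (t2.congr fun n => ?_)
    rw [hr2, hx, ContinuousLinearMap.adjoint_inner_right]
  have hmem : ∀ w : W, ι w ∈ D.domain := by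
    intro w
    obtain ⟨y, hy, -⟩ := hDom w
    rw [← hy]
    exact y.2
  refine ⟨fun u => ⟨fun hu => ?_, ?_⟩, hform⟩
  · let L₀ : W →ₗ[ℂ] H := D.toFun ∘ₗ (ι : W →ₗ[ℂ] H).codRestrict D.domain hmem
    have hL₀ : ∀ w, L₀ w = D ⟨ι w, hmem w⟩ := fun _ => rfl
    let L : W →L[ℂ] H := L₀.mkContinuous 1 fun w => by
      rw [one_mul, hL₀]
      refine le_of_sq_le_sq ?_ (norm_nonneg _)
      have := congrArg RCLike.re (hform w w ⟨ι w, hmem w⟩ ⟨ι w, hmem w⟩ rfl rfl)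
      simp only [map_sub, inner_self_eq_norm_sq] at this
      rw [this]
      nlinarith [sq_nonneg ‖ι w‖]
    -- For `u = ι w` the form identity reads `⟪w, v⟫ = ⟪D u, D ι v⟫ + ⟪u, ι v⟫`. With `L = D ι` this
    -- leaves only `w = L* D u + ι* u`, and testing with `v = ι* k` confirms it.
    refine ⟨L.adjoint (D ⟨u, hu⟩) + ι.adjoint u, ext_inner_right ℂ fun k => ?_⟩
    rw [← ContinuousLinearMap.adjoint_inner_right, inner_add_left,
      ContinuousLinearMap.adjoint_inner_left, ContinuousLinearMap.adjoint_inner_left]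
    have hLk : L (ι.adjoint k) = D (r k) := by
      change D ⟨ι (ι.adjoint k), _⟩ = D (r k)
      congr 1
      exact Subtype.ext (hr1 k).symm
    rw [hLk, hr2]
    abel
  · rintro ⟨w, rfl⟩
    exact hmem w

end Abstract

/-! ### Smooth compactly supported functions -/

/-- `φ ∈ C_c^∞(ℝ³, F)`. -/
def IsTest {F : Type*} [NormedAddCommGroup F] [NormedSpace ℝ F] (φ : Space → F) : Prop :=
  ContDiff ℝ ∞ φ ∧ HasCompactSupport φ

section Test

variable {F G : Type*} [NormedAddCommGroup F] [NormedSpace ℝ F] [NormedAddCommGroup G]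
  [NormedSpace ℝ G]

theorem partialDeriv_add {f g : Space → F} {x : Space} (j : Fin 3) (hf : DifferentiableAt ℝ f x)
    (hg : DifferentiableAt ℝ g x) :
    partialDeriv j (fun y => f y + g y) x = partialDeriv j f x + partialDeriv j g x := by
  simp only [partialDeriv]
  rw [fderiv_fun_add hf hg]
  rfl

theorem partialDeriv_sub {f g : Space → F} {x : Space} (j : Fin 3) (hf : DifferentiableAt ℝ f x)
    (hg : DifferentiableAt ℝ g x) :
    partialDeriv j (fun y => f y - g y) x = partialDeriv j f x - partialDeriv j g x := by
  simp only [partialDeriv]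
  rw [fderiv_fun_sub hf hg]
  rfl

theorem partialDeriv_smul {f : Space → ℝ} {g : Space → F} {x : Space} (j : Fin 3)
    (hf : DifferentiableAt ℝ f x) (hg : DifferentiableAt ℝ g x) :
    partialDeriv j (fun y => f y • g y) x =
      f x • partialDeriv j g x + partialDeriv j f x • g x := by
  simp only [partialDeriv]
  rw [fderiv_fun_smul hf hg]
  rfl

theorem partialDeriv_mul {f g : Space → ℝ} {x : Space} (j : Fin 3)
    (hf : DifferentiableAt ℝ f x) (hg : DifferentiableAt ℝ g x) :
    partialDeriv j (fun y => f y * g y) x =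
      f x * partialDeriv j g x + partialDeriv j f x * g x :=
  partialDeriv_smul j hf hg

theorem partialDeriv_clm (L : F →L[ℝ] G) {f : Space → F} {x : Space} (j : Fin 3)
    (hf : DifferentiableAt ℝ f x) :
    partialDeriv j (fun y => L (f y)) x = L (partialDeriv j f x) := by
  simp only [partialDeriv]
  rw [show (fun y => L (f y)) = L ∘ f from rfl, fderiv_comp _ L.differentiableAt hf, L.fderiv]
  rfl

namespace IsTest

variable {φ ψ : Space → F}

theorem differentiableAt (h : IsTest φ) (x : Space) : DifferentiableAt ℝ φ x :=
  h.1.differentiable (by simp) x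

theorem continuous (h : IsTest φ) : Continuous φ := h.1.continuous

theorem smul_left {f : Space → ℝ} (hf : ContDiff ℝ ∞ f) (hφ : IsTest φ) :
    IsTest (fun x => f x • φ x) :=
  ⟨hf.smul hφ.1, hφ.2.smul_left⟩

theorem mul {f g : Space → ℝ} (hf : ContDiff ℝ ∞ f) (hg : IsTest g) :
    IsTest (fun x => f x * g x) := smul_left hf hg

theorem clm (L : F →L[ℝ] G) (hφ : IsTest φ) : IsTest (fun x => L (φ x)) :=
  ⟨L.contDiff.comp hφ.1, hφ.2.comp_left (map_zero L)⟩

theorem partialDeriv (hφ : IsTest φ) (j : Fin 3) : IsTest (partialDeriv j φ) := by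
  refine ⟨?_, ?_⟩
  · exact (hφ.1.fderiv_right (m := ∞) (by simp)).clm_apply contDiff_const
  · refine (hφ.2.fderiv (𝕜 := ℝ)).mono' (subset_trans ?_ (subset_tsupport _))
    intro x hx h
    exact hx (by simp [Pauli.partialDeriv, h])

theorem integrable (hφ : IsTest φ) : Integrable φ := hφ.continuous.integrable_of_hasCompactSupport hφ.2

theorem memLp (hφ : IsTest φ) (p : ℝ≥0∞) : MemLp φ p := hφ.continuous.memLp_of_hasCompactSupport hφ.2

end IsTest

/-- The integral of a partial derivative of a test function vanishes. -/
theorem integral_partialDeriv {f : Space → F} (hf : IsTest f) (j : Fin 3) :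
    ∫ x, partialDeriv j f x = 0 := by
  have := integral_smul_fderiv_eq_neg_fderiv_smul_of_integrable (μ := (volume : Measure Space))
    (f := fun _ => (1 : ℝ)) (g := f) (v := EuclideanSpace.single j 1) (by simp)
    (by simpa using! (hf.partialDeriv j).integrable) (by simpa using hf.integrable)
    (fun _ _ => differentiableAt_const _) (fun x _ => hf.differentiableAt x)
  simpa [partialDeriv] using this

theorem integral_mul_partialDeriv {f g : Space → ℝ} (hf : ContDiff ℝ ∞ f) (hg : IsTest g)
    (j : Fin 3) : ∫ x, f x * partialDeriv j g x = - ∫ x, partialDeriv j f x * g x := by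
  have h := integral_partialDeriv (IsTest.mul hf hg) j
  have h1 : IsTest fun x => f x * partialDeriv j g x := IsTest.mul hf (hg.partialDeriv j)
  have h2 : IsTest fun x => partialDeriv j f x * g x :=
    IsTest.mul ((hf.fderiv_right (m := ∞) (by simp)).clm_apply contDiff_const) hg
  rw [funext fun x => partialDeriv_mul j (hf.differentiable (by simp) x) (hg.differentiableAt x),
    integral_add h1.integrable h2.integrable] at h
  linarith

theorem partialDeriv_comm {f : Space → ℝ} (hf : ContDiff ℝ ∞ f) (j k : Fin 3) (x : Space) :
    partialDeriv j (partialDeriv k f) x = partialDeriv k (partialDeriv j f) x := by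
  have hs : IsSymmSndFDerivAt ℝ f x :=
    (hf.contDiffAt).isSymmSndFDerivAt (by simpa using WithTop.coe_le_coe.2 (le_top (a := (2 : ℕ∞))))
  have hd : DifferentiableAt ℝ (fderiv ℝ f) x :=
    (hf.fderiv_right (m := ∞) (by simp)).differentiable (by simp) x
  have key : ∀ a b : Fin 3, partialDeriv a (partialDeriv b f) x =
      fderiv ℝ (fderiv ℝ f) x (EuclideanSpace.single a 1) (EuclideanSpace.single b 1) := by
    intro a b
    change fderiv ℝ (fun y => (fderiv ℝ f y) ((fun _ => EuclideanSpace.single b 1) y)) x _ = _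
    rw [fderiv_clm_apply hd (differentiableAt_const _)]
    simp
  rw [key, key]
  exact hs _ _

/-- A Jacobian determinant is a divergence: moving the derivative off `g` leaves `∂ⱼ ∂ₖ f` twice
with opposite signs. -/
theorem integral_jacobian {f g : Space → ℝ} (hf : IsTest f) (hg : IsTest g) (j k : Fin 3) :
    ∫ x, (partialDeriv j f x * partialDeriv k g x - partialDeriv k f x * partialDeriv j g x) = 0 := by
  rw [integral_sub (IsTest.mul (hf.partialDeriv j).1 (hg.partialDeriv k)).integrable
    (IsTest.mul (hf.partialDeriv k).1 (hg.partialDeriv j)).integrable,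
    integral_mul_partialDeriv (hf.partialDeriv j).1 hg, integral_mul_partialDeriv (hf.partialDeriv k).1 hg]
  simp only [partialDeriv_comm hf.1 j k, sub_self]

end Test

/-! ### The covariant derivative and the Lichnerowicz formula -/

/-- `((p - A) φ)ⱼ` for a differentiable spinor field `φ`. -/
def cov (A : Space → Space) (j : Fin 3) (φ : Space → Spinor) (x : Space) : Spinor :=
  (-Complex.I) • partialDeriv j φ x - ((A x j : ℝ) : ℂ) • φ x

/-- `|σ · p|²` for a triple `p` of spinors. -/
def diracSq (p : Fin 3 → Spinor) : ℝ :=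
  ‖p 2 0 + p 0 1 - Complex.I * p 1 1‖ ^ 2 + ‖p 0 0 + Complex.I * p 1 0 - p 2 1‖ ^ 2

/-- The spin density `⟨u, σₗ u⟩`. -/
def spin (l : Fin 3) (u : Spinor) : ℝ :=
  ![2 * ((u 0).re * (u 1).re + (u 0).im * (u 1).im), 2 * ((u 0).re * (u 1).im - (u 0).im * (u 1).re),
    (u 0).re ^ 2 + (u 0).im ^ 2 - (u 1).re ^ 2 - (u 1).im ^ 2] l

/-- The real and imaginary parts of the components of a spinor. -/
def comp (i : Fin 2) (b : Bool) : Spinor →L[ℝ] ℝ :=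
  (bif b then Complex.imCLM else Complex.reCLM) ∘L
    (EuclideanSpace.proj i : Spinor →L[ℂ] ℂ).restrictScalars ℝ

/-! ### Pointwise spinor algebra -/

theorem spinor_norm_sq (u : Spinor) :
    ‖u‖ ^ 2 = (u 0).re ^ 2 + (u 0).im ^ 2 + (u 1).re ^ 2 + (u 1).im ^ 2 := by
  rw [EuclideanSpace.norm_sq_eq, Fin.sum_univ_two, Complex.sq_norm, Complex.sq_norm,
    Complex.normSq_apply, Complex.normSq_apply]
  ring

theorem diracSq_nonneg (p : Fin 3 → Spinor) : 0 ≤ diracSq p := by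
  unfold diracSq
  positivity

theorem diracSq_smul (c : ℝ) (p : Fin 3 → Spinor) :
    diracSq (fun j => c • p j) = c ^ 2 * diracSq p := by
  simp only [diracSq, Complex.sq_norm, Complex.normSq_apply, PiLp.smul_apply, Complex.add_re,
    Complex.sub_re, Complex.mul_re, Complex.add_im, Complex.sub_im, Complex.mul_im, Complex.I_re,
    Complex.I_im, Complex.smul_re, Complex.smul_im, smul_eq_mul]
  ring

/-- The spin density is a vector of length `‖u‖²`, so this is Cauchy–Schwarz. The squares in the
last step are those of Lagrange's identity. -/
theorem abs_sum_mul_spin_le (b : Space) (u : Spinor) :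
    |∑ l, b l * spin l u| ≤ ‖b‖ * ‖u‖ ^ 2 := by
  refine abs_le_of_sq_le_sq ?_ (by positivity)
  have hb : ‖b‖ ^ 2 = b 0 ^ 2 + b 1 ^ 2 + b 2 ^ 2 := by
    rw [EuclideanSpace.norm_sq_eq, Fin.sum_univ_three]
    simp
  have hs : spin 0 u ^ 2 + spin 1 u ^ 2 + spin 2 u ^ 2 = (‖u‖ ^ 2) ^ 2 := by
    rw [spinor_norm_sq]
    simp only [spin, Matrix.cons_val]
    ring
  rw [mul_pow, hb, ← hs, Fin.sum_univ_three]
  nlinarith [sq_nonneg (b 0 * spin 1 u - b 1 * spin 0 u), sq_nonneg (b 0 * spin 2 u - b 2 * spin 0 u),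
    sq_nonneg (b 1 * spin 2 u - b 2 * spin 1 u)]

/-- The algebraic inequality behind the weighted estimate: the difference of the two sides is
`∑ⱼ |dⱼ - σⱼ (σ · V) ψ + Λⱼ ψ|²` with `dⱼ = i pⱼ`. -/
theorem diracSq_shift (p : Fin 3 → Spinor) (ψ : Spinor) (V L : Fin 3 → ℝ) :
    diracSq p - ∑ j, ‖p j‖ ^ 2 ≤ diracSq (fun j => p j + (Complex.I * (V j : ℂ)) • ψ)
      + 2 * ∑ j, L j * RCLike.re ⟪ψ, Complex.I • p j⟫_ℂ
      + (2 * ∑ j, V j ^ 2 - 2 * ∑ j, V j * L j + ∑ j, L j ^ 2) * ‖ψ‖ ^ 2 := by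
  simp only [diracSq, spinor_norm_sq, Fin.sum_univ_three, Complex.sq_norm, Complex.normSq_apply,
    PiLp.inner_apply, Fin.sum_univ_two, RCLike.inner_apply, PiLp.add_apply, PiLp.smul_apply,
    smul_eq_mul, RCLike.re_to_complex, Complex.conj_re, Complex.conj_im,
    Complex.add_re, Complex.ofReal_re, Complex.ofReal_im,
    Complex.sub_re, Complex.mul_re, Complex.add_im, Complex.sub_im, Complex.mul_im, Complex.I_re,
    Complex.I_im]
  -- `χ` denotes `(σ · V) ψ`. The twelve squares below are the real and imaginary parts of the
  -- components of `dⱼ - σⱼ χ + Λⱼ ψ`.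
  obtain ⟨χ0r, h1⟩ : ∃ y, y = V 2 * (ψ 0).re + V 0 * (ψ 1).re + V 1 * (ψ 1).im := ⟨_, rfl⟩
  obtain ⟨χ0i, h2⟩ : ∃ y, y = V 2 * (ψ 0).im + V 0 * (ψ 1).im - V 1 * (ψ 1).re := ⟨_, rfl⟩
  obtain ⟨χ1r, h3⟩ : ∃ y, y = V 0 * (ψ 0).re - V 1 * (ψ 0).im - V 2 * (ψ 1).re := ⟨_, rfl⟩
  obtain ⟨χ1i, h4⟩ : ∃ y, y = V 0 * (ψ 0).im + V 1 * (ψ 0).re - V 2 * (ψ 1).im := ⟨_, rfl⟩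
  have q0 := sq_nonneg (-(p 0 0).im - χ1r + L 0 * (ψ 0).re)
  have q1 := sq_nonneg ((p 0 0).re - χ1i + L 0 * (ψ 0).im)
  have q2 := sq_nonneg (-(p 0 1).im - χ0r + L 0 * (ψ 1).re)
  have q3 := sq_nonneg ((p 0 1).re - χ0i + L 0 * (ψ 1).im)
  have q4 := sq_nonneg (-(p 1 0).im - χ1i + L 1 * (ψ 0).re)
  have q5 := sq_nonneg ((p 1 0).re + χ1r + L 1 * (ψ 0).im)
  have q6 := sq_nonneg (-(p 1 1).im + χ0i + L 1 * (ψ 1).re)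
  have q7 := sq_nonneg ((p 1 1).re - χ0r + L 1 * (ψ 1).im)
  have q8 := sq_nonneg (-(p 2 0).im - χ0r + L 2 * (ψ 0).re)
  have q9 := sq_nonneg ((p 2 0).re - χ0i + L 2 * (ψ 0).im)
  have q10 := sq_nonneg (-(p 2 1).im + χ1r + L 2 * (ψ 1).re)
  have q11 := sq_nonneg ((p 2 1).re + χ1i + L 2 * (ψ 1).im)
  subst h1 h2 h3 h4
  linarith

/-! ### Calculus of spinor fields and covariant derivatives -/

theorem re_partialDeriv {φ : Space → Spinor} {x : Space} (hφ : DifferentiableAt ℝ φ x) (j : Fin 3)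
    (i : Fin 2) : (partialDeriv j φ x i).re = partialDeriv j (fun y => (φ y i).re) x :=
  (partialDeriv_clm (comp i false) j hφ).symm

theorem im_partialDeriv {φ : Space → Spinor} {x : Space} (hφ : DifferentiableAt ℝ φ x) (j : Fin 3)
    (i : Fin 2) : (partialDeriv j φ x i).im = partialDeriv j (fun y => (φ y i).im) x :=
  (partialDeriv_clm (comp i true) j hφ).symm

theorem IsTest.re {φ : Space → Spinor} (hφ : IsTest φ) (i : Fin 2) :
    IsTest fun x => (φ x i).re := hφ.clm (comp i false)

theorem IsTest.im {φ : Space → Spinor} (hφ : IsTest φ) (i : Fin 2) :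
    IsTest fun x => (φ x i).im := hφ.clm (comp i true)

/-- A locally `L²` function times a continuous compactly supported function is in `L²`. -/
theorem memLp_smul_of_hasCompactSupport {E : Type*} [NormedAddCommGroup E] [NormedSpace ℝ E]
    {p : ℝ≥0∞} {f : Space → ℝ} {g : Space → E}
    (hf : ∀ K : Set Space, IsCompact K → MemLp f p (volume.restrict K)) (hg : Continuous g)
    (hgc : HasCompactSupport g) : MemLp (fun x => f x • g x) p := by
  obtain ⟨C, hC⟩ := hg.bounded_above_of_compact_support hgc
  have h1 : MemLp (fun x => f x • g x) p (volume.restrict (tsupport g)) := by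
    refine (hf _ hgc).of_le_mul (c := C) ((hf _ hgc).1.smul hg.aestronglyMeasurable) ?_
    refine Filter.Eventually.of_forall fun x => ?_
    rw [norm_smul, mul_comm]
    exact mul_le_mul_of_nonneg_right (hC x) (norm_nonneg _)
  have h2 : (tsupport g).indicator (fun x => f x • g x) = fun x => f x • g x := by
    rw [Set.indicator_eq_self]
    intro x hx
    exact subset_tsupport g fun h => hx (by simp [h])
  rw [← h2]
  exact (memLp_indicator_iff_restrict (isClosed_tsupport g).measurableSet).2 h1

theorem IsL2Loc.coord {A : Space → Space} (hA : IsL2Loc A) (j : Fin 3) (K : Set Space)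
    (hK : IsCompact K) : MemLp (fun x => A x j) 2 (volume.restrict K) :=
  (EuclideanSpace.proj j : Space →L[ℝ] ℝ).comp_memLp' (hA K hK)

theorem memLp_cov {A : Space → Space} (hA : IsL2Loc A) {φ : Space → Spinor} (hφ : IsTest φ)
    (j : Fin 3) : MemLp (cov A j φ) 2 :=
  (((hφ.partialDeriv j).memLp 2).const_smul (-Complex.I)).sub
    (memLp_smul_of_hasCompactSupport (hA.coord j) hφ.continuous hφ.2)

theorem integrable_cov_sq {A : Space → Space} (hA : IsL2Loc A) {φ : Space → Spinor} (hφ : IsTest φ)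
    (j : Fin 3) : Integrable fun x => ‖cov A j φ x‖ ^ 2 :=
  (memLp_cov hA hφ j).integrable_norm_pow (by simp)

theorem cov_smul (A : Space → Space) {f : Space → ℝ} {φ : Space → Spinor} {x : Space} (j : Fin 3)
    (hf : DifferentiableAt ℝ f x) (hφ : DifferentiableAt ℝ φ x) :
    cov A j (fun y => f y • φ y) x =
      f x • cov A j φ x - (Complex.I * ((partialDeriv j f x : ℝ) : ℂ)) • φ x := by
  simp only [cov, partialDeriv_smul j hf hφ]
  ext i
  simp only [PiLp.sub_apply, PiLp.smul_apply, PiLp.add_apply, smul_eq_mul, Complex.real_smul]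
  ring

theorem IsTest.norm_sq {φ : Space → Spinor} (hφ : IsTest φ) : IsTest fun x => ‖φ x‖ ^ 2 :=
  ⟨hφ.1.norm_sq ℝ, by
    refine hφ.2.mono' (subset_trans ?_ (subset_tsupport φ))
    intro x hx h
    exact hx (by simp [h])⟩

/-- The potential enters `⟪φ, i (p - A)ⱼ φ⟫` through a purely imaginary term, so the real part does
not see it. -/
theorem partialDeriv_norm_sq (A : Space → Space) {φ : Space → Spinor} (hφ : IsTest φ) (j : Fin 3)
    (x : Space) :
    partialDeriv j (fun y => ‖φ y‖ ^ 2) x = 2 * RCLike.re ⟪φ x, Complex.I • cov A j φ x⟫_ℂ := by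
  have h : HasFDerivAt (fun y => ‖φ y‖ ^ 2) _ x := (hφ.differentiableAt x).hasFDerivAt.norm_sq
  have hr : ∀ u v : Spinor, ⟪u, v⟫_ℝ = RCLike.re ⟪u, v⟫_ℂ := fun u v => by
    simp [PiLp.inner_apply]
  rw [partialDeriv, h.fderiv]
  change 2 • ⟪φ x, partialDeriv j φ x⟫_ℝ = _
  have h0 : (Complex.I * ((A x j : ℝ) : ℂ) * ((‖φ x‖ : ℝ) : ℂ) ^ 2).re = 0 := by
    rw [show Complex.I * ((A x j : ℝ) : ℂ) * ((‖φ x‖ : ℝ) : ℂ) ^ 2 =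
      ((A x j * ‖φ x‖ ^ 2 : ℝ) : ℂ) * Complex.I by push_cast; ring, Complex.re_ofReal_mul]
    simp
  have h1 : RCLike.re ⟪φ x, Complex.I • ((A x j : ℝ) : ℂ) • φ x⟫_ℂ = 0 := by
    rw [smul_smul, inner_smul_right, inner_self_eq_norm_sq_to_K]
    exact h0
  rw [hr, cov, smul_sub, inner_sub_right, map_sub, h1, smul_smul]
  simp

theorem IsTest.spin {φ : Space → Spinor} (hφ : IsTest φ) (l : Fin 3) :
    IsTest fun x => Pauli.spin l (φ x) := by
  refine ⟨?_, hφ.2.comp_left (g := Pauli.spin l) ?_⟩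
  · have h0 := (hφ.re 0).1
    have h1 := (hφ.re 1).1
    have h2 := (hφ.im 0).1
    have h3 := (hφ.im 1).1
    fin_cases l <;> simp only [Pauli.spin, Fin.isValue] <;> dsimp <;> fun_prop
  · fin_cases l <;> simp [Pauli.spin]

theorem partialDeriv_const_mul {f : Space → ℝ} {x : Space} (c : ℝ) (j : Fin 3)
    (hf : DifferentiableAt ℝ f x) :
    partialDeriv j (fun y => c * f y) x = c * partialDeriv j f x := by
  rw [partialDeriv_mul j (differentiableAt_const c) hf]
  simp [partialDeriv]

/-- The Jacobian determinant `∂ⱼ f ∂ₖ g - ∂ₖ f ∂ⱼ g`. -/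
def jacobian (j k : Fin 3) (f g : Space → ℝ) (x : Space) : ℝ :=
  partialDeriv j f x * partialDeriv k g x - partialDeriv k f x * partialDeriv j g x

theorem integrable_jacobian {f g : Space → ℝ} (hf : IsTest f) (hg : IsTest g) (j k : Fin 3) :
    Integrable (jacobian j k f g) :=
  (IsTest.mul (hf.partialDeriv j).1 (hg.partialDeriv k)).integrable.sub
    (IsTest.mul (hf.partialDeriv k).1 (hg.partialDeriv j)).integrable

/-- The sum of the Jacobian determinants in the Lichnerowicz formula. -/
def spinJacobian (φ : Space → Spinor) (x : Space) : ℝ :=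
  -2 * jacobian 0 1 (fun y => (φ y 0).re) (fun y => (φ y 0).im) x
    + 2 * jacobian 0 1 (fun y => (φ y 1).re) (fun y => (φ y 1).im) x
    - 2 * jacobian 1 2 (fun y => (φ y 0).re) (fun y => (φ y 1).im) x
    - 2 * jacobian 1 2 (fun y => (φ y 1).re) (fun y => (φ y 0).im) x
    + 2 * jacobian 2 0 (fun y => (φ y 0).re) (fun y => (φ y 1).re) x
    + 2 * jacobian 2 0 (fun y => (φ y 0).im) (fun y => (φ y 1).im) x

theorem partialDeriv_spin_zero {φ : Space → Spinor} (hφ : IsTest φ) (j : Fin 3) (x : Space) :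
    partialDeriv j (fun y => spin 0 (φ y)) x =
      2 * ((φ x 0).re * (partialDeriv j φ x 1).re + (partialDeriv j φ x 0).re * (φ x 1).re
        + (φ x 0).im * (partialDeriv j φ x 1).im + (partialDeriv j φ x 0).im * (φ x 1).im) := by
  have h := fun i => (hφ.re i).differentiableAt x
  have h' := fun i => (hφ.im i).differentiableAt x
  change partialDeriv j (fun y => 2 * ((φ y 0).re * (φ y 1).re + (φ y 0).im * (φ y 1).im)) x = _
  rw [partialDeriv_const_mul _ _ (((h 0).fun_mul (h 1)).fun_add ((h' 0).fun_mul (h' 1))),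
    partialDeriv_add j ((h 0).fun_mul (h 1)) ((h' 0).fun_mul (h' 1)), partialDeriv_mul j (h 0) (h 1),
    partialDeriv_mul j (h' 0) (h' 1)]
  simp only [re_partialDeriv (hφ.differentiableAt x), im_partialDeriv (hφ.differentiableAt x)]
  ring

theorem partialDeriv_spin_one {φ : Space → Spinor} (hφ : IsTest φ) (j : Fin 3) (x : Space) :
    partialDeriv j (fun y => spin 1 (φ y)) x =
      2 * ((φ x 0).re * (partialDeriv j φ x 1).im + (partialDeriv j φ x 0).re * (φ x 1).im
        - (φ x 0).im * (partialDeriv j φ x 1).re - (partialDeriv j φ x 0).im * (φ x 1).re) := by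
  have h := fun i => (hφ.re i).differentiableAt x
  have h' := fun i => (hφ.im i).differentiableAt x
  change partialDeriv j (fun y => 2 * ((φ y 0).re * (φ y 1).im - (φ y 0).im * (φ y 1).re)) x = _
  rw [partialDeriv_const_mul _ _ (((h 0).fun_mul (h' 1)).fun_sub ((h' 0).fun_mul (h 1))),
    partialDeriv_sub j ((h 0).fun_mul (h' 1)) ((h' 0).fun_mul (h 1)), partialDeriv_mul j (h 0) (h' 1),
    partialDeriv_mul j (h' 0) (h 1)]
  simp only [re_partialDeriv (hφ.differentiableAt x), im_partialDeriv (hφ.differentiableAt x)]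
  ring

theorem partialDeriv_spin_two {φ : Space → Spinor} (hφ : IsTest φ) (j : Fin 3) (x : Space) :
    partialDeriv j (fun y => spin 2 (φ y)) x =
      2 * ((φ x 0).re * (partialDeriv j φ x 0).re + (φ x 0).im * (partialDeriv j φ x 0).im
        - (φ x 1).re * (partialDeriv j φ x 1).re - (φ x 1).im * (partialDeriv j φ x 1).im) := by
  have h := fun i => (hφ.re i).differentiableAt x
  have h' := fun i => (hφ.im i).differentiableAt x
  have he : (fun y => spin 2 (φ y)) = fun y => (φ y 0).re * (φ y 0).re + (φ y 0).im * (φ y 0).im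
      - (φ y 1).re * (φ y 1).re - (φ y 1).im * (φ y 1).im := by
    funext y
    change (φ y 0).re ^ 2 + (φ y 0).im ^ 2 - (φ y 1).re ^ 2 - (φ y 1).im ^ 2 = _
    ring
  rw [he, partialDeriv_sub j ((((h 0).fun_mul (h 0)).fun_add ((h' 0).fun_mul (h' 0))).fun_sub ((h 1).fun_mul (h 1)))
    ((h' 1).fun_mul (h' 1)),
    partialDeriv_sub j (((h 0).fun_mul (h 0)).fun_add ((h' 0).fun_mul (h' 0))) ((h 1).fun_mul (h 1)),
    partialDeriv_add j ((h 0).fun_mul (h 0)) ((h' 0).fun_mul (h' 0)), partialDeriv_mul j (h 0) (h 0),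
    partialDeriv_mul j (h' 0) (h' 0), partialDeriv_mul j (h 1) (h 1),
    partialDeriv_mul j (h' 1) (h' 1)]
  simp only [re_partialDeriv (hφ.differentiableAt x), im_partialDeriv (hφ.differentiableAt x)]
  ring

/-- The pointwise Lichnerowicz formula: up to Jacobian determinants, which are divergences,
`|σ · (p - A) φ|² - |(p - A) φ|²` is a first order expression in the spin density. -/
theorem diracSq_cov (A : Space → Space) {φ : Space → Spinor} (hφ : IsTest φ) (x : Space) :
    diracSq (fun j => cov A j φ x) = ∑ j, ‖cov A j φ x‖ ^ 2 + spinJacobian φ x -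
      ∑ l : Fin 3, (A x (l + 1) * partialDeriv (l + 2) (fun y => spin l (φ y)) x
        - A x (l + 2) * partialDeriv (l + 1) (fun y => spin l (φ y)) x) := by
  have e1 : (0 + 1 : Fin 3) = 1 := rfl
  have e2 : (0 + 2 : Fin 3) = 2 := rfl
  have e3 : (1 + 1 : Fin 3) = 2 := rfl
  have e4 : (1 + 2 : Fin 3) = 0 := rfl
  have e5 : (2 + 1 : Fin 3) = 0 := rfl
  have e6 : (2 + 2 : Fin 3) = 1 := rfl
  simp only [Fin.sum_univ_three, e1, e2, e3, e4, e5, e6, partialDeriv_spin_zero hφ,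
    partialDeriv_spin_one hφ, partialDeriv_spin_two hφ, spinJacobian, jacobian,
    ← re_partialDeriv (hφ.differentiableAt x), ← im_partialDeriv (hφ.differentiableAt x)]
  simp only [diracSq, spinor_norm_sq, Complex.sq_norm, Complex.normSq_apply, cov,
    PiLp.sub_apply, PiLp.smul_apply, smul_eq_mul, Complex.neg_re, Complex.neg_im,
    Complex.add_re, Complex.ofReal_re, Complex.ofReal_im,
    Complex.sub_re, Complex.mul_re, Complex.add_im, Complex.sub_im, Complex.mul_im, Complex.I_re,
    Complex.I_im]
  ring

theorem integral_spinJacobian {φ : Space → Spinor} (hφ : IsTest φ) :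
    Integrable (spinJacobian φ) ∧ ∫ x, spinJacobian φ x = 0 := by
  have h : ∀ {f g : Space → ℝ} (c : ℝ) (j k : Fin 3), IsTest f → IsTest g →
      Integrable (fun x => c * jacobian j k f g x) ∧ ∫ x, c * jacobian j k f g x = 0 := by
    intro f g c j k hf hg
    refine ⟨(integrable_jacobian hf hg j k).const_mul c, ?_⟩
    rw [integral_const_mul]
    exact mul_eq_zero_of_right _ (integral_jacobian hf hg j k)
  have hadd : ∀ {f g : Space → ℝ}, (Integrable f ∧ ∫ x, f x = 0) → (Integrable g ∧ ∫ x, g x = 0) →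
      Integrable (fun x => f x + g x) ∧ ∫ x, (f x + g x) = 0 := fun hf hg =>
    ⟨hf.1.add hg.1, by rw [integral_add hf.1 hg.1, hf.2, hg.2, add_zero]⟩
  have hsub : ∀ {f g : Space → ℝ}, (Integrable f ∧ ∫ x, f x = 0) → (Integrable g ∧ ∫ x, g x = 0) →
      Integrable (fun x => f x - g x) ∧ ∫ x, (f x - g x) = 0 := fun hf hg =>
    ⟨hf.1.sub hg.1, by rw [integral_sub hf.1 hg.1, hf.2, hg.2, sub_zero]⟩
  exact hadd (hadd (hsub (hsub (hadd (h (-2) 0 1 (hφ.re 0) (hφ.im 0)) (h 2 0 1 (hφ.re 1) (hφ.im 1)))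
    (h 2 1 2 (hφ.re 0) (hφ.im 1))) (h 2 1 2 (hφ.re 1) (hφ.im 0))) (h 2 2 0 (hφ.re 0) (hφ.re 1)))
    (h 2 2 0 (hφ.im 0) (hφ.im 1))

theorem integrable_locL2_mul {A : Space → Space} (hA : IsL2Loc A) {f : Space → ℝ} (hf : IsTest f)
    (j : Fin 3) : Integrable fun x => A x j * f x := by
  have h : ∀ K : Set Space, IsCompact K → MemLp (fun x => A x j) 1 (volume.restrict K) := by
    intro K hK
    have : IsFiniteMeasure (volume.restrict K : Measure Space) :=
      ⟨by simpa using hK.measure_lt_top⟩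
    exact (hA.coord j K hK).mono_exponent (by norm_num)
  exact memLp_one_iff_integrable.1 (memLp_smul_of_hasCompactSupport h hf.continuous hf.2)

theorem integrable_field_mul {B : Space → Space} (hB : MemLp B (3 / 2) volume) {f : Space → ℝ}
    (hf : IsTest f) (j : Fin 3) : Integrable fun x => B x j * f x := by
  have h : ∀ K : Set Space, IsCompact K → MemLp (fun x => B x j) 1 (volume.restrict K) := by
    intro K hK
    have : IsFiniteMeasure (volume.restrict K : Measure Space) :=
      ⟨by simpa using hK.measure_lt_top⟩
    refine ((EuclideanSpace.proj j : Space →L[ℝ] ℝ).comp_memLp' (hB.restrict K)).mono_exponent ?_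
    rw [ENNReal.le_div_iff_mul_le (by simp) (by simp)]
    norm_num
  exact memLp_one_iff_integrable.1 (memLp_smul_of_hasCompactSupport h hf.continuous hf.2)

/-- The Lichnerowicz formula `‖σ · (p - A) φ‖² = ‖(p - A) φ‖² - (φ, σ · B φ)`, and the integrability
of the terms. -/
theorem lichnerowicz {A B : Space → Space} (hA : IsL2Loc A) (hB : MemLp B (3 / 2) volume)
    (hcurl : HasWeakCurl A B) {φ : Space → Spinor} (hφ : IsTest φ) :
    Integrable (fun x => diracSq fun j => cov A j φ x) ∧
    Integrable (fun x => ∑ l, B x l * spin l (φ x)) ∧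
    ∫ x, diracSq (fun j => cov A j φ x) =
      (∫ x, ∑ j, ‖cov A j φ x‖ ^ 2) - ∫ x, ∑ l, B x l * spin l (φ x) := by
  have i1 : Integrable fun x => ∑ j, ‖cov A j φ x‖ ^ 2 :=
    integrable_finsetSum _ fun j _ => integrable_cov_sq hA hφ j
  have i2 := (integral_spinJacobian hφ).1
  have i3 : ∀ l : Fin 3, Integrable fun x =>
      A x (l + 1) * partialDeriv (l + 2) (fun y => spin l (φ y)) x
        - A x (l + 2) * partialDeriv (l + 1) (fun y => spin l (φ y)) x := fun l =>
    (integrable_locL2_mul hA ((hφ.spin l).partialDeriv _) _).sub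
      (integrable_locL2_mul hA ((hφ.spin l).partialDeriv _) _)
  have i4 : ∀ l, Integrable fun x => B x l * spin l (φ x) := fun l =>
    integrable_field_mul hB (hφ.spin l) l
  have i3' := integrable_finsetSum Finset.univ fun l _ => i3 l
  refine ⟨?_, integrable_finsetSum _ fun l _ => i4 l, ?_⟩
  · simp only [diracSq_cov A hφ]
    exact (i1.add i2).sub i3'
  · simp only [diracSq_cov A hφ]
    have i12 : Integrable fun x => ∑ j, ‖cov A j φ x‖ ^ 2 + spinJacobian φ x := i1.add i2
    rw [integral_sub i12 i3', integral_add i1 i2, (integral_spinJacobian hφ).2, add_zero,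
      integral_finsetSum _ fun l _ => i3 l, integral_finsetSum _ fun l _ => i4 l]
    congr 1
    -- The distributional curl is tested against the spin density, so `A` is never differentiated.
    exact Finset.sum_congr rfl fun l _ => (hcurl _ (hφ.spin l).1 (hφ.spin l).2 l).symm

/-! ### The Sobolev inequality -/

theorem norm_fderiv_le_sum {F : Type*} [NormedAddCommGroup F] [NormedSpace ℝ F] (f : Space → F)
    (x : Space) : ‖fderiv ℝ f x‖ ≤ ∑ j, ‖partialDeriv j f x‖ := by
  refine ContinuousLinearMap.opNorm_le_bound _ (Finset.sum_nonneg fun _ _ => norm_nonneg _) fun v => ?_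
  have hv : v = ∑ j, v j • (EuclideanSpace.single j (1 : ℝ) : Space) := by
    ext i
    simp [Pi.single_apply]
  have h1 : fderiv ℝ f x v = ∑ j, v j • partialDeriv j f x := by
    conv_lhs => rw [hv]
    simp [partialDeriv]
  rw [h1, Finset.sum_mul]
  refine (norm_sum_le _ _).trans (Finset.sum_le_sum fun j _ => ?_)
  rw [norm_smul, mul_comm]
  gcongr
  exact PiLp.norm_apply_le v j

/-- `‖(p - A) φ‖²` as an extended nonnegative number. -/
def covEnergy (A : Space → Space) (φ : Space → Spinor) : ℝ≥0∞ :=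
  ∫⁻ x, ∑ j, ‖cov A j φ x‖ₑ ^ 2

/-- The diamagnetic inequality, squared so that `|φ|` is not differentiated at its zeros. -/
theorem abs_partialDeriv_norm_sq_le (A : Space → Space) {φ : Space → Spinor} (hφ : IsTest φ)
    (j : Fin 3) (x : Space) :
    |partialDeriv j (fun y => ‖φ y‖ ^ 2) x| ≤ 2 * (‖φ x‖ * ‖cov A j φ x‖) := by
  rw [partialDeriv_norm_sq A hφ, abs_mul, abs_two]
  gcongr
  refine (RCLike.abs_re_le_norm _).trans ((norm_inner_le_norm _ _).trans (le_of_eq ?_))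
  rw [norm_smul, Complex.norm_I, one_mul]

theorem aemeasurable_cov_enorm {A : Space → Space} (hA : IsL2Loc A) {φ : Space → Spinor}
    (hφ : IsTest φ) (j : Fin 3) : AEMeasurable (fun x => ‖cov A j φ x‖ₑ) :=
  (memLp_cov hA hφ j).1.enorm

theorem enorm_fderiv_norm_pow_le (A : Space → Space) {φ : Space → Spinor} (hφ : IsTest φ)
    (x : Space) : ‖fderiv ℝ (fun x => ‖φ x‖ ^ 2 * ‖φ x‖ ^ 2) x‖ₑ ≤
      ∑ j, 4 * (‖φ x‖ₑ ^ 3 * ‖cov A j φ x‖ₑ) := by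
  have h1 : ‖fderiv ℝ (fun x => ‖φ x‖ ^ 2 * ‖φ x‖ ^ 2) x‖ ≤
      ∑ j, 4 * (‖φ x‖ ^ 3 * ‖cov A j φ x‖) := by
    refine (norm_fderiv_le_sum _ _).trans (Finset.sum_le_sum fun j _ => ?_)
    rw [partialDeriv_mul j (hφ.norm_sq.differentiableAt x) (hφ.norm_sq.differentiableAt x),
      Real.norm_eq_abs]
    have h2 := abs_partialDeriv_norm_sq_le A hφ j x
    rw [mul_comm, ← mul_add, abs_mul, abs_of_nonneg (by positivity : 0 ≤ ‖φ x‖ ^ 2 + ‖φ x‖ ^ 2)]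
    calc _ ≤ 2 * (‖φ x‖ * ‖cov A j φ x‖) * (‖φ x‖ ^ 2 + ‖φ x‖ ^ 2) := by gcongr
      _ = _ := by ring
  have h3 := ENNReal.ofReal_le_ofReal h1
  rw [ofReal_norm, ENNReal.ofReal_sum_of_nonneg (fun _ _ => by positivity)] at h3
  refine h3.trans (le_of_eq (Finset.sum_congr rfl fun j _ => ?_))
  rw [ENNReal.ofReal_mul (by norm_num), ENNReal.ofReal_mul (by positivity),
    ENNReal.ofReal_pow (norm_nonneg _), ofReal_norm, ofReal_norm]
  norm_num

theorem lintegral_fderiv_norm_pow_le {A : Space → Space} (hA : IsL2Loc A) {φ : Space → Spinor}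
    (hφ : IsTest φ) : ∫⁻ x, ‖fderiv ℝ (fun x => ‖φ x‖ ^ 2 * ‖φ x‖ ^ 2) x‖ₑ ≤
      12 * ((∫⁻ x, ‖φ x‖ₑ ^ 6) ^ (1 / 2 : ℝ) * covEnergy A φ ^ (1 / 2 : ℝ)) := by
  obtain ⟨X, hX⟩ : ∃ X, X = ∫⁻ x, ‖φ x‖ₑ ^ 6 := ⟨_, rfl⟩
  obtain ⟨Y, hY⟩ : ∃ Y, Y = covEnergy A φ := ⟨_, rfl⟩
  rw [← hX, ← hY]
  refine (lintegral_mono fun x => enorm_fderiv_norm_pow_le A hφ x).trans ?_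
  have hm : ∀ j, AEMeasurable fun x => 4 * (‖φ x‖ₑ ^ 3 * ‖cov A j φ x‖ₑ) := fun j =>
    (((hφ.continuous.enorm.measurable.pow_const 3).aemeasurable).mul
      (aemeasurable_cov_enorm hA hφ j)).const_mul 4
  rw [lintegral_finsetSum' _ fun j _ => hm j]
  have hj : ∀ j, ∫⁻ x, 4 * (‖φ x‖ₑ ^ 3 * ‖cov A j φ x‖ₑ) ≤
      4 * (X ^ (1 / 2 : ℝ) * Y ^ (1 / 2 : ℝ)) := by
    intro j
    rw [lintegral_const_mul' _ _ (by simp)]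
    gcongr
    refine (ENNReal.lintegral_mul_le_Lp_mul_Lq volume Real.HolderConjugate.two_two
      (hφ.continuous.enorm.measurable.pow_const 3).aemeasurable
      (aemeasurable_cov_enorm hA hφ j)).trans ?_
    rw [hX, hY]
    gcongr ?_ ^ _ * ?_ ^ _
    · refine le_of_eq (lintegral_congr fun x => ?_)
      rw [← ENNReal.rpow_natCast, ← ENNReal.rpow_natCast, ← ENNReal.rpow_mul]
      norm_num
    · refine lintegral_mono fun x => ?_
      rw [ENNReal.rpow_two]
      exact Finset.single_le_sum (f := fun j => ‖cov A j φ x‖ₑ ^ 2) (fun _ _ => zero_le)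
        (Finset.mem_univ j)
  refine (Finset.sum_le_sum fun j _ => hj j).trans (le_of_eq ?_)
  simp only [Finset.sum_const, Finset.card_univ, Fintype.card_fin, nsmul_eq_mul]
  rw [← mul_assoc]
  norm_num

/-- The fourth power of the hypothesis is `X⁴ ≤ c⁴ 12⁶ X³ Y³`. Finiteness of `X` allows division by
`X³`, and a cube root follows. -/
theorem rpow_estimate {X Y c : ℝ≥0∞} (hXtop : X ≠ ⊤)
    (h : X ≤ c * (12 * (X ^ (1 / 2 : ℝ) * Y ^ (1 / 2 : ℝ))) ^ (3 / 2 : ℝ)) :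
    X ^ (1 / 3 : ℝ) ≤ (c ^ 4 * 12 ^ 6) ^ (1 / 3 : ℝ) * Y := by
  have h4 : X ^ 4 ≤ c ^ 4 * 12 ^ 6 * (X ^ 3 * Y ^ 3) := by
    calc X ^ 4 ≤ (c * (12 * (X ^ (1 / 2 : ℝ) * Y ^ (1 / 2 : ℝ))) ^ (3 / 2 : ℝ)) ^ 4 := by gcongr
      _ = _ := by
        rw [mul_pow, mul_assoc]
        congr 1
        rw [← ENNReal.rpow_natCast, ← ENNReal.rpow_mul]
        norm_num
        rw [mul_pow, mul_pow,
          ← ENNReal.rpow_natCast (_ ^ _), ← ENNReal.rpow_natCast (_ ^ _), ← ENNReal.rpow_mul,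
          ← ENNReal.rpow_mul, ← ENNReal.rpow_natCast X 3, ← ENNReal.rpow_natCast Y 3]
        norm_num
  have h5 : X ≤ c ^ 4 * 12 ^ 6 * Y ^ 3 := by
    rcases eq_or_ne X 0 with h0 | h0
    · rw [h0]; exact zero_le
    · have h3 : X ^ 3 ≠ 0 := pow_ne_zero _ h0
      have h3' : X ^ 3 ≠ ⊤ := ENNReal.pow_ne_top hXtop
      rw [← ENNReal.mul_le_mul_iff_right h3 h3']
      calc X ^ 3 * X = X ^ 4 := by ring
        _ ≤ _ := h4
        _ = _ := by ring
  calc X ^ (1 / 3 : ℝ) ≤ (c ^ 4 * 12 ^ 6 * Y ^ 3) ^ (1 / 3 : ℝ) := by gcongr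
    _ = _ := by
      rw [ENNReal.mul_rpow_of_nonneg _ _ (by norm_num), ← ENNReal.rpow_natCast Y,
        ← ENNReal.rpow_mul]
      norm_num

/-- The magnetic Sobolev inequality. -/
theorem exists_sobolev_const : ∃ C : ℝ≥0∞, C ≠ ⊤ ∧ ∀ A : Space → Space, IsL2Loc A →
    ∀ φ : Space → Spinor, IsTest φ →
      (∫⁻ x, ‖φ x‖ₑ ^ 6) ^ (1 / 3 : ℝ) ≤ C * covEnergy A φ := by
  have hp : Real.HolderConjugate (Module.finrank ℝ Space) (3 / 2) := by
    rw [Real.holderConjugate_iff]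
    simp
    norm_num
  set c : NNReal := lintegralPowLePowLIntegralFDerivConst (volume : Measure Space) (3 / 2) with hc
  refine ⟨((c : ℝ≥0∞) ^ 4 * 12 ^ 6) ^ (1 / 3 : ℝ),
    ENNReal.rpow_ne_top_of_nonneg (by norm_num) (by finiteness), fun A hA φ hφ => ?_⟩
  have hXtop : ∫⁻ x, ‖φ x‖ₑ ^ 6 ≠ ⊤ := by
    have hi := (IsTest.mul hφ.norm_sq.1 (IsTest.mul hφ.norm_sq.1 hφ.norm_sq)).integrable
    have h := hi.hasFiniteIntegral
    simp only [← pow_add] at h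
    simp only [HasFiniteIntegral, enorm_pow, enorm_norm] at h
    exact h.ne
  -- The `W^{1,1}` inequality is applied to `|φ|⁴`: this is smooth, its power `3/2` is `|φ|⁶`, and
  -- its gradient is at most `4 |φ|³ ∑ⱼ |(p - A)ⱼ φ|`.
  have hu : IsTest fun x => ‖φ x‖ ^ 2 * ‖φ x‖ ^ 2 := IsTest.mul hφ.norm_sq.1 hφ.norm_sq
  have gns := lintegral_pow_le_pow_lintegral_fderiv (volume : Measure Space)
    (hu.1.of_le (by simp)) hu.2 hp
  have hl : ∀ x, ‖‖φ x‖ ^ 2 * ‖φ x‖ ^ 2‖ₑ ^ (3 / 2 : ℝ) = ‖φ x‖ₑ ^ 6 := by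
    intro x
    rw [← pow_add, enorm_pow, enorm_norm, ← ENNReal.rpow_natCast, ← ENNReal.rpow_mul,
      ← ENNReal.rpow_natCast]
    norm_num
  simp only [hl] at gns
  refine rpow_estimate hXtop (gns.trans ?_)
  gcongr
  exact lintegral_fderiv_norm_pow_le hA hφ

/-- The constant in the magnetic Sobolev inequality. -/
def sobolevConst : ℝ≥0∞ := exists_sobolev_const.choose

theorem sobolevConst_ne_top : sobolevConst ≠ ⊤ := exists_sobolev_const.choose_spec.1

theorem sobolev {A : Space → Space} (hA : IsL2Loc A) {φ : Space → Spinor} (hφ : IsTest φ) :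
    (∫⁻ x, ‖φ x‖ₑ ^ 6) ^ (1 / 3 : ℝ) ≤ sobolevConst * covEnergy A φ :=
  exists_sobolev_const.choose_spec.2 A hA φ hφ

/-- Hölder with exponents `3/2` and `3`, then Sobolev. The target space of `B` is left general
because the bound is also used for scalar truncations of `|B|`. -/
theorem lintegral_field_le {E : Type*} [NormedAddCommGroup E] {B : Space → E}
    (hB : AEStronglyMeasurable B) {A : Space → Space} (hA : IsL2Loc A)
    {φ : Space → Spinor} (hφ : IsTest φ) :
    ∫⁻ x, ‖B x‖ₑ * ‖φ x‖ₑ ^ 2 ≤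
      (∫⁻ x, ‖B x‖ₑ ^ (3 / 2 : ℝ)) ^ (2 / 3 : ℝ) * (sobolevConst * covEnergy A φ) := by
  have hpq : Real.HolderConjugate (3 / 2) 3 := by
    rw [Real.holderConjugate_iff]; norm_num
  refine (ENNReal.lintegral_mul_le_Lp_mul_Lq volume hpq hB.enorm
    (hφ.continuous.enorm.measurable.pow_const 2).aemeasurable).trans ?_
  rw [show (1 / (3 / 2) : ℝ) = 2 / 3 by norm_num]
  gcongr
  refine le_trans (le_of_eq ?_) (sobolev hA hφ)
  congr 1
  refine lintegral_congr fun x => ?_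
  rw [← ENNReal.rpow_natCast, ← ENNReal.rpow_natCast, ← ENNReal.rpow_mul]
  norm_num

/-! ### The weighted estimate for the Dirac operator -/

/-- The Japanese bracket `(1 + |x|²)^{1/2}`. -/
def bracket (x : Space) : ℝ := √(1 + ‖x‖ ^ 2)

/-- The bounded weight `(1 + ε ⟨x⟩)⁻¹`. -/
def damp (ε : ℝ) (x : Space) : ℝ := (1 + ε * bracket x)⁻¹

theorem bracket_sq (x : Space) : bracket x ^ 2 = 1 + ‖x‖ ^ 2 := Real.sq_sqrt (by positivity)

theorem bracket_pos (x : Space) : 0 < bracket x := Real.sqrt_pos.2 (by positivity)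

theorem contDiff_bracket : ContDiff ℝ ∞ bracket :=
  (contDiff_const.add (contDiff_norm_sq ℝ)).sqrt fun x => by positivity

theorem damp_pos {ε : ℝ} (hε : 0 < ε) (x : Space) : 0 < damp ε x :=
  inv_pos.2 (by have := bracket_pos x; positivity)

theorem contDiff_damp {ε : ℝ} (hε : 0 < ε) : ContDiff ℝ ∞ (damp ε) :=
  (contDiff_const.add (contDiff_const.mul contDiff_bracket)).inv fun x => by
    have := bracket_pos x
    positivity

theorem damp_mul {ε : ℝ} (hε : 0 < ε) (x : Space) : damp ε x * (1 + ε * bracket x) = 1 :=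
  inv_mul_cancel₀ (by have := bracket_pos x; positivity)

theorem damp_le_one {ε : ℝ} (hε : 0 < ε) (x : Space) : damp ε x ≤ 1 :=
  inv_le_one_of_one_le₀ (by have := bracket_pos x; nlinarith [mul_pos hε this])

theorem partialDeriv_one_add_norm_sq (j : Fin 3) (x : Space) :
    partialDeriv j (fun y : Space => 1 + ‖y‖ ^ 2) x = 2 * x j := by
  have h : HasFDerivAt (fun y : Space => 1 + ‖y‖ ^ 2) _ x :=
    ((hasFDerivAt_id x).norm_sq).const_add 1
  rw [partialDeriv, h.fderiv]
  simp [EuclideanSpace.inner_single_right]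

theorem partialDeriv_bracket (j : Fin 3) (x : Space) :
    partialDeriv j bracket x = x j / bracket x := by
  have hd : DifferentiableAt ℝ (fun y : Space => 1 + ‖y‖ ^ 2) x :=
    (contDiff_const.add (contDiff_norm_sq ℝ (n := 1))).differentiable (by simp) x
  have h := (hd.hasFDerivAt.sqrt (by positivity)).fderiv
  have h1 := partialDeriv_one_add_norm_sq j x
  have h2 := bracket_pos x
  rw [partialDeriv, show bracket = fun y => √(1 + ‖y‖ ^ 2) from rfl, h]
  change (1 / (2 * √(1 + ‖x‖ ^ 2))) • partialDeriv j (fun y : Space => 1 + ‖y‖ ^ 2) x = _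
  rw [h1, smul_eq_mul]
  change _ = x j / √(1 + ‖x‖ ^ 2)
  field_simp

theorem partialDeriv_inv {f : Space → ℝ} {x : Space} (j : Fin 3) (hf : DifferentiableAt ℝ f x)
    (h0 : f x ≠ 0) : partialDeriv j (fun y => (f y)⁻¹) x = -(f x ^ 2)⁻¹ * partialDeriv j f x := by
  have h := ((hasDerivAt_inv h0).comp_hasFDerivAt x hf.hasFDerivAt).fderiv
  rw [partialDeriv, show (fun y => (f y)⁻¹) = Inv.inv ∘ f from rfl, h]
  rfl

theorem partialDeriv_damp {ε : ℝ} (hε : 0 < ε) (j : Fin 3) (x : Space) :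
    partialDeriv j (damp ε) x = -ε * damp ε x ^ 2 * (x j / bracket x) := by
  have hb : DifferentiableAt ℝ bracket x := contDiff_bracket.differentiable (by simp) x
  have h2 := bracket_pos x
  rw [show damp ε = fun y => (1 + ε * bracket y)⁻¹ from rfl,
    partialDeriv_inv j ((differentiableAt_const _).fun_add (hb.const_mul ε)) (by positivity),
    partialDeriv_add j (differentiableAt_const _) (hb.const_mul ε), partialDeriv_const_mul ε j hb,
    partialDeriv_bracket]
  have : partialDeriv j (fun _ : Space => (1 : ℝ)) x = 0 := by simp [partialDeriv]
  rw [this, inv_pow]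
  ring

/-- The weight `⟨x⟩ / (1 + ε ⟨x⟩)`. -/
def weight (ε : ℝ) (x : Space) : ℝ := bracket x * damp ε x

theorem contDiff_weight {ε : ℝ} (hε : 0 < ε) : ContDiff ℝ ∞ (weight ε) :=
  contDiff_bracket.mul (contDiff_damp hε)

theorem weight_pos {ε : ℝ} (hε : 0 < ε) (x : Space) : 0 < weight ε x :=
  mul_pos (bracket_pos x) (damp_pos hε x)

theorem weight_le {ε : ℝ} (hε : 0 < ε) (x : Space) : weight ε x ≤ ε⁻¹ := by
  rw [le_inv_comm₀ (weight_pos hε x) hε, ← one_div, le_div_iff₀ (weight_pos hε x)]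
  have := damp_mul hε x
  have := damp_pos hε x
  unfold weight
  nlinarith

theorem partialDeriv_weight {ε : ℝ} (hε : 0 < ε) (j : Fin 3) (x : Space) :
    partialDeriv j (weight ε) x = damp ε x ^ 2 * (x j / bracket x) := by
  have h2 := bracket_pos x
  rw [show weight ε = fun y => bracket y * damp ε y from rfl,
    partialDeriv_mul j (contDiff_bracket.differentiable (by simp) x)
      ((contDiff_damp hε).differentiable (by simp) x), partialDeriv_bracket, partialDeriv_damp hε]
  have := damp_mul hε x
  linear_combination (-(x j / bracket x) * damp ε x) * this

/-- The vector field used in the weighted estimate. -/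
def shiftField (ε : ℝ) (j : Fin 3) (x : Space) : ℝ :=
  (damp ε x + 1 / 2) * ((1 + ‖x‖ ^ 2)⁻¹ * x j)

theorem contDiff_one_add_norm_sq_inv : ContDiff ℝ ∞ fun x : Space => (1 + ‖x‖ ^ 2)⁻¹ :=
  (contDiff_const.add (contDiff_norm_sq ℝ)).inv fun x => by positivity

theorem contDiff_coord (j : Fin 3) : ContDiff ℝ ∞ fun x : Space => x j :=
  (EuclideanSpace.proj j : Space →L[ℝ] ℝ).contDiff

theorem contDiff_shiftField {ε : ℝ} (hε : 0 < ε) (j : Fin 3) : ContDiff ℝ ∞ (shiftField ε j) :=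
  ((contDiff_damp hε).add contDiff_const).mul (contDiff_one_add_norm_sq_inv.mul (contDiff_coord j))

theorem partialDeriv_shiftField {ε : ℝ} (hε : 0 < ε) (j : Fin 3) (x : Space) :
    partialDeriv j (shiftField ε j) x =
      -ε * damp ε x ^ 2 * (x j / bracket x) * ((1 + ‖x‖ ^ 2)⁻¹ * x j)
      + (damp ε x + 1 / 2) * ((1 + ‖x‖ ^ 2)⁻¹ - 2 * x j ^ 2 * ((1 + ‖x‖ ^ 2)⁻¹) ^ 2) := by
  have hd := (contDiff_damp hε).differentiable (by simp) x
  have hq := contDiff_one_add_norm_sq_inv.differentiable (by simp) x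
  have hc := (contDiff_coord j).differentiable (by simp) x
  have hdiff : DifferentiableAt ℝ (fun y : Space => 1 + ‖y‖ ^ 2) x :=
    (contDiff_const.add (contDiff_norm_sq ℝ (n := 1))).differentiable (by simp) x
  have h0 : partialDeriv j (fun _ : Space => (1 / 2 : ℝ)) x = 0 := by simp [partialDeriv]
  have h1 : partialDeriv j (fun y : Space => y j) x = 1 := by
    rw [partialDeriv]
    erw [(EuclideanSpace.proj j : Space →L[ℝ] ℝ).fderiv]
    simp
  rw [show shiftField ε j = fun y => (damp ε y + 1 / 2) * ((1 + ‖y‖ ^ 2)⁻¹ * y j) from rfl,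
    partialDeriv_mul j (hd.fun_add (differentiableAt_const _)) (hq.fun_mul hc),
    partialDeriv_mul j hq hc, partialDeriv_add j hd (differentiableAt_const _), partialDeriv_damp hε,
    h0, h1, partialDeriv_inv j hdiff (by positivity), partialDeriv_one_add_norm_sq, inv_pow]
  ring

theorem space_norm_sq (x : Space) : ‖x‖ ^ 2 = x 0 ^ 2 + x 1 ^ 2 + x 2 ^ 2 := by
  rw [EuclideanSpace.norm_sq_eq, Fin.sum_univ_three]
  simp

/-- Let `b` be the damping factor, `s = ⟨x⟩`, `V = b x / s²` and `Λ = V + c x / s²`. Then `2 V² - 2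
V · Λ + Λ² = V² + (Λ - V)²`, and the right side has leading part `b² (c - c²)` for large `s`. The
choice `c = 1/2` in `shiftField` maximises it and gives the constant `1/4`; the exact value is `b²
(1/4 + (3 b + 5/4) / s²)`. -/
theorem weight_inequality {ε : ℝ} (hε : 0 < ε) (x : Space) :
    damp ε x ^ 2 / 4 ≤ (∑ j, partialDeriv j (shiftField ε j) x
      - (2 * ∑ j, (damp ε x * ((1 + ‖x‖ ^ 2)⁻¹ * x j)) ^ 2
        - 2 * ∑ j, (damp ε x * ((1 + ‖x‖ ^ 2)⁻¹ * x j)) * shiftField ε j x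
        + ∑ j, shiftField ε j x ^ 2)) * weight ε x ^ 2 := by
  simp only [partialDeriv_shiftField hε, shiftField, Fin.sum_univ_three, weight]
  have hs := bracket_pos x
  have hs2 := bracket_sq x
  have hb := damp_pos hε x
  have hm := damp_mul hε x
  have hR := space_norm_sq x
  have hq : (1 + ‖x‖ ^ 2)⁻¹ = (bracket x ^ 2)⁻¹ := by rw [hs2]
  rw [hq]
  generalize damp ε x = b at *
  generalize bracket x = s at *
  generalize x 0 = a0 at *
  generalize x 1 = a1 at *
  generalize x 2 = a2 at *
  -- Eliminating `ε` and one coordinate makes the claim a rational identity in `b` and `s`.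
  have hε' : ε = (1 - b) / (b * s) := by
    rw [eq_div_iff (by positivity)]
    linear_combination hm
  have ha : a0 ^ 2 = s ^ 2 - 1 - a1 ^ 2 - a2 ^ 2 := by linear_combination -hR - hs2
  subst hε'
  have : (b ^ 2 * (1 / 4 + (3 * b + 5 / 4) / s ^ 2)) - b ^ 2 / 4 ≥ 0 := by
    have : 0 ≤ b ^ 2 * ((3 * b + 5 / 4) / s ^ 2) := by positivity
    linarith
  refine le_trans (sub_nonneg.1 this) (le_of_eq ?_)
  field_simp
  ring_nf
  simp only [ha]
  ring

theorem integrable_norm_field_mul {B : Space → Space} (hB : MemLp B (3 / 2) volume) {f : Space → ℝ}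
    (hf : IsTest f) : Integrable fun x => ‖B x‖ * f x := by
  have h : ∀ K : Set Space, IsCompact K → MemLp (fun x => ‖B x‖) 1 (volume.restrict K) := by
    intro K hK
    have : IsFiniteMeasure (volume.restrict K : Measure Space) :=
      ⟨by simpa using hK.measure_lt_top⟩
    refine (hB.restrict K).norm.mono_exponent ?_
    rw [ENNReal.le_div_iff_mul_le (by simp) (by simp)]
    norm_num
  exact memLp_one_iff_integrable.1 (memLp_smul_of_hasCompactSupport h hf.continuous hf.2)

theorem integrable_weight_diracSq {A B : Space → Space} (hA : IsL2Loc A)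
    (hB : MemLp B (3 / 2) volume) (hcurl : HasWeakCurl A B) {φ : Space → Spinor} (hφ : IsTest φ)
    {ε : ℝ} (hε : 0 < ε) :
    Integrable fun x => weight ε x ^ 2 * diracSq (fun j => cov A j φ x) := by
  refine (lichnerowicz hA hB hcurl hφ).1.bdd_mul (c := (ε⁻¹) ^ 2)
    ((contDiff_weight hε).continuous.pow 2).aestronglyMeasurable
    (Filter.Eventually.of_forall fun x => ?_)
  rw [norm_pow, Real.norm_of_nonneg (weight_pos hε x).le]
  have := weight_pos hε x
  gcongr
  exact weight_le hε x

/-- The weighted estimate for the Dirac operator. -/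
theorem weighted_dirac {A B : Space → Space} (hA : IsL2Loc A) (hB : MemLp B (3 / 2) volume)
    (hcurl : HasWeakCurl A B) {φ : Space → Spinor} (hφ : IsTest φ) {ε : ℝ} (hε : 0 < ε) :
    ∫ x, damp ε x ^ 2 / 4 * ‖φ x‖ ^ 2 ≤
      (∫ x, weight ε x ^ 2 * diracSq (fun j => cov A j φ x))
        + ∫ x, ‖B x‖ * (weight ε x ^ 2 * ‖φ x‖ ^ 2) := by
  set ψ : Space → Spinor := fun x => weight ε x • φ x with hψdef
  have hψ : IsTest ψ := IsTest.smul_left (contDiff_weight hε) hφ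
  have hψn : ∀ x, ‖ψ x‖ ^ 2 = weight ε x ^ 2 * ‖φ x‖ ^ 2 := fun x => by
    rw [hψdef, norm_smul, mul_pow, Real.norm_eq_abs, sq_abs]
  -- The logarithmic gradient `∇ω / ω` of the weight `ω`.
  set V : Fin 3 → Space → ℝ := fun j x => damp ε x * ((1 + ‖x‖ ^ 2)⁻¹ * x j) with hV
  have hVc : ∀ j, ContDiff ℝ ∞ (V j) := fun j =>
    (contDiff_damp hε).mul (contDiff_one_add_norm_sq_inv.mul (contDiff_coord j))
  set Z : Space → ℝ := fun x => 2 * ∑ j, V j x ^ 2 - 2 * ∑ j, V j x * shiftField ε j x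
        + ∑ j, shiftField ε j x ^ 2 with hZ
  have hLc := contDiff_shiftField hε
  have hZc : ContDiff ℝ ∞ Z := by
    refine ((contDiff_const.mul (ContDiff.sum fun j _ => (hVc j).pow 2)).sub
      (contDiff_const.mul (ContDiff.sum fun j _ => (hVc j).mul (hLc j)))).add
      (ContDiff.sum fun j _ => (hLc j).pow 2)
  have hVw : ∀ j x, V j x * weight ε x = partialDeriv j (weight ε) x := by
    intro j x
    change damp ε x * ((1 + ‖x‖ ^ 2)⁻¹ * x j) * (bracket x * damp ε x) = _
    rw [partialDeriv_weight hε, ← bracket_sq]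
    have := bracket_pos x
    field_simp
  -- Commuting the weight through `p - A` produces exactly the shift by `i V` that `diracSq_shift`
  -- allows.
  have hshift : ∀ x, (fun j => cov A j ψ x + (Complex.I * ((V j x : ℝ) : ℂ)) • ψ x) =
      fun j => weight ε x • cov A j φ x := by
    intro x
    funext j
    rw [hψdef, cov_smul A j ((contDiff_weight hε).differentiable (by simp) x)
      (hφ.differentiableAt x), ← hVw]
    ext i
    simp only [PiLp.sub_apply, PiLp.smul_apply, PiLp.add_apply, smul_eq_mul, Complex.real_smul]
    push_cast
    ring
  have hpt : ∀ x, diracSq (fun j => cov A j ψ x) - ∑ j, ‖cov A j ψ x‖ ^ 2 ≤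
      weight ε x ^ 2 * diracSq (fun j => cov A j φ x)
        + ∑ j, shiftField ε j x * partialDeriv j (fun y => ‖ψ y‖ ^ 2) x + Z x * ‖ψ x‖ ^ 2 := by
    intro x
    have h := diracSq_shift (fun j => cov A j ψ x) (ψ x) (fun j => V j x) (fun j => shiftField ε j x)
    rw [hshift, diracSq_smul] at h
    refine h.trans (le_of_eq ?_)
    congr 2
    rw [Finset.mul_sum]
    refine Finset.sum_congr rfl fun j _ => ?_
    rw [partialDeriv_norm_sq A hψ]
    ring
  obtain ⟨i1, i2, hL⟩ := lichnerowicz hA hB hcurl hψ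
  have i3 : Integrable fun x => ∑ j, ‖cov A j ψ x‖ ^ 2 :=
    integrable_finsetSum _ fun j _ => integrable_cov_sq hA hψ j
  have i4 := integrable_weight_diracSq hA hB hcurl hφ hε
  have i5 : ∀ j, Integrable fun x => shiftField ε j x * partialDeriv j (fun y => ‖ψ y‖ ^ 2) x :=
    fun j => (IsTest.mul (hLc j) (hψ.norm_sq.partialDeriv j)).integrable
  have i5' := integrable_finsetSum Finset.univ fun j _ => i5 j
  have i6 : Integrable fun x => Z x * ‖ψ x‖ ^ 2 := (IsTest.mul hZc hψ.norm_sq).integrable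
  have i45 : Integrable fun x => weight ε x ^ 2 * diracSq (fun j => cov A j φ x)
        + ∑ j, shiftField ε j x * partialDeriv j (fun y => ‖ψ y‖ ^ 2) x := i4.add i5'
  have hint := integral_mono (i1.sub i3) (i45.add i6) hpt
  have hdc : ∀ j, ContDiff ℝ ∞ (partialDeriv j (shiftField ε j)) := fun j =>
    ((hLc j).fderiv_right (m := ∞) (by simp)).clm_apply contDiff_const
  have i7 : ∀ j, Integrable fun x => partialDeriv j (shiftField ε j) x * ‖ψ x‖ ^ 2 := fun j =>
    (IsTest.mul (hdc j) hψ.norm_sq).integrable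
  -- The cross term `Λ · ∇|ψ|²` becomes `-(div Λ) |ψ|²`, which supplies the positive part of the
  -- Hardy weight.
  have e1 : ∫ x, ∑ j, shiftField ε j x * partialDeriv j (fun y => ‖ψ y‖ ^ 2) x =
      - ∫ x, (∑ j, partialDeriv j (shiftField ε j) x) * ‖ψ x‖ ^ 2 := by
    simp only [Finset.sum_mul]
    rw [integral_finsetSum _ fun j _ => i5 j, integral_finsetSum _ fun j _ => i7 j,
      ← Finset.sum_neg_distrib]
    exact Finset.sum_congr rfl fun j _ => integral_mul_partialDeriv (hLc j) hψ.norm_sq j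
  have i7' : Integrable fun x => (∑ j, partialDeriv j (shiftField ε j) x) * ‖ψ x‖ ^ 2 := by
    simp only [Finset.sum_mul]
    exact integrable_finsetSum _ fun j _ => i7 j
  simp only [Pi.sub_apply, Pi.add_apply] at hint
  rw [integral_sub i1 i3, hL, integral_add i45 i6, integral_add i4 i5', e1] at hint
  have i8 := integrable_norm_field_mul hB hψ.norm_sq
  have hB' : ∫ x, ∑ l, B x l * spin l (ψ x) ≤ ∫ x, ‖B x‖ * ‖ψ x‖ ^ 2 :=
    integral_mono i2 i8 fun x => (le_abs_self _).trans (abs_sum_mul_spin_le _ _)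
  have hfin : ∫ x, damp ε x ^ 2 / 4 * ‖φ x‖ ^ 2 ≤
      (∫ x, (∑ j, partialDeriv j (shiftField ε j) x) * ‖ψ x‖ ^ 2) - ∫ x, Z x * ‖ψ x‖ ^ 2 := by
    rw [← integral_sub i7' i6]
    have hdd : ContDiff ℝ ∞ fun x => damp ε x ^ 2 / 4 := ((contDiff_damp hε).pow 2).div_const 4
    refine integral_mono (IsTest.mul hdd hφ.norm_sq).integrable (i7'.sub i6) fun x => ?_
    simp only [hψn]
    have := mul_le_mul_of_nonneg_right (weight_inequality hε x) (sq_nonneg ‖φ x‖)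
    refine this.trans (le_of_eq ?_)
    simp only [hZ, hV]
    ring
  simp only [← hψn]
  linarith

/-- Outside a large ball the magnetic field is dominated by the Hardy weight. -/
theorem exists_radius {B : Space → Space}
    (hdecay : ∃ β > (0 : ℝ), ∃ C ≥ (0 : ℝ), ∃ r₀ ≥ (0 : ℝ),
      ∀ᵐ x : Space, r₀ ≤ ‖x‖ → ‖B x‖ ≤ C * ‖x‖ ^ (-2 - β)) :
    ∃ R : ℝ, 0 < R ∧ ∀ᵐ x : Space, R ≤ ‖x‖ → ‖B x‖ * bracket x ^ 2 ≤ 1 / 8 := by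
  obtain ⟨β, hβ, C, hC, r₀, -, h⟩ := hdecay
  have ht : Filter.Tendsto (fun r : ℝ => 2 * C * r ^ (-β)) Filter.atTop (nhds (2 * C * 0)) :=
    (tendsto_rpow_neg_atTop hβ).const_mul _
  rw [mul_zero] at ht
  obtain ⟨R, hR⟩ := ((ht.eventually (gt_mem_nhds (by norm_num : (0 : ℝ) < 1 / 8))).and
    ((Filter.eventually_ge_atTop 1).and (Filter.eventually_ge_atTop r₀))).exists_forall_of_atTop
  refine ⟨max R 1, by positivity, ?_⟩
  filter_upwards [h] with x hx hRx
  obtain ⟨h1, h2, h3⟩ := hR ‖x‖ ((le_max_left _ _).trans hRx)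
  have h4 : 0 < ‖x‖ := by linarith
  have h5 : bracket x ^ 2 ≤ 2 * ‖x‖ ^ 2 := by rw [bracket_sq]; nlinarith
  calc ‖B x‖ * bracket x ^ 2 ≤ (C * ‖x‖ ^ (-2 - β)) * (2 * ‖x‖ ^ 2) := by
        gcongr
        exact hx h3
    _ = 2 * C * (‖x‖ ^ (-2 - β) * ‖x‖ ^ (2 : ℝ)) := by rw [Real.rpow_two]; ring
    _ = 2 * C * ‖x‖ ^ (-β) := by rw [← Real.rpow_add h4]; ring_nf
    _ ≤ 1 / 8 := h1.le

/-- A uniform bound on the damped `L²` norm. -/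
theorem exists_damped_bound {A B : Space → Space} (hA : IsL2Loc A) (hB : MemLp B (3 / 2) volume)
    (hcurl : HasWeakCurl A B)
    (hdecay : ∃ β > (0 : ℝ), ∃ C ≥ (0 : ℝ), ∃ r₀ ≥ (0 : ℝ),
      ∀ᵐ x : Space, r₀ ≤ ‖x‖ → ‖B x‖ ≤ C * ‖x‖ ^ (-2 - β)) :
    ∃ K : ℝ, 0 ≤ K ∧ ∀ φ : Space → Spinor, IsTest φ → ∀ ε : ℝ, 0 < ε →
      ∫ x, damp ε x ^ 2 * ‖φ x‖ ^ 2 ≤ 8 * (ε⁻¹) ^ 2 * (∫ x, diracSq (fun j => cov A j φ x))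
        + K * ∫ x, ‖B x‖ * ‖φ x‖ ^ 2 := by
  obtain ⟨R, hR, hdec⟩ := exists_radius hdecay
  -- Of the coefficient `1/4` in the weighted estimate, `1/8` absorbs the field outside the ball;
  -- this explains both factors `8`. Inside the ball `ω² ≤ ⟨x⟩² ≤ 1 + R²`.
  refine ⟨8 * (1 + R ^ 2), by positivity, fun φ hφ ε hε => ?_⟩
  have h := weighted_dirac hA hB hcurl hφ hε
  have hd2 : ContDiff ℝ ∞ fun x => damp ε x ^ 2 := (contDiff_damp hε).pow 2
  have i0 : Integrable fun x => damp ε x ^ 2 * ‖φ x‖ ^ 2 := (IsTest.mul hd2 hφ.norm_sq).integrable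
  have i1 := (lichnerowicz hA hB hcurl hφ).1
  have h1 : ∫ x, weight ε x ^ 2 * diracSq (fun j => cov A j φ x) ≤
      (ε⁻¹) ^ 2 * ∫ x, diracSq (fun j => cov A j φ x) := by
    rw [← integral_const_mul]
    refine integral_mono (integrable_weight_diracSq hA hB hcurl hφ hε) (i1.const_mul _) fun x => ?_
    have := weight_pos hε x
    have := diracSq_nonneg fun j => cov A j φ x
    dsimp only
    gcongr
    exact weight_le hε x
  have i2 := integrable_norm_field_mul hB hφ.norm_sq
  have hw2 : ContDiff ℝ ∞ fun x => weight ε x ^ 2 := (contDiff_weight hε).pow 2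
  have h2 : ∫ x, ‖B x‖ * (weight ε x ^ 2 * ‖φ x‖ ^ 2) ≤
      (1 / 8) * (∫ x, damp ε x ^ 2 * ‖φ x‖ ^ 2) + (1 + R ^ 2) * ∫ x, ‖B x‖ * ‖φ x‖ ^ 2 := by
    rw [← integral_const_mul, ← integral_const_mul, ← integral_add (i0.const_mul _) (i2.const_mul _)]
    refine integral_mono_ae (integrable_norm_field_mul hB (IsTest.mul hw2 hφ.norm_sq))
      ((i0.const_mul _).add (i2.const_mul _)) ?_
    filter_upwards [hdec] with x hx
    have hd := damp_pos hε x
    have hd1 := damp_le_one hε x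
    have hbr := bracket_pos x
    simp only [weight, mul_pow]
    rcases le_total R ‖x‖ with hRx | hRx
    · have e : ‖B x‖ * (bracket x ^ 2 * damp ε x ^ 2 * ‖φ x‖ ^ 2) =
          (‖B x‖ * bracket x ^ 2) * (damp ε x ^ 2 * ‖φ x‖ ^ 2) := by ring
      rw [e]
      have : (‖B x‖ * bracket x ^ 2) * (damp ε x ^ 2 * ‖φ x‖ ^ 2) ≤
        1 / 8 * (damp ε x ^ 2 * ‖φ x‖ ^ 2) := by gcongr; exact hx hRx
      have : 0 ≤ (1 + R ^ 2) * (‖B x‖ * ‖φ x‖ ^ 2) := by positivity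
      linarith
    · have e : ‖B x‖ * (bracket x ^ 2 * damp ε x ^ 2 * ‖φ x‖ ^ 2) ≤
          ‖B x‖ * ((1 + R ^ 2) * 1 ^ 2 * ‖φ x‖ ^ 2) := by
        rw [bracket_sq]
        gcongr
      have : 0 ≤ 1 / 8 * (damp ε x ^ 2 * ‖φ x‖ ^ 2) := by positivity
      linarith
  have h3 : ∫ x, damp ε x ^ 2 / 4 * ‖φ x‖ ^ 2 = 1 / 4 * ∫ x, damp ε x ^ 2 * ‖φ x‖ ^ 2 := by
    rw [← integral_const_mul]
    congr 1
    funext x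
    ring
  rw [h3] at h
  nlinarith

/-! ### The form domain -/

/-- The class in `L²` of a test function. -/
def IsTest.toHil {φ : Space → Spinor} (hφ : IsTest φ) : Hil := (hφ.memLp 2).toLp φ

/-- The class in `L²` of the covariant gradient of a test function. -/
def IsTest.covHil {A : Space → Space} (hA : IsL2Loc A) {φ : Space → Spinor} (hφ : IsTest φ) :
    PiLp 2 (fun _ : Fin 3 => Hil) :=
  WithLp.toLp 2 fun j => (memLp_cov hA hφ j).toLp (cov A j φ)

theorem IsTest.toHil_ae {φ : Space → Spinor} (hφ : IsTest φ) :
    (hφ.toHil : Space → Spinor) =ᵐ[volume] φ := MemLp.coeFn_toLp (hφ.memLp 2)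

theorem IsTest.covHil_ae {A : Space → Space} (hA : IsL2Loc A) {φ : Space → Spinor} (hφ : IsTest φ)
    (j : Fin 3) : (hφ.covHil hA j : Space → Spinor) =ᵐ[volume] cov A j φ :=
  MemLp.coeFn_toLp (memLp_cov hA hφ j)

theorem IsTest.mem_covGradGraph {A : Space → Space} (hA : IsL2Loc A) {φ : Space → Spinor}
    (hφ : IsTest φ) : (hφ.toHil, hφ.covHil hA) ∈ covGradGraph A :=
  ⟨φ, hφ.1, hφ.2, hφ.toHil_ae, fun j => hφ.covHil_ae hA j⟩

theorem exists_isTest_of_mem_covGradGraph {A : Space → Space} (hA : IsL2Loc A)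
    {q : Hil × PiLp 2 (fun _ : Fin 3 => Hil)} (hq : q ∈ covGradGraph A) :
    ∃ (φ : Space → Spinor) (hφ : IsTest φ), q = (hφ.toHil, hφ.covHil hA) := by
  obtain ⟨φ, h1, h2, h3, h4⟩ := hq
  refine ⟨φ, ⟨h1, h2⟩, Prod.ext ?_ ?_⟩
  · exact Lp.ext (h3.trans (IsTest.toHil_ae ⟨h1, h2⟩).symm)
  · refine PiLp.ext fun j => Lp.ext ?_
    exact (h4 j).trans (IsTest.covHil_ae hA ⟨h1, h2⟩ j).symm

theorem dense_toHil : Dense {f : Hil | ∃ (φ : Space → Spinor) (hφ : IsTest φ), f = hφ.toHil} := by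
  refine (Lp.dense_hasCompactSupport_contDiff (F := Spinor) (p := 2)
    (μ := (volume : Measure Space)) (by simp)).mono ?_
  rintro f ⟨g, h1, h2, h3⟩
  exact ⟨g, ⟨h3, h2⟩, Lp.ext (h1.trans (IsTest.toHil_ae ⟨h3, h2⟩).symm)⟩

theorem partialDeriv_inner {η φ : Space → Spinor} (hη : IsTest η) (hφ : IsTest φ) (j : Fin 3)
    (x : Space) : partialDeriv j (fun y => ⟪η y, φ y⟫_ℂ) x =
      ⟪η x, partialDeriv j φ x⟫_ℂ + ⟪partialDeriv j η x, φ x⟫_ℂ :=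
  fderiv_inner_apply ℂ (hη.differentiableAt x) (hφ.differentiableAt x) _

theorem IsTest.inner {η φ : Space → Spinor} (hη : IsTest η) (hφ : IsTest φ) :
    IsTest fun x => ⟪η x, φ x⟫_ℂ := by
  refine ⟨hη.1.inner ℂ hφ.1, hφ.2.mono' (subset_trans ?_ (subset_tsupport φ))⟩
  intro x hx h
  exact hx (by simp [h])

/-- The components of `p - A` are symmetric on test functions. -/
theorem inner_covHil {A : Space → Space} (hA : IsL2Loc A) {η φ : Space → Spinor} (hη : IsTest η)
    (hφ : IsTest φ) (j : Fin 3) :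
    ⟪hη.toHil, hφ.covHil hA j⟫_ℂ = ⟪hη.covHil hA j, hφ.toHil⟫_ℂ := by
  have i1 : Integrable fun x => ⟪(hη.toHil : Space → Spinor) x, (hφ.covHil hA j : Space → Spinor) x⟫_ℂ :=
    L2.integrable_inner _ _
  have i2 : Integrable fun x => ⟪(hη.covHil hA j : Space → Spinor) x, (hφ.toHil : Space → Spinor) x⟫_ℂ :=
    L2.integrable_inner _ _
  rw [L2.inner_def, L2.inner_def, ← sub_eq_zero, ← integral_sub i1 i2]
  have h0 := integral_partialDeriv (hη.inner hφ) j
  have h1 : ∫ x, (-Complex.I) * partialDeriv j (fun y => ⟪η y, φ y⟫_ℂ) x = 0 := by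
    rw [integral_const_mul, h0, mul_zero]
  rw [← h1]
  refine integral_congr_ae ?_
  filter_upwards [hη.toHil_ae, hφ.toHil_ae, hη.covHil_ae hA j, hφ.covHil_ae hA j] with x e1 e2 e3 e4
  rw [e1, e2, e3, e4, partialDeriv_inner hη hφ, cov, cov]
  simp only [inner_sub_left, inner_sub_right, inner_smul_left, inner_smul_right, map_neg,
    Complex.conj_I, Complex.conj_ofReal]
  ring

/-- By symmetry of `(p - A)ⱼ`, the pairing of a limit `q.2 j` with a test function is determined by
`q.1`. Test functions are dense in `L²`. -/
theorem isClosable_covGradGraph {A : Space → Space} (hA : IsL2Loc A)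
    (q : Hil × PiLp 2 (fun _ : Fin 3 => Hil)) (hq : q ∈ (covGradGraph A).topologicalClosure)
    (h0 : q.1 = 0) : q.2 = 0 := by
  refine PiLp.ext fun j => ?_
  refine dense_toHil.eq_zero_of_inner_right ℂ ?_
  rintro _ ⟨η, hη, rfl⟩
  have hcl : IsClosed {q : Hil × PiLp 2 (fun _ : Fin 3 => Hil) |
      ⟪hη.toHil, q.2 j⟫_ℂ = ⟪hη.covHil hA j, q.1⟫_ℂ} := by
    refine isClosed_eq ?_ ?_
    · exact continuous_const.inner ((PiLp.continuous_apply 2 _ j).comp continuous_snd)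
    · exact continuous_const.inner continuous_fst
  have := closure_minimal (fun q hq => by
    obtain ⟨φ, hφ, rfl⟩ := exists_isTest_of_mem_covGradGraph hA hq
    exact inner_covHil hA hη hφ j) hcl hq
  simp only [Set.mem_ofPred_eq, h0, inner_zero_right] at this
  exact this

theorem graph_covGrad {A : Space → Space} (hA : IsL2Loc A) :
    (covGrad A).graph = (covGradGraph A).topologicalClosure :=
  Submodule.toLinearPMap_graph_eq _ (isClosable_covGradGraph hA)

theorem isClosed_graph_covGrad {A : Space → Space} (hA : IsL2Loc A) :
    IsClosed ((covGrad A).graph : Set (Hil × PiLp 2 (fun _ : Fin 3 => Hil))) := by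
  rw [graph_covGrad hA]
  exact Submodule.isClosed_topologicalClosure _

/-- The element of the form domain given by a test function. -/
theorem IsTest.exists_form {A : Space → Space} (hA : IsL2Loc A) {φ : Space → Spinor}
    (hφ : IsTest φ) : ∃ u : formDomain A, (u : Hil) = hφ.toHil ∧ covGrad A u = hφ.covHil hA := by
  have h : (hφ.toHil, hφ.covHil hA) ∈ (covGrad A).graph := by
    rw [graph_covGrad hA]
    exact Submodule.le_topologicalClosure _ (hφ.mem_covGradGraph hA)
  exact (LinearPMap.mem_graph_iff _).1 h

/-- The element of the form domain given by a test function. -/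
def IsTest.toForm {A : Space → Space} (hA : IsL2Loc A) {φ : Space → Spinor} (hφ : IsTest φ) :
    formDomain A := (hφ.exists_form hA).choose

theorem IsTest.coe_toForm {A : Space → Space} (hA : IsL2Loc A) {φ : Space → Spinor}
    (hφ : IsTest φ) : (hφ.toForm hA : Hil) = hφ.toHil := (hφ.exists_form hA).choose_spec.1

theorem IsTest.covGrad_toForm {A : Space → Space} (hA : IsL2Loc A) {φ : Space → Spinor}
    (hφ : IsTest φ) : covGrad A (hφ.toForm hA) = hφ.covHil hA := (hφ.exists_form hA).choose_spec.2

theorem IsTest.toForm_ae {A : Space → Space} (hA : IsL2Loc A) {φ : Space → Spinor}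
    (hφ : IsTest φ) : ((hφ.toForm hA : Hil) : Space → Spinor) =ᵐ[volume] φ := by
  rw [hφ.coe_toForm hA]
  exact hφ.toHil_ae

/-- Test functions are dense in the form domain. -/
theorem exists_seq_isTest {A : Space → Space} (hA : IsL2Loc A) (u : formDomain A) :
    ∃ (φ : ℕ → Space → Spinor) (hφ : ∀ n, IsTest (φ n)),
      Filter.Tendsto (fun n => (((hφ n).toForm hA : formDomain A) : Hil)) Filter.atTop (nhds (u : Hil)) ∧
      Filter.Tendsto (fun n => covGrad A ((hφ n).toForm hA)) Filter.atTop (nhds (covGrad A u)) := by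
  have h : ((u : Hil), covGrad A u) ∈ (covGrad A).graph := (covGrad A).mem_graph u
  rw [graph_covGrad hA] at h
  obtain ⟨q, hq, hqt⟩ := mem_closure_iff_seq_limit.1 h
  choose φ hφ hqφ using fun n => exists_isTest_of_mem_covGradGraph hA (hq n)
  refine ⟨φ, hφ, ?_, ?_⟩
  · simp only [IsTest.coe_toForm]
    have := (continuous_fst.tendsto _).comp hqt
    refine this.congr fun n => ?_
    simp [hqφ n]
  · simp only [IsTest.covGrad_toForm]
    have := (continuous_snd.tendsto _).comp hqt
    refine this.congr fun n => ?_
    simp [hqφ n]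

theorem dense_formDomain {A : Space → Space} (hA : IsL2Loc A) : Dense (formDomain A : Set Hil) := by
  refine dense_toHil.mono ?_
  rintro _ ⟨φ, hφ, rfl⟩
  rw [← hφ.coe_toForm hA]
  exact (hφ.toForm hA).2

/-- Membership in the form domain through limits of test functions. -/
theorem exists_form_of_tendsto {A : Space → Space} (hA : IsL2Loc A) {ι : Type*} {l : Filter ι}
    [l.NeBot] {q : ι → formDomain A} {f : Hil} {g : PiLp 2 (fun _ : Fin 3 => Hil)}
    (h1 : Filter.Tendsto (fun n => (q n : Hil)) l (nhds f))
    (h2 : Filter.Tendsto (fun n => covGrad A (q n)) l (nhds g)) :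
    ∃ u : formDomain A, (u : Hil) = f ∧ covGrad A u = g := by
  have := (isClosed_graph_covGrad hA).mem_of_tendsto (h1.prodMk_nhds h2)
    (Filter.Eventually.of_forall fun n => (covGrad A).mem_graph (q n))
  exact (LinearPMap.mem_graph_iff _).1 this

/-! ### From test functions to the form domain -/

theorem norm_sq_eq_integral (f : Hil) : ‖f‖ ^ 2 = ∫ x, ‖(f : Space → Spinor) x‖ ^ 2 := by
  have h : ⟪f, f⟫_ℂ = ((‖f‖ ^ 2 : ℝ) : ℂ) := by
    rw [inner_self_eq_norm_sq_to_K]; norm_cast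
  rw [L2.inner_def] at h
  have h2 : ∀ x, ⟪(f : Space → Spinor) x, (f : Space → Spinor) x⟫_ℂ =
      ((‖(f : Space → Spinor) x‖ ^ 2 : ℝ) : ℂ) := fun x => by
    rw [inner_self_eq_norm_sq_to_K]; norm_cast
  simp only [h2] at h
  rw [integral_complex_ofReal] at h
  exact_mod_cast h.symm

theorem integrable_norm_sq (f : Hil) : Integrable fun x => ‖(f : Space → Spinor) x‖ ^ 2 :=
  (Lp.memLp f).integrable_norm_pow (by simp)

theorem ofReal_norm_sq (f : Hil) : ENNReal.ofReal (‖f‖ ^ 2) = ∫⁻ x, ‖(f : Space → Spinor) x‖ₑ ^ 2 := by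
  rw [norm_sq_eq_integral, ofReal_integral_eq_lintegral_ofReal (integrable_norm_sq f)
    (Filter.Eventually.of_forall fun x => by positivity)]
  refine lintegral_congr fun x => ?_
  rw [ENNReal.ofReal_pow (norm_nonneg _), ofReal_norm]

theorem norm_sq_covHil {A : Space → Space} (hA : IsL2Loc A) {φ : Space → Spinor} (hφ : IsTest φ) :
    ‖hφ.covHil hA‖ ^ 2 = ∫ x, ∑ j, ‖cov A j φ x‖ ^ 2 := by
  rw [PiLp.norm_sq_eq_of_L2, integral_finsetSum _ fun j _ => integrable_cov_sq hA hφ j]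
  refine Finset.sum_congr rfl fun j _ => ?_
  rw [norm_sq_eq_integral]
  refine integral_congr_ae ?_
  filter_upwards [hφ.covHil_ae hA j] with x hx
  rw [hx]

theorem covEnergy_eq {A : Space → Space} (hA : IsL2Loc A) {φ : Space → Spinor} (hφ : IsTest φ) :
    covEnergy A φ = ENNReal.ofReal (‖covGrad A (hφ.toForm hA)‖ ^ 2) := by
  rw [hφ.covGrad_toForm hA, norm_sq_covHil hA hφ, ofReal_integral_eq_lintegral_ofReal
    (integrable_finsetSum _ fun j _ => integrable_cov_sq hA hφ j)
    (Filter.Eventually.of_forall fun x => by positivity)]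
  refine lintegral_congr fun x => ?_
  rw [ENNReal.ofReal_sum_of_nonneg fun _ _ => by positivity]
  refine Finset.sum_congr rfl fun j _ => ?_
  rw [ENNReal.ofReal_pow (norm_nonneg _), ofReal_norm]

/-- Fatou's lemma for convergence in measure. -/
theorem lintegral_le_of_tendstoInMeasure {f : ℕ → Space → Spinor} {g : Space → Spinor}
    (hfg : TendstoInMeasure volume f Filter.atTop g) {Φ : Space → Spinor → ℝ≥0∞}
    (hΦ : ∀ x, Continuous (Φ x)) (hm : ∀ n, AEMeasurable fun x => Φ x (f n x)) {c : ℕ → ℝ≥0∞}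
    {c' : ℝ≥0∞} (hc : ∀ n, ∫⁻ x, Φ x (f n x) ≤ c n) (hcc : Filter.Tendsto c Filter.atTop (nhds c')) :
    ∫⁻ x, Φ x (g x) ≤ c' := by
  obtain ⟨ns, hns, hae⟩ := hfg.exists_seq_tendsto_ae
  calc ∫⁻ x, Φ x (g x) = ∫⁻ x, Filter.liminf (fun n => Φ x (f (ns n) x)) Filter.atTop := by
        refine lintegral_congr_ae ?_
        filter_upwards [hae] with x hx
        exact ((((hΦ x).tendsto _).comp hx).liminf_eq).symm
    _ ≤ Filter.liminf (fun n => ∫⁻ x, Φ x (f (ns n) x)) Filter.atTop :=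
        lintegral_liminf_le' fun n => hm (ns n)
    _ ≤ Filter.liminf (fun n => c (ns n)) Filter.atTop :=
        Filter.liminf_le_liminf (Filter.Eventually.of_forall fun n => hc (ns n))
    _ = c' := (hcc.comp hns.tendsto_atTop).liminf_eq

theorem tendstoInMeasure_of_tendsto {f : ℕ → Hil} {g : Hil}
    (h : Filter.Tendsto f Filter.atTop (nhds g)) :
    TendstoInMeasure volume (fun n => (f n : Space → Spinor)) Filter.atTop (g : Space → Spinor) :=
  tendstoInMeasure_of_tendsto_Lp h

theorem tendsto_ofReal_norm_sq {E : Type*} [NormedAddCommGroup E] {f : ℕ → E} {g : E}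
    (h : Filter.Tendsto f Filter.atTop (nhds g)) :
    Filter.Tendsto (fun n => ENNReal.ofReal (‖f n‖ ^ 2)) Filter.atTop
      (nhds (ENNReal.ofReal (‖g‖ ^ 2))) :=
  (ENNReal.continuous_ofReal.tendsto _).comp (h.norm.pow 2)

/-- The constant of the form bound of a magnetic field. -/
def fieldConst {E : Type*} [NormedAddCommGroup E] (B : Space → E) : ℝ≥0∞ :=
  (∫⁻ x, ‖B x‖ₑ ^ (3 / 2 : ℝ)) ^ (2 / 3 : ℝ) * sobolevConst

theorem fieldConst_ne_top {E : Type*} [NormedAddCommGroup E] {B : Space → E}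
    (hB : MemLp B (3 / 2) volume) : fieldConst B ≠ ⊤ := by
  refine ENNReal.mul_ne_top (ENNReal.rpow_ne_top_of_nonneg (by norm_num) ?_) sobolevConst_ne_top
  have h32 : ((3 / 2 : ℝ≥0∞)).toReal = 3 / 2 := by simp
  have := lintegral_rpow_enorm_lt_top_of_eLpNorm_lt_top (p := 3 / 2) (by simp)
    (ENNReal.div_ne_top (by simp) (by simp)) hB.eLpNorm_lt_top
  rw [h32] at this
  exact this.ne

/-- The form bound of a magnetic field on the form domain. -/
theorem lintegral_field_le_form {E : Type*} [NormedAddCommGroup E] {A : Space → Space}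
    (hA : IsL2Loc A) {B : Space → E} (hB : MemLp B (3 / 2) volume) (u : formDomain A) :
    ∫⁻ x, ‖B x‖ₑ * ‖(u : Hil) x‖ₑ ^ 2 ≤ fieldConst B * ENNReal.ofReal (‖covGrad A u‖ ^ 2) := by
  obtain ⟨φ, hφ, h1, h2⟩ := exists_seq_isTest hA u
  refine lintegral_le_of_tendstoInMeasure (tendstoInMeasure_of_tendsto h1)
    (Φ := fun x s => ‖B x‖ₑ * ‖s‖ₑ ^ 2) (fun x => ?_) (fun n => ?_) (fun n => ?_)
    (ENNReal.Tendsto.const_mul (tendsto_ofReal_norm_sq h2) (Or.inr (fieldConst_ne_top hB)))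
  · exact ENNReal.continuous_const_mul (by simp) |>.comp ((ENNReal.continuous_pow 2).comp continuous_enorm)
  · exact hB.1.enorm.mul ((Lp.aestronglyMeasurable _).enorm.pow_const 2)
  · rw [← covEnergy_eq hA (hφ n), fieldConst, mul_assoc]
    refine le_trans (le_of_eq (lintegral_congr_ae ?_)) (lintegral_field_le hB.1 hA (hφ n))
    filter_upwards [(hφ n).toForm_ae hA] with x hx
    rw [hx]

/-- The Sobolev inequality on the form domain. -/
theorem sobolev_form {A : Space → Space} (hA : IsL2Loc A) (u : formDomain A) :
    ∫⁻ x, ‖(u : Hil) x‖ₑ ^ 6 ≤ (sobolevConst * ENNReal.ofReal (‖covGrad A u‖ ^ 2)) ^ (3 : ℝ) := by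
  obtain ⟨φ, hφ, h1, h2⟩ := exists_seq_isTest hA u
  refine lintegral_le_of_tendstoInMeasure (tendstoInMeasure_of_tendsto h1)
    (Φ := fun x s => ‖s‖ₑ ^ 6) (fun x => by fun_prop) (fun n => ?_) (fun n => ?_)
    ((ENNReal.continuous_rpow_const.tendsto _).comp
      (ENNReal.Tendsto.const_mul (tendsto_ofReal_norm_sq h2) (Or.inr sobolevConst_ne_top)))
  · exact (Lp.aestronglyMeasurable _).enorm.pow_const 6
  · simp only [Function.comp_apply]
    rw [← covEnergy_eq hA (hφ n)]
    have := ENNReal.rpow_le_rpow (sobolev hA (hφ n)) (by norm_num : (0 : ℝ) ≤ 3)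
    rw [← ENNReal.rpow_mul] at this
    norm_num at this
    refine le_trans (le_of_eq (lintegral_congr_ae ?_)) (by simpa using this)
    filter_upwards [(hφ n).toForm_ae hA] with x hx
    rw [hx]

/-! ### The square root of `P_A + |B|` -/

/-! ### Algebra of the matrices `σ · b` and `|b| - σ · b` -/

theorem inner_self_ofReal {E : Type*} [NormedAddCommGroup E] [InnerProductSpace ℂ E] (u : E) :
    ⟪u, u⟫_ℂ = ((‖u‖ ^ 2 : ℝ) : ℂ) := by
  rw [inner_self_eq_norm_sq_to_K]
  push_cast
  rfl

/-- The action of `σ · b` on spinors. -/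
def sigmaAct (b : Space) (u : Spinor) : Spinor := Matrix.toEuclideanLin (sigmaDot b) u

theorem sigmaAct_zero (b : Space) (u : Spinor) :
    sigmaAct b u 0 = (b 2 : ℂ) * u 0 + ((b 0 : ℂ) - Complex.I * (b 1 : ℂ)) * u 1 := by
  simp [sigmaAct, sigmaDot, Matrix.toEuclideanLin, Matrix.toLpLin_apply, dotProduct,
    Fin.sum_univ_two]

theorem sigmaAct_one (b : Space) (u : Spinor) :
    sigmaAct b u 1 = ((b 0 : ℂ) + Complex.I * (b 1 : ℂ)) * u 0 - (b 2 : ℂ) * u 1 := by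
  simp [sigmaAct, sigmaDot, Matrix.toEuclideanLin, Matrix.toLpLin_apply, dotProduct,
    Fin.sum_univ_two]
  ring

theorem sigmaAct_add (b : Space) (u v : Spinor) : sigmaAct b (u + v) = sigmaAct b u + sigmaAct b v :=
  map_add _ _ _

theorem sigmaAct_smul (b : Space) (c : ℂ) (u : Spinor) : sigmaAct b (c • u) = c • sigmaAct b u :=
  map_smul _ _ _

theorem inner_sigmaAct_left (b : Space) (v u : Spinor) :
    ⟪sigmaAct b v, u⟫_ℂ = ⟪v, sigmaAct b u⟫_ℂ := by
  simp only [PiLp.inner_apply, Fin.sum_univ_two, RCLike.inner_apply, sigmaAct_zero, sigmaAct_one,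
    map_add, map_sub, map_mul, Complex.conj_ofReal, Complex.conj_I]
  ring

theorem sigmaAct_sigmaAct (b : Space) (u : Spinor) :
    sigmaAct b (sigmaAct b u) = ((‖b‖ ^ 2 : ℝ) : ℂ) • u := by
  have hI : Complex.I ^ 2 = -1 := Complex.I_sq
  ext i
  fin_cases i
  · simp only [Fin.zero_eta, sigmaAct_zero, sigmaAct_one, PiLp.smul_apply, smul_eq_mul, space_norm_sq]
    push_cast
    linear_combination (-(b 1 : ℂ) ^ 2 * u 0) * hI
  · simp only [Fin.mk_one, sigmaAct_zero, sigmaAct_one, PiLp.smul_apply, smul_eq_mul, space_norm_sq]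
    push_cast
    linear_combination (-(b 1 : ℂ) ^ 2 * u 1) * hI

theorem norm_sigmaAct (b : Space) (u : Spinor) : ‖sigmaAct b u‖ = ‖b‖ * ‖u‖ := by
  refine (pow_left_inj₀ (norm_nonneg _) (by positivity) two_ne_zero).1 ?_
  have h : ⟪sigmaAct b u, sigmaAct b u⟫_ℂ = ((‖b‖ ^ 2 * ‖u‖ ^ 2 : ℝ) : ℂ) := by
    rw [inner_sigmaAct_left, sigmaAct_sigmaAct, inner_smul_right, inner_self_ofReal]
    push_cast
    rfl
  rw [inner_self_ofReal] at h
  rw [mul_pow]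
  exact_mod_cast h

theorem inner_sigmaAct_self (b : Space) (u : Spinor) :
    ⟪u, sigmaAct b u⟫_ℂ = ((∑ l, b l * spin l u : ℝ) : ℂ) := by
  simp only [PiLp.inner_apply, Fin.sum_univ_two, RCLike.inner_apply, sigmaAct_zero, sigmaAct_one,
    Fin.sum_univ_three, spin, Matrix.cons_val]
  apply Complex.ext <;>
  simp only [Complex.add_re, Complex.ofReal_re, Complex.ofReal_im,
    Complex.sub_re, Complex.mul_re, Complex.add_im, Complex.sub_im, Complex.mul_im, Complex.I_re,
    Complex.I_im, Complex.conj_re, Complex.conj_im] <;>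
  ring

/-- The square root of the nonnegative matrix `|b| - σ · b`. -/
def defectAct (b : Space) (u : Spinor) : Spinor :=
  (((√2)⁻¹ : ℝ) : ℂ) • (((√‖b‖ : ℝ) : ℂ) • u - (((√‖b‖)⁻¹ : ℝ) : ℂ) • sigmaAct b u)

theorem defectAct_add (b : Space) (u v : Spinor) :
    defectAct b (u + v) = defectAct b u + defectAct b v := by
  simp only [defectAct, sigmaAct_add]
  module

theorem defectAct_smul (b : Space) (c : ℂ) (u : Spinor) :
    defectAct b (c • u) = c • defectAct b u := by
  simp only [defectAct, sigmaAct_smul]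
  module

/-- From `(σ · b)² = |b|²` it follows that `(|b| - σ · b)² = 2 |b| (|b| - σ · b)`, so division by
`√(2 |b|)` yields a square root. -/
theorem inner_defectAct (b : Space) (v u : Spinor) :
    ⟪defectAct b v, defectAct b u⟫_ℂ = ((‖b‖ : ℝ) : ℂ) * ⟪v, u⟫_ℂ - ⟪v, sigmaAct b u⟫_ℂ := by
  -- At `b = 0` the inverse in `defectAct` takes its default value `0`, and both sides vanish.
  rcases eq_or_ne b 0 with rfl | hb
  · have : ∀ w, sigmaAct (0 : Space) w = 0 := fun w => by
      rw [← norm_eq_zero, norm_sigmaAct]; simp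
    simp [defectAct, this]
  · have ht : (0 : ℝ) < √‖b‖ := Real.sqrt_pos.2 (norm_pos_iff.2 hb)
    have htt : √‖b‖ ^ 2 = ‖b‖ := Real.sq_sqrt (norm_nonneg _)
    simp only [defectAct, inner_smul_left, inner_smul_right, inner_sub_left, inner_sub_right,
      inner_sigmaAct_left, sigmaAct_sigmaAct, Complex.conj_ofReal]
    generalize √‖b‖ = t at *
    rw [← htt]
    have h2 : ((√2 : ℝ) : ℂ) ^ 2 = 2 := by
      rw [← Complex.ofReal_pow, Real.sq_sqrt (by norm_num)]; norm_num
    have h2' : ((√2 : ℝ) : ℂ) ≠ 0 := fun h => by rw [h] at h2; norm_num at h2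
    have ht' : (t : ℂ) ≠ 0 := by exact_mod_cast ht.ne'
    push_cast
    field_simp
    rw [h2]
    ring

theorem norm_defectAct_sq_le (b : Space) (u : Spinor) :
    ‖defectAct b u‖ ^ 2 ≤ 2 * (‖b‖ * ‖u‖ ^ 2) := by
  have h := inner_defectAct b u u
  rw [inner_sigmaAct_self, inner_self_ofReal, inner_self_ofReal] at h
  have h' : ‖defectAct b u‖ ^ 2 = ‖b‖ * ‖u‖ ^ 2 - ∑ l, b l * spin l u := by
    exact_mod_cast h
  rw [h']
  have := (abs_le.1 (abs_sum_mul_spin_le b u)).1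
  linarith

theorem continuous_sigmaAct : Continuous fun q : Space × Spinor => sigmaAct q.1 q.2 := by
  have h : ∀ i, Continuous fun q : Space × Spinor => ((q.1 i : ℝ) : ℂ) := fun i =>
    Complex.continuous_ofReal.comp ((PiLp.continuous_apply 2 _ i).comp continuous_fst)
  have h' : ∀ i, Continuous fun q : Space × Spinor => q.2 i := fun i =>
    (PiLp.continuous_apply 2 _ i).comp continuous_snd
  refine (PiLp.continuous_toLp 2 _).comp (g := WithLp.toLp 2) (f := fun q : Space × Spinor =>
    WithLp.ofLp (sigmaAct q.1 q.2)) (continuous_pi fun i => ?_)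
  fin_cases i
  · simp only [Fin.zero_eta, sigmaAct_zero]
    fun_prop
  · simp only [Fin.mk_one, sigmaAct_one]
    fun_prop

/-! ### Multiplication operators on the form domain -/

variable {A B : Space → Space}

theorem aestronglyMeasurable_sqrt_smul (hB : MemLp B (3 / 2) volume) {f : Space → Spinor}
    (hf : AEStronglyMeasurable f) :
    AEStronglyMeasurable fun x => ((√‖B x‖ : ℝ) : ℂ) • f x :=
  ((Complex.continuous_ofReal.comp Real.continuous_sqrt).comp_aestronglyMeasurable hB.1.norm).smul hf

theorem aestronglyMeasurable_sigmaAct (hB : MemLp B (3 / 2) volume) {f : Space → Spinor}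
    (hf : AEStronglyMeasurable f) : AEStronglyMeasurable fun x => sigmaAct (B x) (f x) :=
  Continuous.comp_aestronglyMeasurable (g := fun q : Space × Spinor => sigmaAct q.1 q.2)
    (f := fun x => (B x, f x)) continuous_sigmaAct (hB.1.prodMk hf)

theorem aestronglyMeasurable_defectAct (hB : MemLp B (3 / 2) volume) {f : Space → Spinor}
    (hf : AEStronglyMeasurable f) : AEStronglyMeasurable fun x => defectAct (B x) (f x) := by
  unfold defectAct
  refine AEStronglyMeasurable.const_smul (𝕜 := ℂ) ?_ _
  refine (aestronglyMeasurable_sqrt_smul hB hf).sub ?_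
  refine AEStronglyMeasurable.smul (𝕜 := ℂ) ?_ (aestronglyMeasurable_sigmaAct hB hf)
  refine Complex.continuous_ofReal.comp_aestronglyMeasurable ?_
  exact (hB.1.norm.aemeasurable.sqrt.inv).aestronglyMeasurable

theorem enorm_sq_sqrt_smul (t : ℝ) (ht : 0 ≤ t) (u : Spinor) :
    ‖((√t : ℝ) : ℂ) • u‖ₑ ^ 2 = ‖t‖ₑ * ‖u‖ₑ ^ 2 := by
  rw [enorm_smul, mul_pow]
  congr 1
  rw [← enorm_pow, ← Complex.ofReal_pow, Real.sq_sqrt ht, ← ofReal_norm, ← ofReal_norm,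
    Complex.norm_real]

theorem memLp_two_of_lintegral {f : Space → Spinor} (hf : AEStronglyMeasurable f)
    (h : ∫⁻ x, ‖f x‖ₑ ^ 2 ≠ ⊤) : MemLp f 2 := by
  refine ⟨hf, ?_⟩
  rw [eLpNorm_lt_top_iff_lintegral_rpow_enorm_lt_top (by simp) (by simp)]
  simpa using lt_top_iff_ne_top.2 h

theorem lintegral_norm_field_form (hA : IsL2Loc A) (hB : MemLp B (3 / 2) volume)
    (u : formDomain A) :
    ∫⁻ x, ‖((√‖B x‖ : ℝ) : ℂ) • (u : Hil) x‖ₑ ^ 2 ≤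
      fieldConst B * ENNReal.ofReal (‖covGrad A u‖ ^ 2) := by
  refine le_trans (le_of_eq (lintegral_congr fun x => ?_)) (lintegral_field_le_form hA hB u)
  rw [enorm_sq_sqrt_smul _ (norm_nonneg _), enorm_norm]

theorem memLp_fieldMul (hA : IsL2Loc A) (hB : MemLp B (3 / 2) volume) (u : formDomain A) :
    MemLp (fun x => ((√‖B x‖ : ℝ) : ℂ) • (u : Hil) x) 2 :=
  memLp_two_of_lintegral (aestronglyMeasurable_sqrt_smul hB (Lp.aestronglyMeasurable _))
    (ne_top_of_le_ne_top (ENNReal.mul_ne_top (fieldConst_ne_top hB) ENNReal.ofReal_ne_top)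
      (lintegral_norm_field_form hA hB u))

theorem memLp_defect (hA : IsL2Loc A) (hB : MemLp B (3 / 2) volume) (u : formDomain A) :
    MemLp (fun x => defectAct (B x) ((u : Hil) x)) 2 := by
  refine (memLp_fieldMul hA hB u).of_le_mul (c := √2)
    (aestronglyMeasurable_defectAct hB (Lp.aestronglyMeasurable _))
    (Filter.Eventually.of_forall fun x => ?_)
  refine le_of_sq_le_sq ?_ (by positivity)
  refine (norm_defectAct_sq_le _ _).trans (le_of_eq ?_)
  rw [norm_smul, Complex.norm_real, Real.norm_of_nonneg (Real.sqrt_nonneg _), mul_pow, mul_pow,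
    Real.sq_sqrt (norm_nonneg _), Real.sq_sqrt (by norm_num)]

/-- Multiplication by `|B|^{1/2}` on the form domain. -/
def fieldMul (hA : IsL2Loc A) (hB : MemLp B (3 / 2) volume) : formDomain A →ₗ[ℂ] Hil where
  toFun u := (memLp_fieldMul hA hB u).toLp _
  map_add' u v := by
    rw [← MemLp.toLp_add]
    refine MemLp.toLp_congr _ _ ?_
    filter_upwards [Lp.coeFn_add (u : Hil) v] with x hx
    rw [Submodule.coe_add, hx, Pi.add_apply, Pi.add_apply, smul_add]
  map_smul' c u := by
    rw [← MemLp.toLp_const_smul]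
    refine MemLp.toLp_congr _ _ ?_
    filter_upwards [Lp.coeFn_smul c (u : Hil)] with x hx
    simp only [Submodule.coe_smul, hx, Pi.smul_apply, RingHom.id_apply]
    rw [smul_comm]

theorem fieldMul_ae (hA : IsL2Loc A) (hB : MemLp B (3 / 2) volume) (u : formDomain A) :
    (fieldMul hA hB u : Space → Spinor) =ᵐ[volume] fun x => ((√‖B x‖ : ℝ) : ℂ) • (u : Hil) x :=
  MemLp.coeFn_toLp (memLp_fieldMul hA hB u)

/-- Multiplication by `(|B| - σ · B)^{1/2}` on the form domain. -/
def defectMul (hA : IsL2Loc A) (hB : MemLp B (3 / 2) volume) : formDomain A →ₗ[ℂ] Hil where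
  toFun u := (memLp_defect hA hB u).toLp _
  map_add' u v := by
    rw [← MemLp.toLp_add]
    refine MemLp.toLp_congr _ _ ?_
    filter_upwards [Lp.coeFn_add (u : Hil) v] with x hx
    rw [Submodule.coe_add, hx, Pi.add_apply, Pi.add_apply, defectAct_add]
  map_smul' c u := by
    rw [← MemLp.toLp_const_smul]
    refine MemLp.toLp_congr _ _ ?_
    filter_upwards [Lp.coeFn_smul c (u : Hil)] with x hx
    simp only [Submodule.coe_smul, hx, Pi.smul_apply, RingHom.id_apply, defectAct_smul]

theorem defectMul_ae (hA : IsL2Loc A) (hB : MemLp B (3 / 2) volume) (u : formDomain A) :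
    (defectMul hA hB u : Space → Spinor) =ᵐ[volume] fun x => defectAct (B x) ((u : Hil) x) :=
  MemLp.coeFn_toLp (memLp_defect hA hB u)

theorem norm_fieldMul_sq_le (hA : IsL2Loc A) (hB : MemLp B (3 / 2) volume) (u : formDomain A) :
    ‖fieldMul hA hB u‖ ^ 2 ≤ (fieldConst B).toReal * ‖covGrad A u‖ ^ 2 := by
  have h : ENNReal.ofReal (‖fieldMul hA hB u‖ ^ 2) ≤
      fieldConst B * ENNReal.ofReal (‖covGrad A u‖ ^ 2) := by
    rw [ofReal_norm_sq]
    refine le_trans (le_of_eq (lintegral_congr_ae ?_)) (lintegral_norm_field_form hA hB u)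
    filter_upwards [fieldMul_ae hA hB u] with x hx
    rw [hx]
  rw [← ENNReal.ofReal_toReal (fieldConst_ne_top hB), ← ENNReal.ofReal_mul ENNReal.toReal_nonneg,
    ENNReal.ofReal_le_ofReal_iff (by positivity)] at h
  exact h

theorem norm_defectMul_sq_le (hA : IsL2Loc A) (hB : MemLp B (3 / 2) volume) (u : formDomain A) :
    ‖defectMul hA hB u‖ ^ 2 ≤ 2 * (fieldConst B).toReal * ‖covGrad A u‖ ^ 2 := by
  have h : ‖defectMul hA hB u‖ ^ 2 ≤ 2 * ‖fieldMul hA hB u‖ ^ 2 := by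
    rw [norm_sq_eq_integral, norm_sq_eq_integral, ← integral_const_mul]
    refine integral_mono_ae (integrable_norm_sq _) ((integrable_norm_sq _).const_mul 2) ?_
    filter_upwards [defectMul_ae hA hB u, fieldMul_ae hA hB u] with x h1 h2
    rw [h1, h2]
    refine (norm_defectAct_sq_le _ _).trans (le_of_eq ?_)
    rw [norm_smul, Complex.norm_real, Real.norm_of_nonneg (Real.sqrt_nonneg _), mul_pow,
      Real.sq_sqrt (norm_nonneg _)]
  have := norm_fieldMul_sq_le hA hB u
  nlinarith

theorem inner_fieldMul (hA : IsL2Loc A) (hB : MemLp B (3 / 2) volume) (v u : formDomain A) :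
    Integrable (fun x => ((‖B x‖ : ℝ) : ℂ) * ⟪(v : Hil) x, (u : Hil) x⟫_ℂ) ∧
    ⟪fieldMul hA hB v, fieldMul hA hB u⟫_ℂ =
      ∫ x, ((‖B x‖ : ℝ) : ℂ) * ⟪(v : Hil) x, (u : Hil) x⟫_ℂ := by
  have he : (fun x => ⟪(fieldMul hA hB v : Space → Spinor) x,
      (fieldMul hA hB u : Space → Spinor) x⟫_ℂ) =ᵐ[volume]
      fun x => ((‖B x‖ : ℝ) : ℂ) * ⟪(v : Hil) x, (u : Hil) x⟫_ℂ := by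
    filter_upwards [fieldMul_ae hA hB u, fieldMul_ae hA hB v] with x h1 h2
    rw [h1, h2, inner_smul_left, inner_smul_right, Complex.conj_ofReal, ← mul_assoc,
      ← Complex.ofReal_mul, Real.mul_self_sqrt (norm_nonneg _)]
  refine ⟨(L2.integrable_inner _ _).congr he, ?_⟩
  rw [L2.inner_def]
  exact integral_congr_ae he

theorem pauliForm_eq (hA : IsL2Loc A) (hB : MemLp B (3 / 2) volume) (v u : formDomain A) :
    pauliForm A B v u = pauliTildeForm A B v u - ⟪fieldMul hA hB v, fieldMul hA hB u⟫_ℂ := by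
  rw [pauliTildeForm, (inner_fieldMul hA hB v u).2, add_sub_cancel_right]

/-- Adding `|B|` turns the potential `-σ · B` into the nonnegative `|B| - σ · B`. The form is then a
sum of two squares, which makes it nonnegative and, with the bound on `defectMul`, closed. -/
theorem pauliTildeForm_eq (hA : IsL2Loc A) (hB : MemLp B (3 / 2) volume) (v u : formDomain A) :
    pauliTildeForm A B v u =
      ⟪covGrad A v, covGrad A u⟫_ℂ + ⟪defectMul hA hB v, defectMul hA hB u⟫_ℂ := by
  have i1 := (inner_fieldMul hA hB v u).1
  have i2 : Integrable fun x => ⟪(v : Hil) x, sigmaAct (B x) ((u : Hil) x)⟫_ℂ := by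
    have hm : AEStronglyMeasurable fun x => sigmaAct (B x) ((u : Hil) x) :=
      aestronglyMeasurable_sigmaAct hB (Lp.aestronglyMeasurable (u : Hil))
    have hi : Integrable fun x => ‖(fieldMul hA hB v : Space → Spinor) x‖ *
        ‖(fieldMul hA hB u : Space → Spinor) x‖ :=
      (Lp.memLp (fieldMul hA hB v)).norm.integrable_mul (Lp.memLp (fieldMul hA hB u)).norm
    refine hi.mono' ((Lp.aestronglyMeasurable (v : Hil)).inner hm) ?_
    filter_upwards [fieldMul_ae hA hB u, fieldMul_ae hA hB v] with x h1 h2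
    refine (norm_inner_le_norm _ _).trans (le_of_eq ?_)
    rw [h1, h2, norm_smul, norm_smul, norm_sigmaAct, Complex.norm_real,
      Real.norm_of_nonneg (Real.sqrt_nonneg _)]
    linear_combination (-‖(v : Hil) x‖ * ‖(u : Hil) x‖) * Real.mul_self_sqrt (norm_nonneg (B x))
  have he : (fun x => ⟪(defectMul hA hB v : Space → Spinor) x,
      (defectMul hA hB u : Space → Spinor) x⟫_ℂ) =ᵐ[volume]
      fun x => ((‖B x‖ : ℝ) : ℂ) * ⟪(v : Hil) x, (u : Hil) x⟫_ℂ
        - ⟪(v : Hil) x, sigmaAct (B x) ((u : Hil) x)⟫_ℂ := by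
    filter_upwards [defectMul_ae hA hB u, defectMul_ae hA hB v] with x h1 h2
    rw [h1, h2, inner_defectAct]
  rw [L2.inner_def, integral_congr_ae he, integral_sub i1 i2, pauliTildeForm, pauliForm]
  simp only [sigmaAct]
  ring

/-! ### The form domain as a Hilbert space -/

theorem covGrad_add (u v : formDomain A) :
    covGrad A (u + v : formDomain A) = covGrad A u + covGrad A v := map_add (covGrad A).toFun u v

theorem covGrad_sub (u v : formDomain A) :
    covGrad A (u - v : formDomain A) = covGrad A u - covGrad A v := map_sub (covGrad A).toFun u v

theorem covGrad_smul (c : ℂ) (u : formDomain A) :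
    covGrad A (c • u : formDomain A) = c • covGrad A u := map_smul (covGrad A).toFun c u

/-- The Hilbert space that contains the graph of `((p - A), (|B| - σ · B)^{1/2})`. -/
abbrev GraphSpace : Type :=
  WithLp 2 (Hil × WithLp 2 (PiLp 2 (fun _ : Fin 3 => Hil) × Hil))

/-- The embedding of the form domain as a graph. -/
def graphEmb (hA : IsL2Loc A) (hB : MemLp B (3 / 2) volume) : formDomain A →ₗ[ℂ] GraphSpace where
  toFun u := WithLp.toLp 2 ((u : Hil), WithLp.toLp 2 (covGrad A u, defectMul hA hB u))
  map_add' u v := by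
    rw [covGrad_add, map_add, Submodule.coe_add]
    rfl
  map_smul' c u := by
    rw [covGrad_smul, map_smul, Submodule.coe_smul]
    rfl

theorem inner_graphEmb (hA : IsL2Loc A) (hB : MemLp B (3 / 2) volume) (v u : formDomain A) :
    ⟪graphEmb hA hB v, graphEmb hA hB u⟫_ℂ = ⟪(v : Hil), (u : Hil)⟫_ℂ + pauliTildeForm A B v u := by
  rw [pauliTildeForm_eq hA hB, WithLp.prod_inner_apply, WithLp.prod_inner_apply]
  rfl

theorem norm_defectMul_le (hA : IsL2Loc A) (hB : MemLp B (3 / 2) volume) (u : formDomain A) :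
    ‖defectMul hA hB u‖ ≤ √(2 * (fieldConst B).toReal) * ‖covGrad A u‖ := by
  refine le_of_sq_le_sq ?_ (by positivity)
  rw [mul_pow, Real.sq_sqrt (by positivity)]
  exact norm_defectMul_sq_le hA hB u

theorem tendsto_defectMul (hA : IsL2Loc A) (hB : MemLp B (3 / 2) volume) {q : ℕ → formDomain A}
    {u : formDomain A}
    (h : Filter.Tendsto (fun n => covGrad A (q n)) Filter.atTop (nhds (covGrad A u))) :
    Filter.Tendsto (fun n => defectMul hA hB (q n)) Filter.atTop (nhds (defectMul hA hB u)) := by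
  rw [tendsto_iff_norm_sub_tendsto_zero] at h ⊢
  have h' := h.const_mul √(2 * (fieldConst B).toReal)
  rw [mul_zero] at h'
  refine squeeze_zero (fun _ => norm_nonneg _) (fun n => ?_) h'
  rw [← map_sub, ← covGrad_sub]
  exact norm_defectMul_le hA hB _

/-- The graph of `p - A` is closed, and the defect component follows because it is bounded by `‖(p -
A) u‖`. -/
theorem isClosed_range_graphEmb (hA : IsL2Loc A) (hB : MemLp B (3 / 2) volume) :
    IsClosed (LinearMap.range (graphEmb hA hB) : Set GraphSpace) := by
  refine isClosed_of_closure_subset fun z hz => ?_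
  obtain ⟨w, hw, hwz⟩ := mem_closure_iff_seq_limit.1 hz
  choose q hq using hw
  have c1 : Continuous fun z : GraphSpace => z.fst := by fun_prop
  have c2 : Continuous fun z : GraphSpace => z.snd.fst := by fun_prop
  have c3 : Continuous fun z : GraphSpace => z.snd.snd := by fun_prop
  have h1 : Filter.Tendsto (fun n => (q n : Hil)) Filter.atTop (nhds z.fst) :=
    ((c1.tendsto z).comp hwz).congr fun n => by simp [← hq n, graphEmb]
  have h2 : Filter.Tendsto (fun n => covGrad A (q n)) Filter.atTop (nhds z.snd.fst) :=
    ((c2.tendsto z).comp hwz).congr fun n => by simp [← hq n, graphEmb]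
  have h3 : Filter.Tendsto (fun n => defectMul hA hB (q n)) Filter.atTop (nhds z.snd.snd) :=
    ((c3.tendsto z).comp hwz).congr fun n => by simp [← hq n, graphEmb]
  obtain ⟨u, hu1, hu2⟩ := exists_form_of_tendsto hA h1 h2
  rw [← hu2] at h2
  have h4 := tendsto_nhds_unique h3 (tendsto_defectMul hA hB h2)
  refine ⟨u, ?_⟩
  change WithLp.toLp 2 ((u : Hil), WithLp.toLp 2 (covGrad A u, defectMul hA hB u)) = z
  rw [hu1, hu2, ← h4]
  rfl

/-- The form domain with the norm of the form `P_A + |B| + 1`. -/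
def FormSpace (hA : IsL2Loc A) (hB : MemLp B (3 / 2) volume) : Type :=
  LinearMap.range (graphEmb hA hB)

instance (hA : IsL2Loc A) (hB : MemLp B (3 / 2) volume) : NormedAddCommGroup (FormSpace hA hB) :=
  inferInstanceAs (NormedAddCommGroup (LinearMap.range (graphEmb hA hB)))

instance (hA : IsL2Loc A) (hB : MemLp B (3 / 2) volume) : InnerProductSpace ℂ (FormSpace hA hB) :=
  inferInstanceAs (InnerProductSpace ℂ (LinearMap.range (graphEmb hA hB)))

instance (hA : IsL2Loc A) (hB : MemLp B (3 / 2) volume) : CompleteSpace (FormSpace hA hB) :=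
  (isClosed_range_graphEmb hA hB).completeSpace_coe

/-- The inclusion of the form domain, with its form norm, in `L²`. -/
def formIncl (hA : IsL2Loc A) (hB : MemLp B (3 / 2) volume) : FormSpace hA hB →L[ℂ] Hil :=
  LinearMap.mkContinuous
    { toFun := fun w : FormSpace hA hB => WithLp.fst (w.1 : GraphSpace)
      map_add' := fun _ _ => rfl
      map_smul' := fun _ _ => rfl } 1 fun w => by
    rw [one_mul]
    exact WithLp.norm_fst_le _ (w.1 : GraphSpace)

/-- An element of the form domain as an element of `FormSpace`. -/
def toFormSpace (hA : IsL2Loc A) (hB : MemLp B (3 / 2) volume) (u : formDomain A) :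
    FormSpace hA hB := ⟨graphEmb hA hB u, u, rfl⟩

theorem exists_toFormSpace (hA : IsL2Loc A) (hB : MemLp B (3 / 2) volume) (w : FormSpace hA hB) :
    ∃ u, w = toFormSpace hA hB u := by
  obtain ⟨w, u, rfl⟩ := w
  exact ⟨u, rfl⟩

theorem formIncl_toFormSpace (hA : IsL2Loc A) (hB : MemLp B (3 / 2) volume) (u : formDomain A) :
    formIncl hA hB (toFormSpace hA hB u) = (u : Hil) := rfl

theorem inner_toFormSpace (hA : IsL2Loc A) (hB : MemLp B (3 / 2) volume) (v u : formDomain A) :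
    ⟪toFormSpace hA hB v, toFormSpace hA hB u⟫_ℂ =
      ⟪(v : Hil), (u : Hil)⟫_ℂ + pauliTildeForm A B v u :=
  inner_graphEmb hA hB v u

theorem norm_formIncl_le (hA : IsL2Loc A) (hB : MemLp B (3 / 2) volume) : ‖formIncl hA hB‖ ≤ 1 :=
  LinearMap.mkContinuous_norm_le _ zero_le_one _

theorem injective_formIncl (hA : IsL2Loc A) (hB : MemLp B (3 / 2) volume) :
    Function.Injective (formIncl hA hB) := by
  intro v w h
  obtain ⟨v, rfl⟩ := exists_toFormSpace hA hB v
  obtain ⟨w, rfl⟩ := exists_toFormSpace hA hB w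
  rw [formIncl_toFormSpace, formIncl_toFormSpace] at h
  rw [Subtype.ext h]

theorem denseRange_formIncl (hA : IsL2Loc A) (hB : MemLp B (3 / 2) volume) :
    DenseRange (formIncl hA hB) := by
  refine (dense_formDomain hA).mono fun u hu => ?_
  exact ⟨toFormSpace hA hB ⟨u, hu⟩, rfl⟩

/-- The form operator `P_A + |B|` is `R⁻¹ - 1` with `R = ι ι*`. -/
theorem mem_pauliTilde_iff (hA : IsL2Loc A) (hB : MemLp B (3 / 2) volume) (u f : Hil) :
    (u, f) ∈ pauliTilde A B ↔ ∃ k, u = formIncl hA hB ((formIncl hA hB).adjoint k) ∧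
      f = k - formIncl hA hB ((formIncl hA hB).adjoint k) := by
  constructor
  · rintro ⟨w, hw : (w : Hil) = u, h⟩
    have h' : ∀ v, pauliTildeForm A B v w = ⟪(v : Hil), f⟫_ℂ := h
    -- If `T u = f` for the form operator `T`, then `(T + 1) u = f + u`; hence `k = f + u`.
    have key : (formIncl hA hB).adjoint (f + u) = toFormSpace hA hB w := by
      refine ext_inner_left ℂ fun v => ?_
      obtain ⟨v, rfl⟩ := exists_toFormSpace hA hB v
      rw [ContinuousLinearMap.adjoint_inner_right, inner_toFormSpace, h', formIncl_toFormSpace,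
        inner_add_right, hw, add_comm]
    refine ⟨f + u, ?_, ?_⟩ <;> rw [key, formIncl_toFormSpace, hw]
    abel
  · rintro ⟨k, rfl, rfl⟩
    obtain ⟨w, hw⟩ := exists_toFormSpace hA hB ((formIncl hA hB).adjoint k)
    refine ⟨w, ?_, fun v => ?_⟩
    · rw [hw, formIncl_toFormSpace]
    · have := ContinuousLinearMap.adjoint_inner_right (formIncl hA hB) (toFormSpace hA hB v) k
      rw [hw, inner_toFormSpace, formIncl_toFormSpace] at this
      simp only
      rw [hw, formIncl_toFormSpace, inner_sub_right, ← this]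
      abel

/-- Existence of a square root, so that `opSqrt` does not fall back to its default value. -/
theorem isNonnegSqrt_pauliTildeSqrt (hA : IsL2Loc A) (hB : MemLp B (3 / 2) volume) :
    IsNonnegSqrt (pauliTildeSqrt A B) (pauliTilde A B) := by
  have hex : ∃ D : Hil →ₗ.[ℂ] Hil, IsNonnegSqrt D (pauliTilde A B) := by
    obtain ⟨D, h1, h2, h3⟩ := exists_sqrt_of_resolvent
      (formIncl hA hB ∘L (formIncl hA hB).adjoint) (comp_adjoint_nonneg _)
      (comp_adjoint_le_one (norm_formIncl_le hA hB))
      (injective_comp_adjoint (injective_formIncl hA hB) (denseRange_formIncl hA hB))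
    exact ⟨D, h1, h2, fun u f => (mem_pauliTilde_iff hA hB u f).trans (h3 u f)⟩
  rw [pauliTildeSqrt, opSqrt, dif_pos hex]
  exact hex.choose_spec

/-- The domain and the form are determined by the square alone, so this holds for whichever root was
chosen and no uniqueness is needed. -/
theorem pauliTildeSqrt_spec (hA : IsL2Loc A) (hB : MemLp B (3 / 2) volume) :
    (pauliTildeSqrt A B).domain = formDomain A ∧
      ∀ (x y : (pauliTildeSqrt A B).domain) (v u : formDomain A), (x : Hil) = v → (y : Hil) = u →
        ⟪pauliTildeSqrt A B x, pauliTildeSqrt A B y⟫_ℂ = pauliTildeForm A B v u := by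
  obtain ⟨h1, -, h3⟩ := isNonnegSqrt_pauliTildeSqrt hA hB
  obtain ⟨hd, hf⟩ := sqrt_domain_and_form (injective_formIncl hA hB) h1
    fun u f => (mem_pauliTilde_iff hA hB u f).symm.trans (h3 u f)
  refine ⟨?_, fun x y v u hx hy => ?_⟩
  · ext u
    rw [hd]
    constructor
    · rintro ⟨w, rfl⟩
      obtain ⟨w, rfl⟩ := exists_toFormSpace hA hB w
      exact w.2
    · exact fun hu => ⟨toFormSpace hA hB ⟨u, hu⟩, rfl⟩
  · rw [hf (toFormSpace hA hB v) (toFormSpace hA hB u) x y hx hy, inner_toFormSpace,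
      formIncl_toFormSpace, formIncl_toFormSpace, add_sub_cancel_left]

/-! ### The square root, `U` and `S` on the form domain -/

/-- An element of the form domain as an element of the domain of `(P_A + |B|)^{1/2}`. -/
def toPreTilde (hA : IsL2Loc A) (hB : MemLp B (3 / 2) volume) :
    formDomain A →ₗ[ℂ] PreTilde (pauliTildeSqrt A B) :=
  Submodule.inclusion (pauliTildeSqrt_spec hA hB).1.ge

theorem preTildeIncl_toPreTilde (hA : IsL2Loc A) (hB : MemLp B (3 / 2) volume)
    (u : formDomain A) : preTildeIncl _ (toPreTilde hA hB u) = (u : Hil) := rfl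

theorem exists_toPreTilde (hA : IsL2Loc A) (hB : MemLp B (3 / 2) volume)
    (w : PreTilde (pauliTildeSqrt A B)) : ∃ u, w = toPreTilde hA hB u :=
  ⟨⟨preTildeIncl _ w, (pauliTildeSqrt_spec hA hB).1.le w.2⟩, rfl⟩

/-- `(P_A + |B|)^{1/2}` as a linear map on the form domain. -/
def sqrtMap (hA : IsL2Loc A) (hB : MemLp B (3 / 2) volume) : formDomain A →ₗ[ℂ] Hil :=
  preTildeMap (pauliTildeSqrt A B) ∘ₗ toPreTilde hA hB

theorem inner_sqrtMap (hA : IsL2Loc A) (hB : MemLp B (3 / 2) volume) (v u : formDomain A) :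
    ⟪sqrtMap hA hB v, sqrtMap hA hB u⟫_ℂ = pauliTildeForm A B v u :=
  (pauliTildeSqrt_spec hA hB).2 _ _ v u rfl rfl

theorem norm_sqrtMap_sq (hA : IsL2Loc A) (hB : MemLp B (3 / 2) volume) (u : formDomain A) :
    ‖sqrtMap hA hB u‖ ^ 2 = ‖covGrad A u‖ ^ 2 + ‖defectMul hA hB u‖ ^ 2 := by
  have h := inner_sqrtMap hA hB u u
  rw [pauliTildeForm_eq hA hB, inner_self_eq_norm_sq_to_K, inner_self_eq_norm_sq_to_K,
    inner_self_eq_norm_sq_to_K] at h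
  exact_mod_cast h

/-- Together with `norm_sqrtMap_le` this makes `‖D u‖` and `‖(p - A) u‖` equivalent, without the
term `‖u‖`. -/
theorem norm_covGrad_le_sqrtMap (hA : IsL2Loc A) (hB : MemLp B (3 / 2) volume)
    (u : formDomain A) : ‖covGrad A u‖ ≤ ‖sqrtMap hA hB u‖ := by
  refine le_of_sq_le_sq ?_ (norm_nonneg _)
  rw [norm_sqrtMap_sq]
  exact le_add_of_nonneg_right (sq_nonneg _)

theorem norm_sqrtMap_le (hA : IsL2Loc A) (hB : MemLp B (3 / 2) volume) (u : formDomain A) :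
    ‖sqrtMap hA hB u‖ ≤ √(1 + 2 * (fieldConst B).toReal) * ‖covGrad A u‖ := by
  refine le_of_sq_le_sq ?_ (by positivity)
  rw [mul_pow, Real.sq_sqrt (by positivity), norm_sqrtMap_sq]
  linarith [norm_defectMul_sq_le hA hB u]

theorem norm_fieldMul_le (hA : IsL2Loc A) (hB : MemLp B (3 / 2) volume) (u : formDomain A) :
    ‖fieldMul hA hB u‖ ≤ √(fieldConst B).toReal * ‖covGrad A u‖ := by
  refine le_of_sq_le_sq ?_ (by positivity)
  rw [mul_pow, Real.sq_sqrt (by positivity)]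
  exact norm_fieldMul_sq_le hA hB u

/-- The Sobolev inequality bounds the `L⁶` norm by `‖(p - A) u‖` alone. -/
theorem eq_zero_of_covGrad_eq_zero (hA : IsL2Loc A) (u : formDomain A) (h : covGrad A u = 0) :
    u = 0 := by
  have h6 := sobolev_form hA u
  simp only [h, norm_zero, ne_eq, OfNat.ofNat_ne_zero, not_false_eq_true, zero_pow,
    ENNReal.ofReal_zero, mul_zero, ENNReal.zero_rpow_of_pos (by norm_num : (0 : ℝ) < 3),
    nonpos_iff_eq_zero] at h6
  rw [lintegral_eq_zero_iff' (by
    exact ((Lp.aestronglyMeasurable (u : Hil)).enorm.pow_const 6))] at h6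
  refine Subtype.ext ?_
  rw [Submodule.coe_zero, Lp.eq_zero_iff_ae_eq_zero]
  filter_upwards [h6] with x hx
  simpa using hx

theorem sqrtMap_injective (hA : IsL2Loc A) (hB : MemLp B (3 / 2) volume) :
    Function.Injective (sqrtMap hA hB) := by
  rw [injective_iff_map_eq_zero]
  intro u hu
  refine eq_zero_of_covGrad_eq_zero hA u ?_
  have := norm_covGrad_le_sqrtMap hA hB u
  rw [hu, norm_zero] at this
  exact norm_le_zero_iff.1 this

/-- A vector orthogonal to the range of a self-adjoint operator lies in its kernel, and `D` is
injective. -/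
theorem denseRange_sqrtMap (hA : IsL2Loc A) (hB : MemLp B (3 / 2) volume) :
    DenseRange (sqrtMap hA hB) := by
  have hD := (isNonnegSqrt_pauliTildeSqrt hA hB).1
  have h : (LinearMap.range (sqrtMap hA hB)).topologicalClosure = ⊤ := by
    rw [Submodule.topologicalClosure_eq_top_iff, Submodule.eq_bot_iff]
    intro y hy
    have hg : (y, (0 : Hil)) ∈ (pauliTildeSqrt A B).graph := by
      refine mem_graph_of_isSelfAdjoint hD fun x => ?_
      obtain ⟨u, hu⟩ := exists_toPreTilde hA hB x
      rw [inner_zero_left, eq_comm, inner_eq_zero_symm]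
      exact hy _ ⟨u, by rw [sqrtMap, LinearMap.comp_apply, ← hu]; rfl⟩
    obtain ⟨w, hw1, hw2⟩ := (LinearPMap.mem_graph_iff _).1 hg
    obtain ⟨u, rfl⟩ := exists_toPreTilde hA hB w
    have h0 : sqrtMap hA hB u = 0 := hw2
    have := sqrtMap_injective hA hB (h0.trans (map_zero _).symm)
    rw [← show (u : Hil) = y from hw1, this, Submodule.coe_zero]
  intro f
  have : f ∈ (LinearMap.range (sqrtMap hA hB)).topologicalClosure := h ▸ Submodule.mem_top
  exact this

theorem norm_coe_toPreTilde (hA : IsL2Loc A) (hB : MemLp B (3 / 2) volume) (u : formDomain A) :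
    ‖((toPreTilde hA hB u : PreTilde _) : Tilde (pauliTildeSqrt A B))‖ = ‖sqrtMap hA hB u‖ :=
  Completion.norm_coe _

/-- `D u ↦ u` is isometric into the completion and densely defined, so the extension that `tildeU`
asks for exists. -/
theorem opU_sqrtMap (hA : IsL2Loc A) (hB : MemLp B (3 / 2) volume) (u : formDomain A) :
    opU A B (sqrtMap hA hB u) = ((toPreTilde hA hB u : PreTilde _) : Tilde _) := by
  have hex : ∃ U : Hil →L[ℂ] Tilde (pauliTildeSqrt A B),
      ∀ u : PreTilde (pauliTildeSqrt A B), U (preTildeMap _ u) = (u : Tilde (pauliTildeSqrt A B)) := by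
    have hd : DenseRange (preTildeMap (pauliTildeSqrt A B)) :=
      (denseRange_sqrtMap hA hB).mono (by rintro _ ⟨u, rfl⟩; exact ⟨toPreTilde hA hB u, rfl⟩)
    refine ⟨(Completion.toComplL (𝕜 := ℂ) (E := PreTilde _)).toLinearMap.extendOfNorm
      (preTildeMap _), fun u => ?_⟩
    exact LinearMap.extendOfNorm_eq hd
      ⟨1, fun x => by rw [one_mul]; exact (Completion.norm_coe x).le⟩ u
  rw [opU, tildeU, dif_pos hex]
  exact hex.choose_spec _

theorem opS_sqrtMap (hA : IsL2Loc A) (hB : MemLp B (3 / 2) volume) (u : formDomain A) :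
    opS A B (sqrtMap hA hB u) = fieldMul hA hB u := by
  have hex : ∃ M : Tilde (pauliTildeSqrt A B) →L[ℂ] Hil, ∀ u : PreTilde (pauliTildeSqrt A B),
      (M (u : Tilde _) =ᵐ[volume]
        fun x => ((√‖B x‖ : ℝ) : ℂ) • (preTildeIncl (pauliTildeSqrt A B) u) x) := by
    let m : PreTilde (pauliTildeSqrt A B) →ₗ[ℂ] Hil :=
      fieldMul hA hB ∘ₗ Submodule.inclusion (pauliTildeSqrt_spec hA hB).1.le
    refine ⟨m.extendOfNorm (Completion.toComplL (𝕜 := ℂ) (E := PreTilde _)).toLinearMap,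
      fun u => ?_⟩
    have := LinearMap.extendOfNorm_eq (f := m)
      (e := (Completion.toComplL (𝕜 := ℂ) (E := PreTilde (pauliTildeSqrt A B))).toLinearMap)
      Completion.denseRange_coe ⟨√(fieldConst B).toReal, fun x => ?_⟩ u
    · have h2 : (m.extendOfNorm (Completion.toComplL (𝕜 := ℂ) (E := PreTilde _)).toLinearMap)
        (u : Tilde (pauliTildeSqrt A B)) = m u := this
      rw [h2]
      exact fieldMul_ae hA hB _
    · obtain ⟨v, rfl⟩ := exists_toPreTilde hA hB x
      refine (norm_fieldMul_le hA hB v).trans ?_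
      gcongr
      exact (norm_covGrad_le_sqrtMap hA hB v).trans (norm_coe_toPreTilde hA hB v).ge
  rw [opS, ContinuousLinearMap.comp_apply, opU_sqrtMap hA hB, tildeMul, dif_pos hex]
  refine Lp.ext ((hex.choose_spec (toPreTilde hA hB u)).trans ?_)
  rw [preTildeIncl_toPreTilde]
  exact (fieldMul_ae hA hB u).symm

/-- The link between the two sides of the theorem: `1 - S* S` is the Pauli form transported by `D`.
-/
theorem inner_one_sub_adjoint_opS (hA : IsL2Loc A) (hB : MemLp B (3 / 2) volume)
    (v u : formDomain A) :
    ⟪sqrtMap hA hB v, sqrtMap hA hB u -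
      ContinuousLinearMap.adjoint (opS A B) (opS A B (sqrtMap hA hB u))⟫_ℂ = pauliForm A B v u := by
  rw [inner_sub_right, ContinuousLinearMap.adjoint_inner_right, opS_sqrtMap, opS_sqrtMap,
    inner_sqrtMap, pauliForm_eq hA hB]

theorem tendsto_sqrtMap (hA : IsL2Loc A) (hB : MemLp B (3 / 2) volume) {q : ℕ → formDomain A}
    {u : formDomain A}
    (h : Filter.Tendsto (fun n => covGrad A (q n)) Filter.atTop (nhds (covGrad A u))) :
    Filter.Tendsto (fun n => sqrtMap hA hB (q n)) Filter.atTop (nhds (sqrtMap hA hB u)) := by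
  rw [tendsto_iff_norm_sub_tendsto_zero] at h ⊢
  have h' := h.const_mul √(1 + 2 * (fieldConst B).toReal)
  rw [mul_zero] at h'
  refine squeeze_zero (fun _ => norm_nonneg _) (fun n => ?_) h'
  rw [← map_sub, ← covGrad_sub]
  exact norm_sqrtMap_le hA hB _

/-- The images of test functions under `(P_A + |B|)^{1/2}` are dense. -/
theorem dense_sqrtMap_toForm (hA : IsL2Loc A) (hB : MemLp B (3 / 2) volume) :
    Dense {f : Hil | ∃ (φ : Space → Spinor) (hφ : IsTest φ),
      f = sqrtMap hA hB (hφ.toForm hA)} := by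
  refine dense_closure.1 ((denseRange_sqrtMap hA hB).mono ?_)
  rintro _ ⟨u, rfl⟩
  obtain ⟨φ, hφ, -, h⟩ := exists_seq_isTest hA u
  refine mem_closure_of_tendsto (tendsto_sqrtMap hA hB h)
    (Filter.Eventually.of_forall fun n => ⟨φ n, hφ n, rfl⟩)

/-! ### Compactness of `S` -/

/-- The scheme of all limits below: an error `c k` uniform in `n` is made small first, then `n → ∞`
with `k` fixed. -/
theorem tendsto_zero_of_forall_le_add {a : ℕ → ℝ≥0∞} {b : ℕ → ℕ → ℝ≥0∞} {c : ℕ → ℝ≥0∞}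
    (h : ∀ k n, a n ≤ b k n + c k)
    (hb : ∀ k, Filter.Tendsto (b k) Filter.atTop (nhds 0))
    (hc : Filter.Tendsto c Filter.atTop (nhds 0)) : Filter.Tendsto a Filter.atTop (nhds 0) := by
  rw [ENNReal.tendsto_nhds_zero] at hc ⊢
  intro ε hε
  obtain ⟨k, hk⟩ := (hc (ε / 2) (ENNReal.half_pos hε.ne')).exists
  filter_upwards [ENNReal.tendsto_nhds_zero.1 (hb k) (ε / 2) (ENNReal.half_pos hε.ne')] with n hn
  exact (h k n).trans ((add_le_add hn hk).trans (ENNReal.add_halves ε).le)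

/-- Bounded sequences in a separable Hilbert space have weakly convergent subsequences. -/
theorem exists_weak_subseq {H : Type*} [NormedAddCommGroup H] [InnerProductSpace ℂ H]
    [CompleteSpace H] [TopologicalSpace.SeparableSpace H] {f : ℕ → H} {r : ℝ}
    (hf : ∀ n, ‖f n‖ ≤ r) : ∃ (g : H) (k : ℕ → ℕ), StrictMono k ∧
      ∀ h : H, Filter.Tendsto (fun n => ⟪f (k n), h⟫_ℂ) Filter.atTop (nhds ⟪g, h⟫_ℂ) := by
  obtain ⟨a, -, k, hk, hak⟩ := WeakDual.isSeqCompact_closedBall ℂ H 0 r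
    (x := fun n => StrongDual.toWeakDual (InnerProductSpace.toDual ℂ H (f n))) (fun n => by
      simpa using hf n)
  refine ⟨(InnerProductSpace.toDual ℂ H).symm (WeakDual.toStrongDual a), k, hk, fun h => ?_⟩
  have := ((WeakDual.eval_continuous h).tendsto a).comp hak
  rw [InnerProductSpace.toDual_symm_apply]
  exact this

/-! ### Translations and averages over small balls -/

section Translation

variable {F : Type*} [NormedAddCommGroup F] [NormedSpace ℝ F] [CompleteSpace F]

theorem enorm_translate_sub_le {g : Space → F} (hg : IsTest g) (x z : Space) :
    ‖g (x + z) - g x‖ₑ ≤ ∫⁻ t in Set.Ioc (0 : ℝ) 1, ‖z‖ₑ * ‖fderiv ℝ g (x + t • z)‖ₑ := by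
  have hc : Continuous (fderiv ℝ g) := hg.1.continuous_fderiv (by simp)
  have hd : ∀ t : ℝ, HasDerivAt (fun t : ℝ => g (x + t • z)) (fderiv ℝ g (x + t • z) z) t := by
    intro t
    have h1 : HasDerivAt (fun t : ℝ => x + t • z) z t := by
      simpa using ((hasDerivAt_id t).smul_const z).const_add x
    exact (hg.differentiableAt _).hasFDerivAt.comp_hasDerivAt t h1
  have hi := intervalIntegral.integral_eq_sub_of_hasDerivAt (a := 0) (b := 1) (fun t _ => hd t)
    (Continuous.intervalIntegrable (by fun_prop) _ _)
  simp only [one_smul, zero_smul, add_zero] at hi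
  rw [← hi, intervalIntegral.integral_of_le zero_le_one]
  refine (enorm_integral_le_lintegral_enorm _).trans (lintegral_mono fun t => ?_)
  rw [mul_comm]
  exact ContinuousLinearMap.le_opENorm _ _

theorem lintegral_translate_sub_le {g : Space → F} (hg : IsTest g) (z : Space) :
    ∫⁻ x, ‖g (x + z) - g x‖ₑ ≤ ‖z‖ₑ * ∫⁻ x, ‖fderiv ℝ g x‖ₑ := by
  have hc : Continuous (fderiv ℝ g) := hg.1.continuous_fderiv (by simp)
  have hm : Measurable fun p : Space × ℝ => ‖z‖ₑ * ‖fderiv ℝ g (p.1 + p.2 • z)‖ₑ := by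
    refine Measurable.const_mul ?_ _
    exact (hc.comp (by fun_prop)).enorm.measurable
  calc ∫⁻ x, ‖g (x + z) - g x‖ₑ
      ≤ ∫⁻ x, ∫⁻ t in Set.Ioc (0 : ℝ) 1, ‖z‖ₑ * ‖fderiv ℝ g (x + t • z)‖ₑ :=
        lintegral_mono fun x => enorm_translate_sub_le hg x z
    _ = ∫⁻ t in Set.Ioc (0 : ℝ) 1, ∫⁻ x, ‖z‖ₑ * ‖fderiv ℝ g (x + t • z)‖ₑ :=
        lintegral_lintegral_swap hm.aemeasurable
    _ = ∫⁻ t in Set.Ioc (0 : ℝ) 1, ‖z‖ₑ * ∫⁻ x, ‖fderiv ℝ g x‖ₑ := by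
        refine lintegral_congr fun t => ?_
        rw [lintegral_const_mul' _ _ (by simp), lintegral_add_right_eq_self fun x => ‖fderiv ℝ g x‖ₑ]
    _ = ‖z‖ₑ * ∫⁻ x, ‖fderiv ℝ g x‖ₑ := by simp

/-- A function is close in `L¹` to its averages over small balls. -/
theorem measure_ball_mul_lintegral_le {g : Space → F} (hg : IsTest g) (h : ℝ) (s : Set Space) :
    volume (Metric.ball (0 : Space) h) * ∫⁻ x in s, ‖g x‖ₑ ≤
      (∫⁻ x in s, ‖∫ z in Metric.ball (0 : Space) h, g (x + z)‖ₑ) +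
        volume (Metric.ball (0 : Space) h) * (ENNReal.ofReal h * ∫⁻ x, ‖fderiv ℝ g x‖ₑ) := by
  set b := Metric.ball (0 : Space) h with hb
  have hbt : volume b ≠ ⊤ := measure_ball_lt_top.ne
  have hpt : ∀ x, volume b * ‖g x‖ₑ ≤
      ‖∫ z in b, g (x + z)‖ₑ + ∫⁻ z in b, ‖g (x + z) - g x‖ₑ := by
    intro x
    have i1 : IntegrableOn (fun z => g (x + z)) b :=
      ((hg.continuous.comp (by fun_prop)).continuousOn.integrableOn_compact
        (isCompact_closedBall 0 h)).mono_set Metric.ball_subset_closedBall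
    have i2 : IntegrableOn (fun z => g (x + z) - g x) b :=
      i1.sub (integrableOn_const hbt)
    have e : (volume.real b) • g x = (∫ z in b, g (x + z)) - ∫ z in b, (g (x + z) - g x) := by
      rw [integral_sub i1 (integrableOn_const hbt), setIntegral_const, sub_sub_cancel]
    have e2 : volume b * ‖g x‖ₑ = ‖(volume.real b) • g x‖ₑ := by
      rw [enorm_smul, Real.enorm_eq_ofReal measureReal_nonneg, ofReal_measureReal hbt]
    rw [e2, e]
    exact enorm_sub_le.trans (add_le_add le_rfl (enorm_integral_le_lintegral_enorm _))
  have hm : Measurable fun p : Space × Space => ‖g (p.1 + p.2) - g p.1‖ₑ :=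
    ((hg.continuous.comp (by fun_prop)).sub (hg.continuous.comp (by fun_prop))).enorm.measurable
  calc volume b * ∫⁻ x in s, ‖g x‖ₑ = ∫⁻ x in s, volume b * ‖g x‖ₑ :=
        (lintegral_const_mul' _ _ hbt).symm
    _ ≤ ∫⁻ x in s, (‖∫ z in b, g (x + z)‖ₑ + ∫⁻ z in b, ‖g (x + z) - g x‖ₑ) :=
        lintegral_mono hpt
    _ = (∫⁻ x in s, ‖∫ z in b, g (x + z)‖ₑ) + ∫⁻ x in s, ∫⁻ z in b, ‖g (x + z) - g x‖ₑ :=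
        lintegral_add_right _ hm.lintegral_prod_right'
    _ ≤ _ := by
        refine add_le_add le_rfl ?_
        calc ∫⁻ x in s, ∫⁻ z in b, ‖g (x + z) - g x‖ₑ
            ≤ ∫⁻ x, ∫⁻ z in b, ‖g (x + z) - g x‖ₑ := setLIntegral_le_lintegral _ _
          _ = ∫⁻ z in b, ∫⁻ x, ‖g (x + z) - g x‖ₑ := lintegral_lintegral_swap hm.aemeasurable
          _ ≤ ∫⁻ z in b, ENNReal.ofReal h * ∫⁻ x, ‖fderiv ℝ g x‖ₑ := by
              refine setLIntegral_mono' measurableSet_ball fun z hz => ?_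
              refine (lintegral_translate_sub_le hg z).trans ?_
              gcongr
              rw [← ofReal_norm]
              exact ENNReal.ofReal_le_ofReal (mem_ball_zero_iff.1 hz).le
          _ = _ := by rw [setLIntegral_const, mul_comm]

end Translation

/-! ### Local compactness of the form domain -/

/-- A field of unit length on a ball, and zero elsewhere. -/
def ballField (R : ℝ) : Space → Space :=
  (Metric.ball (0 : Space) R).indicator fun _ => EuclideanSpace.single 0 1

theorem memLp_ballField (R : ℝ) : MemLp (ballField R) (3 / 2) volume :=
  memLp_indicator_const _ measurableSet_ball _ (Or.inr measure_ball_lt_top.ne)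

theorem norm_ballField (R : ℝ) (x : Space) :
    ‖ballField R x‖ = (Metric.ball (0 : Space) R).indicator 1 x := by
  by_cases h : x ∈ Metric.ball (0 : Space) R <;> simp [ballField, h]

/-- Feeding the indicator of a ball into the field bound gives local `L²` control by `‖(p - A) u‖`.
-/
theorem lintegral_ball_le_form (hA : IsL2Loc A) (R : ℝ) (u : formDomain A) :
    ∫⁻ x in Metric.ball (0 : Space) R, ‖(u : Hil) x‖ₑ ^ 2 ≤
      fieldConst (ballField R) * ENNReal.ofReal (‖covGrad A u‖ ^ 2) := by
  refine le_trans (le_of_eq ?_) (lintegral_field_le_form hA (memLp_ballField R) u)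
  rw [← lintegral_indicator measurableSet_ball]
  refine lintegral_congr fun x => ?_
  rw [← ofReal_norm, norm_ballField]
  by_cases h : x ∈ Metric.ball (0 : Space) R <;> simp [h]

theorem IsTest.lintegral_ball_le (hA : IsL2Loc A) (R : ℝ) {φ : Space → Spinor} (hφ : IsTest φ) :
    ∫⁻ x in Metric.ball (0 : Space) R, ‖φ x‖ₑ ^ 2 ≤
      fieldConst (ballField R) * ENNReal.ofReal (‖covGrad A (hφ.toForm hA)‖ ^ 2) := by
  refine le_trans (le_of_eq (lintegral_congr_ae (ae_restrict_of_ae ?_)))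
    (lintegral_ball_le_form hA R (hφ.toForm hA))
  filter_upwards [hφ.toForm_ae hA] with x hx
  rw [hx]

/-- Operators that are bounded in the form norm preserve weak convergence to zero. -/
theorem tendsto_inner_of_sqrtMap_weak (hA : IsL2Loc A) (hB : MemLp B (3 / 2) volume)
    (L : formDomain A →ₗ[ℂ] Hil) {C : ℝ} (hC : 0 ≤ C) (hL : ∀ u, ‖L u‖ ≤ C * ‖covGrad A u‖)
    {q : ℕ → formDomain A}
    (hq : ∀ h : Hil, Filter.Tendsto (fun n => ⟪sqrtMap hA hB (q n), h⟫_ℂ) Filter.atTop (nhds 0))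
    (h : Hil) : Filter.Tendsto (fun n => ⟪L (q n), h⟫_ℂ) Filter.atTop (nhds 0) := by
  have hT := LinearMap.extendOfNorm_eq (f := L) (e := sqrtMap hA hB) (denseRange_sqrtMap hA hB)
    ⟨C, fun u => (hL u).trans (by gcongr; exact norm_covGrad_le_sqrtMap hA hB u)⟩
  refine (hq ((L.extendOfNorm (sqrtMap hA hB)).adjoint h)).congr fun n => ?_
  rw [ContinuousLinearMap.adjoint_inner_right, hT]

theorem mul_le_sq_add_sq (a b : ℝ≥0∞) : a * b ≤ a ^ 2 + b ^ 2 := by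
  rcases le_total a b with h | h
  · exact le_add_left ((mul_le_mul_left h b).trans (sq b).ge)
  · exact le_add_right ((mul_le_mul_right h a).trans (sq a).ge)

/-- A smooth cutoff that equals one on the ball of radius `R`. -/
theorem exists_cutoff {R : ℝ} (hR : 0 < R) : ∃ θ : Space → ℝ, IsTest θ ∧ (∀ x, 0 ≤ θ x) ∧
    (∀ x, θ x ≤ 1) ∧ (∀ x ∈ Metric.ball (0 : Space) R, θ x = 1) ∧
    tsupport θ ⊆ Metric.ball (0 : Space) (2 * R + 1) := by
  let b : ContDiffBump (0 : Space) := ⟨R, 2 * R, hR, by linarith⟩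
  refine ⟨b, ⟨b.contDiff, b.hasCompactSupport⟩, fun x => b.nonneg, fun x => b.le_one,
    fun x hx => b.one_of_mem_closedBall (Metric.ball_subset_closedBall hx), ?_⟩
  rw [b.tsupport_eq]
  exact Metric.closedBall_subset_ball (by linarith)

theorem partialDeriv_eq_zero_of_notMem_tsupport {F : Type*} [NormedAddCommGroup F]
    [NormedSpace ℝ F] {f : Space → F} {x : Space} (j : Fin 3) (h : x ∉ tsupport f) :
    partialDeriv j f x = 0 := by
  rw [partialDeriv, image_eq_zero_of_notMem_tsupport fun h' => h (tsupport_fderiv_subset ℝ h')]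
  rfl

theorem enorm_partialDeriv_le (A : Space → Space) (j : Fin 3) (φ : Space → Spinor) (x : Space) :
    ‖partialDeriv j φ x‖ₑ ≤ ‖cov A j φ x‖ₑ + ‖A x‖ₑ * ‖φ x‖ₑ := by
  have h : ‖partialDeriv j φ x‖ₑ = ‖cov A j φ x + ((A x j : ℝ) : ℂ) • φ x‖ₑ := by
    rw [cov, sub_add_cancel, enorm_smul, enorm_neg, ← ofReal_norm Complex.I, Complex.norm_I,
      ENNReal.ofReal_one, one_mul]
  rw [h]
  refine (enorm_add_le _ _).trans (add_le_add le_rfl ?_)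
  rw [enorm_smul]
  gcongr
  rw [← ofReal_norm, ← ofReal_norm, Complex.norm_real]
  exact ENNReal.ofReal_le_ofReal (PiLp.norm_apply_le (A x) j)

/-- Since `∂ⱼ φ = i (p - A)ⱼ φ + i Aⱼ φ` and `A` is only locally square integrable, the product `A
φ` is controlled just in `L¹`. Products are split by `a b ≤ a² + b²`; the factor `3` counts the
coordinates. -/
theorem exists_lintegral_fderiv_cutoff_le (hA : IsL2Loc A) {θ : Space → ℝ} (hθ : IsTest θ)
    (hθ0 : ∀ x, 0 ≤ θ x) (hθ1 : ∀ x, θ x ≤ 1) {R : ℝ}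
    (hR : tsupport θ ⊆ Metric.ball (0 : Space) R) {E : ℝ≥0∞} (hE : E ≠ ⊤) :
    ∃ K : ℝ≥0∞, K ≠ ⊤ ∧ ∀ (φ : Space → Spinor) (hφ : IsTest φ),
      ENNReal.ofReal (‖covGrad A (hφ.toForm hA)‖ ^ 2) ≤ E →
        ∫⁻ x, ‖fderiv ℝ (fun y => θ y • φ y) x‖ₑ ≤ K := by
  have hb : ∀ j, ∃ c : ℝ, ∀ x, ‖partialDeriv j θ x‖ ≤ c := fun j =>
    (hθ.partialDeriv j).2.exists_bound_of_continuous (hθ.partialDeriv j).continuous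
  choose c hc using hb
  let b := Metric.ball (0 : Space) R
  let k : ℝ≥0∞ := 1 + ∑ j, ENNReal.ofReal (c j) ^ 2
  have hk : k ≠ ⊤ := ENNReal.add_ne_top.2 ⟨by simp, by simp [ENNReal.sum_eq_top]⟩
  let a : ℝ≥0∞ := ∫⁻ x in b, ‖A x‖ₑ ^ 2
  have hAb : MemLp A 2 (volume.restrict b) :=
    (hA _ (isCompact_closedBall 0 R)).mono_measure
      (Measure.restrict_mono Metric.ball_subset_closedBall le_rfl)
  have ha : a ≠ ⊤ := by
    have := (eLpNorm_lt_top_iff_lintegral_rpow_enorm_lt_top (by simp) (by simp)).1 hAb.2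
    simpa using this.ne
  have hbt : volume b ≠ ⊤ := measure_ball_lt_top.ne
  refine ⟨3 * (E + a + (k * volume b + 2 * (fieldConst (ballField R) * E))), ?_, fun φ hφ hφE => ?_⟩
  · have := fieldConst_ne_top (memLp_ballField R)
    finiteness
  have hpt : ∀ x, ‖fderiv ℝ (fun y => θ y • φ y) x‖ₑ ≤ b.indicator
      (fun x => 3 * ((∑ j, ‖cov A j φ x‖ₑ ^ 2) + ‖A x‖ₑ ^ 2 + (k + 2 * ‖φ x‖ₑ ^ 2))) x := by
    intro x
    have h1 : ‖fderiv ℝ (fun y => θ y • φ y) x‖ₑ ≤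
        ∑ j, ‖partialDeriv j (fun y => θ y • φ y) x‖ₑ := by
      rw [← ofReal_norm]
      refine (ENNReal.ofReal_le_ofReal (norm_fderiv_le_sum _ _)).trans (le_of_eq ?_)
      rw [ENNReal.ofReal_sum_of_nonneg fun _ _ => norm_nonneg _]
      simp [ofReal_norm]
    refine h1.trans ?_
    simp only [fun j => partialDeriv_smul j (hθ.differentiableAt x) (hφ.differentiableAt x)]
    by_cases hx : x ∈ tsupport θ
    · rw [Set.indicator_of_mem (hR hx)]
      have : (3 : ℝ≥0∞) = ((Finset.univ : Finset (Fin 3)).card : ℝ≥0∞) := by simp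
      rw [this, ← nsmul_eq_mul]
      refine Finset.sum_le_card_nsmul _ _ _ fun j _ => ?_
      calc ‖θ x • partialDeriv j φ x + partialDeriv j θ x • φ x‖ₑ
          ≤ ‖θ x‖ₑ * ‖partialDeriv j φ x‖ₑ + ‖partialDeriv j θ x‖ₑ * ‖φ x‖ₑ := by
            refine (enorm_add_le _ _).trans ?_
            rw [enorm_smul, enorm_smul]
        _ ≤ 1 * (‖cov A j φ x‖ₑ * 1 + ‖A x‖ₑ * ‖φ x‖ₑ) + ENNReal.ofReal (c j) * ‖φ x‖ₑ := by
            gcongr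
            · rw [Real.enorm_eq_ofReal (hθ0 x)]
              exact ENNReal.ofReal_le_one.2 (hθ1 x)
            · rw [mul_one]
              exact enorm_partialDeriv_le A j φ x
            · rw [← ofReal_norm]
              exact ENNReal.ofReal_le_ofReal (hc j x)
        _ ≤ 1 * ((‖cov A j φ x‖ₑ ^ 2 + 1 ^ 2) + (‖A x‖ₑ ^ 2 + ‖φ x‖ₑ ^ 2)) +
            (ENNReal.ofReal (c j) ^ 2 + ‖φ x‖ₑ ^ 2) := by
            gcongr <;> exact mul_le_sq_add_sq _ _
        _ = ‖cov A j φ x‖ₑ ^ 2 + ‖A x‖ₑ ^ 2 +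
            ((1 + ENNReal.ofReal (c j) ^ 2) + 2 * ‖φ x‖ₑ ^ 2) := by ring
        _ ≤ _ := by
            gcongr
            · exact Finset.single_le_sum (f := fun j => ‖cov A j φ x‖ₑ ^ 2) (fun _ _ => zero_le)
                (Finset.mem_univ j)
            · exact add_le_add le_rfl (Finset.single_le_sum
                (f := fun j => ENNReal.ofReal (c j) ^ 2) (fun _ _ => zero_le) (Finset.mem_univ j))
    · have h0 := image_eq_zero_of_notMem_tsupport hx
      simp [h0, partialDeriv_eq_zero_of_notMem_tsupport _ hx]
  refine (lintegral_mono hpt).trans ?_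
  rw [lintegral_indicator measurableSet_ball, lintegral_const_mul' _ _ (by simp)]
  have hφm : Measurable fun x => ‖φ x‖ₑ ^ 2 := hφ.continuous.enorm.measurable.pow_const 2
  rw [lintegral_add_right _ (by fun_prop), lintegral_add_right' _ (hAb.1.enorm.pow_const 2),
    lintegral_add_right _ (by fun_prop), lintegral_const_mul _ hφm, setLIntegral_const]
  gcongr
  · refine (setLIntegral_le_lintegral _ _).trans (le_trans (le_of_eq ?_) hφE)
    exact covEnergy_eq hA hφ
  · exact (hφ.lintegral_ball_le hA R).trans (by gcongr)

/-- An average over a ball is an `L²` pairing with a fixed function. Restriction to a ball, realised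
as `fieldMul` for `ballField`, is bounded in the form norm and therefore preserves weak convergence.
-/
theorem tendsto_integral_cutoff_of_weak (hA : IsL2Loc A) (hB : MemLp B (3 / 2) volume)
    {φ : ℕ → Space → Spinor} (hφ : ∀ n, IsTest (φ n))
    (hw : ∀ h : Hil, Filter.Tendsto (fun n => ⟪sqrtMap hA hB ((hφ n).toForm hA), h⟫_ℂ)
      Filter.atTop (nhds 0)) {θ : Space → ℝ} (hθ : IsTest θ) {R : ℝ}
    (hR : tsupport θ ⊆ Metric.ball (0 : Space) R) (h : ℝ) (x : Space) :
    Filter.Tendsto (fun n => ∫ z in Metric.ball (0 : Space) h, θ (x + z) • φ n (x + z))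
      Filter.atTop (nhds 0) := by
  have key : ∀ e : Spinor, Filter.Tendsto
      (fun n => ⟪e, ∫ z in Metric.ball (0 : Space) h, θ (x + z) • φ n (x + z)⟫_ℂ)
      Filter.atTop (nhds 0) := by
    intro e
    have hte : IsTest fun y => θ y • e := hθ.clm (ContinuousLinearMap.toSpanSingleton ℝ e)
    -- The fixed function of the pairing: `θ e` on the ball around `x` that results from translating
    -- the domain of integration.
    have hχ : MemLp ((Metric.ball x h).indicator fun y => θ y • e) 2 :=
      MemLp.indicator measurableSet_ball (hte.memLp 2)
    have h1 := tendsto_inner_of_sqrtMap_weak hA hB (fieldMul hA (memLp_ballField R))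
      (Real.sqrt_nonneg _) (norm_fieldMul_le hA (memLp_ballField R)) hw (hχ.toLp _)
    have h2 := (Complex.continuous_conj.tendsto 0).comp h1
    rw [map_zero] at h2
    refine h2.congr fun n => ?_
    simp only [Function.comp_apply]
    rw [inner_conj_symm, L2.inner_def]
    have i1 : IntegrableOn (fun z => θ (x + z) • φ n (x + z)) (Metric.ball (0 : Space) h) :=
      ((((hφ n).smul_left hθ.1).continuous.comp (by fun_prop : Continuous fun z => x + z)
        ).continuousOn.integrableOn_compact (isCompact_closedBall 0 h)).mono_set
        Metric.ball_subset_closedBall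
    rw [← integral_inner i1, ← integral_indicator measurableSet_ball,
      ← integral_add_left_eq_self _ x]
    refine integral_congr_ae ?_
    have hae := (hχ.coeFn_toLp).and ((fieldMul_ae hA (memLp_ballField R) ((hφ n).toForm hA)).and
      ((hφ n).toForm_ae hA))
    filter_upwards [(quasiMeasurePreserving_add_left volume x).ae hae] with z hz
    obtain ⟨hz1, hz2, hz3⟩ := hz
    rw [hz1, hz2, hz3, norm_ballField]
    have hmem : x + z ∈ Metric.ball x h ↔ z ∈ Metric.ball (0 : Space) h := by simp
    by_cases hzh : z ∈ Metric.ball (0 : Space) h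
    · rw [Set.indicator_of_mem (hmem.2 hzh), Set.indicator_of_mem hzh]
      by_cases hzR : x + z ∈ Metric.ball (0 : Space) R
      · rw [Set.indicator_of_mem hzR]
        simp [inner_smul_left_eq_smul, inner_smul_right_eq_smul]
      · have : θ (x + z) = 0 := image_eq_zero_of_notMem_tsupport fun h' => hzR (hR h')
        simp [this]
    · rw [Set.indicator_of_notMem (fun h' => hzh (hmem.1 h')), Set.indicator_of_notMem hzh,
        inner_zero_left]
  have hb := tendsto_finsetSum (Finset.univ : Finset (Fin 2)) fun k _ =>
    (key (EuclideanSpace.basisFun (Fin 2) ℂ k)).smul_const (EuclideanSpace.basisFun (Fin 2) ℂ k)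
  simp only [zero_smul, Finset.sum_const_zero] at hb
  exact hb.congr fun n => OrthonormalBasis.sum_repr' _ _

/-- Rellich's theorem in `L¹`: weakly null sequences in the form norm are locally null. -/
theorem tendsto_lintegral_ball_of_weak (hA : IsL2Loc A) (hB : MemLp B (3 / 2) volume)
    {φ : ℕ → Space → Spinor} (hφ : ∀ n, IsTest (φ n)) {r : ℝ}
    (hr : ∀ n, ‖sqrtMap hA hB ((hφ n).toForm hA)‖ ≤ r)
    (hw : ∀ h : Hil, Filter.Tendsto (fun n => ⟪sqrtMap hA hB ((hφ n).toForm hA), h⟫_ℂ)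
      Filter.atTop (nhds 0)) {R : ℝ} (hR : 0 < R) :
    Filter.Tendsto (fun n => ∫⁻ x in Metric.ball (0 : Space) R, ‖φ n x‖ₑ) Filter.atTop
      (nhds 0) := by
  obtain ⟨θ, hθ, hθ0, hθ1, hθR, hθs⟩ := exists_cutoff hR
  have hE : ∀ n, ENNReal.ofReal (‖covGrad A ((hφ n).toForm hA)‖ ^ 2) ≤ ENNReal.ofReal (r ^ 2) :=
    fun n => ENNReal.ofReal_le_ofReal (pow_le_pow_left₀ (norm_nonneg _)
      ((norm_covGrad_le_sqrtMap hA hB _).trans (hr n)) 2)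
  obtain ⟨K, hK, hKφ⟩ := exists_lintegral_fderiv_cutoff_le hA hθ hθ0 hθ1 hθs
    (ENNReal.ofReal_ne_top (r := r ^ 2))
  have hg : ∀ n, IsTest fun x => θ x • φ n x := fun n => (hφ n).smul_left hθ.1
  -- Replacing `θ φ_n` by its averages costs `h K` uniformly in `n`; this becomes the error term
  -- when `h = 1 / (k + 1)`.
  have hsum : ∀ n (h : ℝ), 0 < h → ∫⁻ x in Metric.ball (0 : Space) R, ‖φ n x‖ₑ ≤
      (volume (Metric.ball (0 : Space) h))⁻¹ * (∫⁻ x in Metric.ball (0 : Space) R,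
        ‖∫ z in Metric.ball (0 : Space) h, θ (x + z) • φ n (x + z)‖ₑ) + ENNReal.ofReal h * K := by
    intro n h hh
    have h1 := measure_ball_mul_lintegral_le (hg n) h (Metric.ball (0 : Space) R)
    have hv0 : volume (Metric.ball (0 : Space) h) ≠ 0 := (Metric.measure_ball_pos _ _ hh).ne'
    have hvt : volume (Metric.ball (0 : Space) h) ≠ ⊤ := measure_ball_lt_top.ne
    have h2 : ∫⁻ x in Metric.ball (0 : Space) R, ‖θ x • φ n x‖ₑ =
        ∫⁻ x in Metric.ball (0 : Space) R, ‖φ n x‖ₑ :=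
      setLIntegral_congr_fun measurableSet_ball fun x hx => by simp [hθR x hx]
    rw [h2] at h1
    calc ∫⁻ x in Metric.ball (0 : Space) R, ‖φ n x‖ₑ
        = (volume (Metric.ball (0 : Space) h))⁻¹ * (volume (Metric.ball (0 : Space) h) *
            ∫⁻ x in Metric.ball (0 : Space) R, ‖φ n x‖ₑ) := by
          rw [← mul_assoc, ENNReal.inv_mul_cancel hv0 hvt, one_mul]
      _ ≤ _ := by
          refine (mul_le_mul_right h1 _).trans ?_
          rw [mul_add, ← mul_assoc _ (volume (Metric.ball (0 : Space) h)),
            ENNReal.inv_mul_cancel hv0 hvt, one_mul]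
          gcongr
          exact hKφ _ (hφ n) (hE n)
  have hb : ∀ n, ∫⁻ x, ‖θ x • φ n x‖ₑ ≤ fieldConst (ballField (2 * R + 1)) *
      ENNReal.ofReal (r ^ 2) + volume (Metric.ball (0 : Space) (2 * R + 1)) := by
    intro n
    have hpt : ∀ x, ‖θ x • φ n x‖ₑ ≤
        (Metric.ball (0 : Space) (2 * R + 1)).indicator (fun x => ‖φ n x‖ₑ ^ 2 + 1) x := by
      intro x
      by_cases hx : x ∈ tsupport θ
      · rw [Set.indicator_of_mem (hθs hx), enorm_smul]
        calc ‖θ x‖ₑ * ‖φ n x‖ₑ ≤ 1 * ‖φ n x‖ₑ := by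
              gcongr
              rw [Real.enorm_eq_ofReal (hθ0 x)]
              exact ENNReal.ofReal_le_one.2 (hθ1 x)
          _ = ‖φ n x‖ₑ * 1 := by ring
          _ ≤ ‖φ n x‖ₑ ^ 2 + 1 ^ 2 := mul_le_sq_add_sq _ _
          _ = _ := by rw [one_pow]
      · simp [image_eq_zero_of_notMem_tsupport hx]
    refine (lintegral_mono hpt).trans ?_
    rw [lintegral_indicator measurableSet_ball, lintegral_add_right _ measurable_const,
      setLIntegral_const, one_mul]
    gcongr
    exact ((hφ n).lintegral_ball_le hA _).trans (mul_le_mul_right (hE n) _)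
  have hbt : fieldConst (ballField (2 * R + 1)) * ENNReal.ofReal (r ^ 2) +
      volume (Metric.ball (0 : Space) (2 * R + 1)) ≠ ⊤ := by
    have := fieldConst_ne_top (memLp_ballField (2 * R + 1))
    have := (measure_ball_lt_top (μ := volume) (x := (0 : Space)) (r := 2 * R + 1)).ne
    finiteness
  have hdct : ∀ h : ℝ, Filter.Tendsto (fun n => ∫⁻ x in Metric.ball (0 : Space) R,
      ‖∫ z in Metric.ball (0 : Space) h, θ (x + z) • φ n (x + z)‖ₑ) Filter.atTop (nhds 0) := by
    intro h
    have := tendsto_lintegral_of_dominated_convergence'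
      (μ := volume.restrict (Metric.ball (0 : Space) R)) (f := fun _ => 0)
      (F := fun n x => ‖∫ z in Metric.ball (0 : Space) h, θ (x + z) • φ n (x + z)‖ₑ)
      (fun _ => fieldConst (ballField (2 * R + 1)) * ENNReal.ofReal (r ^ 2) +
        volume (Metric.ball (0 : Space) (2 * R + 1)))
      (fun n => ?_) (fun n => Filter.Eventually.of_forall fun x => ?_) ?_
      (Filter.Eventually.of_forall fun x => ?_)
    · simpa using this
    · have hc : Continuous fun p : Space × Space => θ (p.1 + p.2) • φ n (p.1 + p.2) :=
        (hg n).continuous.comp (by fun_prop)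
      exact (StronglyMeasurable.integral_prod_right' hc.stronglyMeasurable).enorm.aemeasurable
    · refine (enorm_integral_le_lintegral_enorm _).trans ((setLIntegral_le_lintegral _ _).trans ?_)
      rw [lintegral_add_left_eq_self fun y => ‖θ y • φ n y‖ₑ]
      exact hb n
    · rw [setLIntegral_const]
      exact ENNReal.mul_ne_top hbt measure_ball_lt_top.ne
    · have := (tendsto_integral_cutoff_of_weak hA hB hφ hw hθ hθs h x).enorm
      simpa using this
  refine tendsto_zero_of_forall_le_add (fun k n => hsum n (1 / ((k : ℝ) + 1)) (by positivity))
    (fun k => ?_) ?_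
  · have := ENNReal.Tendsto.const_mul (hdct (1 / ((k : ℝ) + 1))) (Or.inr (ENNReal.inv_ne_top.2
      (Metric.measure_ball_pos volume (0 : Space) (r := 1 / ((k : ℝ) + 1)) (by positivity)).ne'))
    simpa using this
  · have := ENNReal.Tendsto.mul_const
      (ENNReal.tendsto_ofReal tendsto_one_div_add_atTop_nhds_zero_nat) (Or.inr hK)
    simpa using this

/-- Interpolation of `L²` between `L¹` and `L⁶`, by comparing `t` with `k + 1`: the `L⁶` part gets a
small coefficient. -/
theorem sq_le_mul_add_inv_mul (k : ℕ) (t : ℝ≥0∞) :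
    t ^ 2 ≤ ((k : ℝ≥0∞) + 1) * t + (((k : ℝ≥0∞) + 1) ^ 4)⁻¹ * t ^ 6 := by
  rcases le_total t ((k : ℝ≥0∞) + 1) with h | h
  · refine le_add_right ?_
    rw [sq]
    exact mul_le_mul_left h t
  · refine le_add_left ?_
    have h0 : ((k : ℝ≥0∞) + 1) ^ 4 ≠ 0 := by simp
    have ht : ((k : ℝ≥0∞) + 1) ^ 4 ≠ ⊤ := by finiteness
    calc t ^ 2 = (((k : ℝ≥0∞) + 1) ^ 4)⁻¹ * (((k : ℝ≥0∞) + 1) ^ 4 * t ^ 2) := by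
          rw [← mul_assoc, ENNReal.inv_mul_cancel h0 ht, one_mul]
      _ ≤ (((k : ℝ≥0∞) + 1) ^ 4)⁻¹ * (t ^ 4 * t ^ 2) := by gcongr
      _ = _ := by rw [← pow_add]

theorem tendsto_inv_nat_add_one_pow (m : ℕ) (hm : m ≠ 0) :
    Filter.Tendsto (fun k : ℕ => (((k : ℝ≥0∞) + 1) ^ m)⁻¹) Filter.atTop (nhds 0) := by
  have h1 : Filter.Tendsto (fun k : ℕ => ((k : ℝ≥0∞) + 1)⁻¹) Filter.atTop (nhds 0) := by
    have := ENNReal.tendsto_inv_nat_nhds_zero.comp (Filter.tendsto_add_atTop_nat 1)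
    refine this.congr fun k => by simp
  have h2 := ((ENNReal.continuous_pow m).tendsto 0).comp h1
  rw [zero_pow hm] at h2
  exact h2.congr fun k => by simp [ENNReal.inv_pow]

/-- Rellich's theorem in `L²`: weakly null sequences in the form norm are locally null. -/
theorem tendsto_lintegral_ball_sq_of_weak (hA : IsL2Loc A) (hB : MemLp B (3 / 2) volume)
    {φ : ℕ → Space → Spinor} (hφ : ∀ n, IsTest (φ n)) {r : ℝ}
    (hr : ∀ n, ‖sqrtMap hA hB ((hφ n).toForm hA)‖ ≤ r)
    (hw : ∀ h : Hil, Filter.Tendsto (fun n => ⟪sqrtMap hA hB ((hφ n).toForm hA), h⟫_ℂ)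
      Filter.atTop (nhds 0)) {R : ℝ} (hR : 0 < R) :
    Filter.Tendsto (fun n => ∫⁻ x in Metric.ball (0 : Space) R, ‖φ n x‖ₑ ^ 2) Filter.atTop
      (nhds 0) := by
  have hL1 := tendsto_lintegral_ball_of_weak hA hB hφ hr hw hR
  have h6 : ∀ n, ∫⁻ x, ‖φ n x‖ₑ ^ 6 ≤ (sobolevConst * ENNReal.ofReal (r ^ 2)) ^ (3 : ℝ) := by
    intro n
    have h1 : ∫⁻ x, ‖φ n x‖ₑ ^ 6 = ∫⁻ x, ‖((hφ n).toForm hA : Hil) x‖ₑ ^ 6 := by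
      refine lintegral_congr_ae ?_
      filter_upwards [(hφ n).toForm_ae hA] with x hx
      rw [hx]
    rw [h1]
    refine (sobolev_form hA _).trans ?_
    gcongr
    exact (norm_covGrad_le_sqrtMap hA hB _).trans (hr n)
  have hC : (sobolevConst * ENNReal.ofReal (r ^ 2)) ^ (3 : ℝ) ≠ ⊤ :=
    ENNReal.rpow_ne_top_of_nonneg (by norm_num)
      (ENNReal.mul_ne_top sobolevConst_ne_top ENNReal.ofReal_ne_top)
  refine tendsto_zero_of_forall_le_add
    (b := fun k n => ((k : ℝ≥0∞) + 1) * ∫⁻ x in Metric.ball (0 : Space) R, ‖φ n x‖ₑ)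
    (c := fun k => (((k : ℝ≥0∞) + 1) ^ 4)⁻¹ * (sobolevConst * ENNReal.ofReal (r ^ 2)) ^ (3 : ℝ))
    (fun k n => ?_) (fun k => ?_) ?_
  · refine (lintegral_mono fun x => sq_le_mul_add_inv_mul k ‖φ n x‖ₑ).trans ?_
    have hm : Measurable fun x => ‖φ n x‖ₑ := (hφ n).continuous.enorm.measurable
    rw [lintegral_add_right _ (by fun_prop), lintegral_const_mul _ hm,
      lintegral_const_mul _ (by fun_prop)]
    gcongr
    exact (setLIntegral_le_lintegral _ _).trans (h6 n)
  · have := ENNReal.Tendsto.const_mul hL1 (Or.inr (by finiteness : (k : ℝ≥0∞) + 1 ≠ ⊤))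
    simpa using this
  · have := ENNReal.Tendsto.mul_const (tendsto_inv_nat_add_one_pow 4 (by norm_num)) (Or.inr hC)
    simpa using this

/-! ### Truncation of the field and compactness of `S` -/

/-- What remains of `|B|` after truncation in value and in space. -/
def fieldTail (B : Space → Space) (k : ℕ) (x : Space) : ℝ :=
  ‖B x‖ - min ‖B x‖ ((Metric.ball (0 : Space) k).indicator (fun _ => (k : ℝ)) x)

theorem fieldTail_nonneg (B : Space → Space) (k : ℕ) (x : Space) : 0 ≤ fieldTail B k x :=
  sub_nonneg.2 (min_le_left _ _)

theorem fieldTail_le (B : Space → Space) (k : ℕ) (x : Space) : fieldTail B k x ≤ ‖B x‖ :=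
  sub_le_self _ (le_min (norm_nonneg _) (Set.indicator_nonneg (fun _ _ => by positivity) _))

theorem memLp_fieldTail (hB : MemLp B (3 / 2) volume) (k : ℕ) :
    MemLp (fieldTail B k) (3 / 2) volume := by
  refine hB.norm.of_le ?_ (Filter.Eventually.of_forall fun x => ?_)
  · exact hB.1.norm.sub (hB.1.norm.inf (aestronglyMeasurable_const.indicator measurableSet_ball))
  · rw [Real.norm_of_nonneg (fieldTail_nonneg B k x), norm_norm]
    exact fieldTail_le B k x

/-- At each point the tail vanishes once `k` exceeds both `‖B x‖` and `‖x‖`. Dominated convergence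
with majorant `|B|^{3/2}` does the rest. -/
theorem tendsto_fieldConst_fieldTail (hB : MemLp B (3 / 2) volume) :
    Filter.Tendsto (fun k => fieldConst (fieldTail B k)) Filter.atTop (nhds 0) := by
  have hfin : ∫⁻ x, ‖B x‖ₑ ^ (3 / 2 : ℝ) ≠ ⊤ := by
    have h32 : ((3 / 2 : ℝ≥0∞)).toReal = 3 / 2 := by simp
    have := lintegral_rpow_enorm_lt_top_of_eLpNorm_lt_top (p := 3 / 2) (by simp)
      (ENNReal.div_ne_top (by simp) (by simp)) hB.eLpNorm_lt_top
    rw [h32] at this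
    exact this.ne
  have h1 : Filter.Tendsto (fun k => ∫⁻ x, ‖fieldTail B k x‖ₑ ^ (3 / 2 : ℝ)) Filter.atTop
      (nhds (∫⁻ _ : Space, 0)) := by
    refine tendsto_lintegral_of_dominated_convergence' (fun x => ‖B x‖ₑ ^ (3 / 2 : ℝ))
      (fun k => (memLp_fieldTail hB k).1.enorm.pow_const _)
      (fun k => Filter.Eventually.of_forall fun x => ?_) hfin
      (Filter.Eventually.of_forall fun x => ?_)
    · refine ENNReal.rpow_le_rpow ?_ (by norm_num)
      rw [Real.enorm_eq_ofReal (fieldTail_nonneg B k x), ← ofReal_norm]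
      exact ENNReal.ofReal_le_ofReal (fieldTail_le B k x)
    · refine tendsto_const_nhds.congr' ?_
      obtain ⟨N, hN⟩ := exists_nat_gt (max ‖B x‖ ‖x‖)
      filter_upwards [Filter.eventually_ge_atTop N] with k hk
      have hk' : max ‖B x‖ ‖x‖ < k := hN.trans_le (by exact_mod_cast hk)
      have hx : x ∈ Metric.ball (0 : Space) k :=
        mem_ball_zero_iff.2 ((le_max_right _ _).trans_lt hk')
      rw [fieldTail, Set.indicator_of_mem hx, min_eq_left ((le_max_left _ _).trans hk'.le), sub_self]
      simp
  rw [lintegral_zero] at h1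
  have h2 := ((ENNReal.continuous_rpow_const (y := (2 / 3 : ℝ))).tendsto 0).comp h1
  rw [ENNReal.zero_rpow_of_pos (by norm_num)] at h2
  have h3 := ENNReal.Tendsto.mul_const h2 (Or.inr sobolevConst_ne_top)
  rw [zero_mul] at h3
  exact h3

theorem tendsto_fieldMul_of_weak (hA : IsL2Loc A) (hB : MemLp B (3 / 2) volume)
    {φ : ℕ → Space → Spinor} (hφ : ∀ n, IsTest (φ n)) {r : ℝ}
    (hr : ∀ n, ‖sqrtMap hA hB ((hφ n).toForm hA)‖ ≤ r)
    (hw : ∀ h : Hil, Filter.Tendsto (fun n => ⟪sqrtMap hA hB ((hφ n).toForm hA), h⟫_ℂ)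
      Filter.atTop (nhds 0)) :
    Filter.Tendsto (fun n => fieldMul hA hB ((hφ n).toForm hA)) Filter.atTop (nhds 0) := by
  have hsq : Filter.Tendsto (fun n => ENNReal.ofReal (‖fieldMul hA hB ((hφ n).toForm hA)‖ ^ 2))
      Filter.atTop (nhds 0) := by
    refine tendsto_zero_of_forall_le_add
      -- The truncated field lives on the ball of radius `k`; the radius `k + 1` keeps it positive
      -- at `k = 0`, as the local theorem requires.
      (b := fun k n => (k : ℝ≥0∞) * ∫⁻ x in Metric.ball (0 : Space) (k + 1 : ℝ), ‖φ n x‖ₑ ^ 2)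
      (c := fun k => fieldConst (fieldTail B k) * ENNReal.ofReal (r ^ 2))
      (fun k n => ?_) (fun k => ?_) ?_
    · have h1 : ∫⁻ x, ‖fieldTail B k x‖ₑ * ‖φ n x‖ₑ ^ 2 ≤
          fieldConst (fieldTail B k) * ENNReal.ofReal (r ^ 2) := by
        have h2 : ∫⁻ x, ‖fieldTail B k x‖ₑ * ‖φ n x‖ₑ ^ 2 =
            ∫⁻ x, ‖fieldTail B k x‖ₑ * ‖((hφ n).toForm hA : Hil) x‖ₑ ^ 2 := by
          refine lintegral_congr_ae ?_
          filter_upwards [(hφ n).toForm_ae hA] with x hx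
          rw [hx]
        rw [h2]
        refine (lintegral_field_le_form hA (memLp_fieldTail hB k) _).trans ?_
        gcongr
        exact (norm_covGrad_le_sqrtMap hA hB _).trans (hr n)
      refine le_trans ?_ (add_le_add le_rfl h1)
      have hφm : Measurable fun x => ‖φ n x‖ₑ ^ 2 := (hφ n).continuous.enorm.measurable.pow_const 2
      rw [ofReal_norm_sq, ← lintegral_const_mul _ hφm, ← lintegral_indicator measurableSet_ball,
        ← lintegral_add_left ((hφm.const_mul _).indicator measurableSet_ball)]
      refine lintegral_mono_ae ?_
      filter_upwards [fieldMul_ae hA hB ((hφ n).toForm hA), (hφ n).toForm_ae hA] with x hx1 hx2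
      rw [hx1, hx2, enorm_sq_sqrt_smul _ (norm_nonneg _), enorm_norm]
      have hBx : ‖B x‖ₑ ≤ (Metric.ball (0 : Space) k).indicator (fun _ => (k : ℝ≥0∞)) x +
          ‖fieldTail B k x‖ₑ := by
        rw [Real.enorm_eq_ofReal (fieldTail_nonneg B k x), ← ofReal_norm]
        by_cases hx : x ∈ Metric.ball (0 : Space) k
        · rw [Set.indicator_of_mem hx, ← ENNReal.ofReal_natCast,
            ← ENNReal.ofReal_add (by positivity) (fieldTail_nonneg B k x)]
          refine ENNReal.ofReal_le_ofReal ?_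
          rw [fieldTail, Set.indicator_of_mem hx]
          linarith [min_le_right ‖B x‖ (k : ℝ)]
        · rw [Set.indicator_of_notMem hx, zero_add, fieldTail, Set.indicator_of_notMem hx,
            min_eq_right (norm_nonneg _), sub_zero]
      refine (mul_le_mul_left hBx _).trans ?_
      rw [add_mul]
      gcongr
      by_cases hx : x ∈ Metric.ball (0 : Space) k
      · rw [Set.indicator_of_mem hx, Set.indicator_of_mem
          (Metric.ball_subset_ball (by linarith) hx)]
      · rw [Set.indicator_of_notMem hx, zero_mul]
        exact zero_le
    · have := ENNReal.Tendsto.const_mul (tendsto_lintegral_ball_sq_of_weak hA hB hφ hr hw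
        (R := k + 1) (by positivity)) (Or.inr (ENNReal.natCast_ne_top k))
      simpa using this
    · have := ENNReal.Tendsto.mul_const (tendsto_fieldConst_fieldTail hB)
        (Or.inr (ENNReal.ofReal_ne_top (r := r ^ 2)))
      simpa using this
  have h1 := (ENNReal.tendsto_toReal ENNReal.zero_ne_top).comp hsq
  have h2 := (Real.continuous_sqrt.tendsto _).comp h1
  rw [tendsto_zero_iff_norm_tendsto_zero]
  simpa [Function.comp_def, ENNReal.toReal_ofReal, Real.sqrt_sq] using h2

/-- `S` is a compact operator: it maps weakly null sequences to null sequences. -/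
theorem tendsto_opS_of_weak (hA : IsL2Loc A) (hB : MemLp B (3 / 2) volume) {f : ℕ → Hil} {r : ℝ}
    (hr : ∀ n, ‖f n‖ ≤ r)
    (hw : ∀ h : Hil, Filter.Tendsto (fun n => ⟪f n, h⟫_ℂ) Filter.atTop (nhds 0)) :
    Filter.Tendsto (fun n => opS A B (f n)) Filter.atTop (nhds 0) := by
  -- The sequence is replaced by images of test functions, with an error that tends to zero in norm
  -- and is harmless for weak limits and for `S`.
  have hex : ∀ n : ℕ, ∃ (φ : Space → Spinor) (hφ : IsTest φ),
      ‖f n - sqrtMap hA hB (hφ.toForm hA)‖ < 1 / ((n : ℝ) + 1) := by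
    intro n
    obtain ⟨g, ⟨φ, hφ, rfl⟩, hg⟩ := (dense_sqrtMap_toForm hA hB).exists_dist_lt (f n)
      (by positivity : 0 < 1 / ((n : ℝ) + 1))
    exact ⟨φ, hφ, by rwa [← dist_eq_norm]⟩
  choose φ hφ hd using hex
  have hd0 : Filter.Tendsto (fun n => f n - sqrtMap hA hB ((hφ n).toForm hA)) Filter.atTop
      (nhds 0) := by
    rw [tendsto_zero_iff_norm_tendsto_zero]
    exact squeeze_zero (fun _ => norm_nonneg _) (fun n => (hd n).le)
      tendsto_one_div_add_atTop_nhds_zero_nat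
  have hw' : ∀ h : Hil, Filter.Tendsto (fun n => ⟪sqrtMap hA hB ((hφ n).toForm hA), h⟫_ℂ)
      Filter.atTop (nhds 0) := by
    intro h
    have h1 := (hw h).sub (hd0.inner (𝕜 := ℂ) (tendsto_const_nhds (x := h)))
    rw [inner_zero_left, sub_zero] at h1
    exact h1.congr fun n => by rw [inner_sub_left, sub_sub_cancel]
  have hr' : ∀ n, ‖sqrtMap hA hB ((hφ n).toForm hA)‖ ≤ r + 1 := by
    intro n
    have h1 : 1 / ((n : ℝ) + 1) ≤ 1 := by
      rw [div_le_one (by positivity)]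
      linarith [(Nat.cast_nonneg n : (0 : ℝ) ≤ n)]
    have h2 := norm_sub_norm_le (sqrtMap hA hB ((hφ n).toForm hA)) (f n)
    rw [norm_sub_rev] at h2
    linarith [hr n, hd n]
  have h1 := tendsto_fieldMul_of_weak hA hB hφ hr' hw'
  have h2 := ((opS A B).continuous.tendsto 0).comp hd0
  rw [map_zero] at h2
  have h3 := h2.add h1
  rw [add_zero] at h3
  refine h3.congr fun n => ?_
  simp only [Function.comp_apply]
  rw [map_sub, opS_sqrtMap, sub_add_cancel]

/-! ### Multiplication operators and cutoffs -/

theorem memLp_mul (m : BoundedContinuousFunction Space ℝ) (f : Hil) :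
    MemLp (fun x => ((m x : ℝ) : ℂ) • (f : Space → Spinor) x) 2 := by
  refine (Lp.memLp f).of_le_mul (c := ‖m‖) ?_ (Filter.Eventually.of_forall fun x => ?_)
  · exact (Complex.continuous_ofReal.comp m.continuous).aestronglyMeasurable.smul
      (Lp.aestronglyMeasurable f)
  · rw [norm_smul, Complex.norm_real]
    gcongr
    exact m.norm_coe_le_norm x

/-- Multiplication by a bounded continuous function. -/
def mulHil (m : BoundedContinuousFunction Space ℝ) : Hil →L[ℂ] Hil :=
  LinearMap.mkContinuous
    { toFun := fun f => (memLp_mul m f).toLp _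
      map_add' := fun f g => by
        rw [← MemLp.toLp_add]
        refine MemLp.toLp_congr _ _ ?_
        filter_upwards [Lp.coeFn_add f g] with x hx
        simp only [hx, Pi.add_apply, smul_add]
      map_smul' := fun c f => by
        rw [RingHom.id_apply, ← MemLp.toLp_const_smul]
        refine MemLp.toLp_congr _ _ ?_
        filter_upwards [Lp.coeFn_smul c f] with x hx
        simp only [hx, Pi.smul_apply]
        rw [smul_comm] } ‖m‖ fun f => by
    refine Lp.norm_le_mul_norm_of_ae_le_mul ?_
    filter_upwards [(memLp_mul m f).coeFn_toLp] with x hx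
    simp only [LinearMap.coe_mk, AddHom.coe_mk]
    rw [hx, norm_smul, Complex.norm_real]
    gcongr
    exact m.norm_coe_le_norm x

theorem mulHil_ae (m : BoundedContinuousFunction Space ℝ) (f : Hil) :
    (mulHil m f : Space → Spinor) =ᵐ[volume] fun x => ((m x : ℝ) : ℂ) • (f : Space → Spinor) x :=
  (memLp_mul m f).coeFn_toLp

theorem tendsto_mulHil {m : ℕ → BoundedContinuousFunction Space ℝ} {C : ℝ}
    (hC : ∀ k x, |m k x| ≤ C) {a : ℝ}
    (hm : ∀ x, Filter.Tendsto (fun k => m k x) Filter.atTop (nhds a)) (f : Hil) :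
    Filter.Tendsto (fun k => mulHil (m k) f) Filter.atTop (nhds ((a : ℂ) • f)) := by
  have h1 : Filter.Tendsto (fun k => ∫⁻ x, ENNReal.ofReal ((m k x - a) ^ 2) *
      ‖(f : Space → Spinor) x‖ₑ ^ 2) Filter.atTop (nhds (∫⁻ _ : Space, 0)) := by
    refine tendsto_lintegral_of_dominated_convergence'
      (fun x => ENNReal.ofReal ((C + |a|) ^ 2) * ‖(f : Space → Spinor) x‖ₑ ^ 2)
      (fun k => ?_) (fun k => Filter.Eventually.of_forall fun x => ?_) ?_
      (Filter.Eventually.of_forall fun x => ?_)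
    · have hc : Continuous fun x => ENNReal.ofReal ((m k x - a) ^ 2) :=
        ENNReal.continuous_ofReal.comp (by fun_prop)
      exact hc.aemeasurable.mul ((Lp.aestronglyMeasurable f).enorm.pow_const 2)
    · refine mul_le_mul_left (ENNReal.ofReal_le_ofReal ?_) _
      rw [← sq_abs]
      exact pow_le_pow_left₀ (abs_nonneg _)
        ((abs_sub _ _).trans (add_le_add (hC k x) le_rfl)) 2
    · rw [lintegral_const_mul' _ _ ENNReal.ofReal_ne_top, ← ofReal_norm_sq]
      finiteness
    · have h2 : Filter.Tendsto (fun k => ENNReal.ofReal ((m k x - a) ^ 2)) Filter.atTop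
          (nhds 0) := by
        have h3 := ENNReal.tendsto_ofReal (((hm x).sub_const a).pow 2)
        simpa using h3
      have := ENNReal.Tendsto.mul_const h2
        (Or.inr (by finiteness : ‖(f : Space → Spinor) x‖ₑ ^ 2 ≠ ⊤))
      simpa using this
  rw [lintegral_zero] at h1
  have h2 : ∀ k, ∫⁻ x, ENNReal.ofReal ((m k x - a) ^ 2) * ‖(f : Space → Spinor) x‖ₑ ^ 2 =
      ENNReal.ofReal (‖mulHil (m k) f - (a : ℂ) • f‖ ^ 2) := by
    intro k
    rw [ofReal_norm_sq]
    refine lintegral_congr_ae ?_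
    filter_upwards [mulHil_ae (m k) f, Lp.coeFn_smul (a : ℂ) f,
      Lp.coeFn_sub (mulHil (m k) f) ((a : ℂ) • f)] with x e1 e2 e3
    rw [e3, Pi.sub_apply, e1, e2, Pi.smul_apply, ← sub_smul, enorm_smul, mul_pow,
      ← Complex.ofReal_sub, ← sq_abs, ENNReal.ofReal_pow (abs_nonneg _),
      ← ofReal_norm ((m k x - a : ℝ) : ℂ),
      Complex.norm_real, Real.norm_eq_abs]
  simp only [h2] at h1
  have h3 := (ENNReal.tendsto_toReal ENNReal.zero_ne_top).comp h1
  have h4 := (Real.continuous_sqrt.tendsto _).comp h3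
  rw [tendsto_iff_norm_sub_tendsto_zero]
  simpa [Function.comp_def, ENNReal.toReal_ofReal, Real.sqrt_sq] using h4

theorem mulHil_mulHil {m n p : BoundedContinuousFunction Space ℝ}
    (h : ∀ x, m x * n x = p x) (f : Hil) : mulHil m (mulHil n f) = mulHil p f := by
  refine Lp.ext ((mulHil_ae _ _).trans ?_)
  filter_upwards [mulHil_ae n f, mulHil_ae p f] with x e1 e2
  rw [e1, e2, smul_smul, ← Complex.ofReal_mul, h]

/-- A sequence of cutoffs with bounded gradients that exhausts the space. -/
theorem exists_cutoff_seq : ∃ θ : ℕ → Space → ℝ, (∀ k, IsTest (θ k)) ∧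
    (∀ k x, |θ k x| ≤ 1) ∧ (∀ x, Filter.Tendsto (fun k => θ k x) Filter.atTop (nhds 1)) ∧
    ∀ j, (∃ C, ∀ k x, |partialDeriv j (θ k) x| ≤ C) ∧
      ∀ x, Filter.Tendsto (fun k => partialDeriv j (θ k) x) Filter.atTop (nhds 0) := by
  obtain ⟨θ, hθ, hθ0, hθ1, hθR, -⟩ := exists_cutoff one_pos
  -- Dilating one cutoff makes the gradients of order `1 / (k + 1)`.
  let c : ℕ → ℝ := fun k => 1 / ((k : ℝ) + 1)
  have hc0 : ∀ k, 0 < c k := fun k => by positivity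
  have hc1 : ∀ k, c k ≤ 1 := fun k => by
    rw [div_le_one (by positivity)]
    linarith [(Nat.cast_nonneg k : (0 : ℝ) ≤ k)]
  have hct : Filter.Tendsto c Filter.atTop (nhds 0) := tendsto_one_div_add_atTop_nhds_zero_nat
  have hd : ∀ j k x, partialDeriv j (fun y => θ (c k • y)) x =
      c k * partialDeriv j θ (c k • x) := by
    intro j k x
    rw [partialDeriv, fderiv_comp_smul, partialDeriv]
    simp
  refine ⟨fun k x => θ (c k • x), fun k => ⟨hθ.1.comp (contDiff_const_smul _),
    hθ.2.comp_smul (hc0 k).ne'⟩, fun k x => ?_, fun x => ?_, fun j => ?_⟩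
  · rw [abs_of_nonneg (hθ0 _)]
    exact hθ1 _
  · have h1 : Filter.Tendsto (fun k => θ (c k • x)) Filter.atTop (nhds (θ ((0 : ℝ) • x))) :=
      (hθ.continuous.tendsto _).comp (hct.smul_const x)
    rwa [zero_smul, hθR 0 (by simp)] at h1
  · obtain ⟨C, hC⟩ := (hθ.partialDeriv j).2.exists_bound_of_continuous
      (hθ.partialDeriv j).continuous
    have hC0 : 0 ≤ C := (norm_nonneg _).trans (hC 0)
    have hb : ∀ k x, |partialDeriv j (fun y => θ (c k • y)) x| ≤ c k * C := fun k x => by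
      rw [hd, abs_mul, abs_of_pos (hc0 k)]
      exact mul_le_mul_of_nonneg_left (hC _) (hc0 k).le
    refine ⟨⟨C, fun k x => (hb k x).trans (mul_le_of_le_one_left hC0 (hc1 k))⟩, fun x => ?_⟩
    refine squeeze_zero_norm (hb · x) ?_
    simpa using hct.mul_const C

/-- A continuous function with compact support as a bounded continuous function. -/
theorem exists_bcf {f : Space → ℝ} (hf : Continuous f) (hc : HasCompactSupport f) :
    ∃ m : BoundedContinuousFunction Space ℝ, ∀ x, m x = f x := by
  obtain ⟨C, hC⟩ := hc.exists_bound_of_continuous hf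
  exact ⟨BoundedContinuousFunction.ofNormedAddCommGroup f hf C hC, fun x => rfl⟩

/-! ### Zero modes -/

theorem pauliForm_toForm_self (hA : IsL2Loc A) (hB : MemLp B (3 / 2) volume)
    (hcurl : HasWeakCurl A B) {φ : Space → Spinor} (hφ : IsTest φ) :
    pauliForm A B (hφ.toForm hA) (hφ.toForm hA) =
      ((∫ x, diracSq fun j => cov A j φ x : ℝ) : ℂ) := by
  have h1 : ∫ x, ⟪((hφ.toForm hA : formDomain A) : Hil) x,
      Matrix.toEuclideanLin (sigmaDot (B x)) (((hφ.toForm hA : formDomain A) : Hil) x)⟫_ℂ =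
      ((∫ x, ∑ l, B x l * spin l (φ x) : ℝ) : ℂ) := by
    rw [← integral_complex_ofReal]
    refine integral_congr_ae ?_
    filter_upwards [hφ.toForm_ae hA] with x hx
    rw [hx]
    exact inner_sigmaAct_self (B x) (φ x)
  rw [pauliForm, h1, (lichnerowicz hA hB hcurl hφ).2.2, hφ.covGrad_toForm hA,
    inner_self_eq_norm_sq_to_K, ← norm_sq_covHil hA hφ]
  push_cast
  rfl

/-- The weight `(1 + ε ⟨x⟩)⁻¹` as a bounded continuous function. -/
def dampBcf {ε : ℝ} (hε : 0 < ε) : BoundedContinuousFunction Space ℝ :=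
  BoundedContinuousFunction.ofNormedAddCommGroup (damp ε) (contDiff_damp hε).continuous 1
    fun x => by
      rw [Real.norm_of_nonneg (damp_pos hε x).le]
      exact damp_le_one hε x

theorem dampBcf_apply {ε : ℝ} (hε : 0 < ε) (x : Space) : dampBcf hε x = damp ε x := rfl

/-- The damped bound in operator terms: the Lichnerowicz formula turns `‖σ · (p - A) φ‖²` into the
Pauli form. -/
theorem exists_norm_damp_le (hA : IsL2Loc A) (hB : MemLp B (3 / 2) volume)
    (hcurl : HasWeakCurl A B)
    (hdecay : ∃ β > (0 : ℝ), ∃ C ≥ (0 : ℝ), ∃ r₀ ≥ (0 : ℝ),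
      ∀ᵐ x : Space, r₀ ≤ ‖x‖ → ‖B x‖ ≤ C * ‖x‖ ^ (-2 - β)) :
    ∃ K : ℝ, 0 ≤ K ∧ ∀ (φ : Space → Spinor) (hφ : IsTest φ) (ε : ℝ) (hε : 0 < ε),
      ‖mulHil (dampBcf hε) (hφ.toForm hA)‖ ^ 2 ≤
        8 * (ε⁻¹) ^ 2 * (pauliForm A B (hφ.toForm hA) (hφ.toForm hA)).re +
          K * ‖fieldMul hA hB (hφ.toForm hA)‖ ^ 2 := by
  obtain ⟨K, hK, h⟩ := exists_damped_bound hA hB hcurl hdecay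
  refine ⟨K, hK, fun φ hφ ε hε => ?_⟩
  have h1 : ‖mulHil (dampBcf hε) (hφ.toForm hA)‖ ^ 2 = ∫ x, damp ε x ^ 2 * ‖φ x‖ ^ 2 := by
    rw [norm_sq_eq_integral]
    refine integral_congr_ae ?_
    filter_upwards [mulHil_ae (dampBcf hε) (hφ.toForm hA), hφ.toForm_ae hA] with x e1 e2
    rw [e1, e2, norm_smul, mul_pow, Complex.norm_real, dampBcf_apply, Real.norm_eq_abs, sq_abs]
  have h2 : ‖fieldMul hA hB (hφ.toForm hA)‖ ^ 2 = ∫ x, ‖B x‖ * ‖φ x‖ ^ 2 := by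
    rw [norm_sq_eq_integral]
    refine integral_congr_ae ?_
    filter_upwards [fieldMul_ae hA hB (hφ.toForm hA), hφ.toForm_ae hA] with x e1 e2
    rw [e1, e2, norm_smul, mul_pow, Complex.norm_real, Real.norm_eq_abs, sq_abs,
      Real.sq_sqrt (norm_nonneg _)]
  rw [h1, h2, pauliForm_toForm_self hA hB hcurl hφ, Complex.ofReal_re]
  exact h φ hφ ε hε

theorem re_pauliForm_self (hA : IsL2Loc A) (hB : MemLp B (3 / 2) volume) (u : formDomain A) :
    (pauliForm A B u u).re = ‖sqrtMap hA hB u‖ ^ 2 - ‖fieldMul hA hB u‖ ^ 2 := by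
  rw [pauliForm_eq hA hB, ← inner_sqrtMap hA hB, inner_self_eq_norm_sq_to_K,
    inner_self_eq_norm_sq_to_K]
  norm_cast

/-- At `ε = 1` both terms of the damped bound are controlled by `‖D u‖²`. Cauchy sequences in the
norm `‖D u‖` therefore converge in a weighted `L²` space. -/
theorem exists_norm_damp_one_le (hA : IsL2Loc A) (hB : MemLp B (3 / 2) volume)
    (hcurl : HasWeakCurl A B)
    (hdecay : ∃ β > (0 : ℝ), ∃ C ≥ (0 : ℝ), ∃ r₀ ≥ (0 : ℝ),
      ∀ᵐ x : Space, r₀ ≤ ‖x‖ → ‖B x‖ ≤ C * ‖x‖ ^ (-2 - β)) :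
    ∃ C : ℝ, 0 ≤ C ∧ ∀ u : formDomain A,
      ‖mulHil (dampBcf one_pos) (u : Hil)‖ ≤ C * ‖sqrtMap hA hB u‖ := by
  obtain ⟨K, hK, h⟩ := exists_norm_damp_le hA hB hcurl hdecay
  refine ⟨√(8 + K * (fieldConst B).toReal), Real.sqrt_nonneg _, fun u => ?_⟩
  have htest : ∀ (φ : Space → Spinor) (hφ : IsTest φ),
      ‖mulHil (dampBcf one_pos) (hφ.toForm hA)‖ ≤
        √(8 + K * (fieldConst B).toReal) * ‖sqrtMap hA hB (hφ.toForm hA)‖ := by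
    intro φ hφ
    refine le_of_sq_le_sq ?_ (by positivity)
    rw [mul_pow, Real.sq_sqrt (by positivity)]
    have h1 := h φ hφ 1 one_pos
    rw [re_pauliForm_self hA hB] at h1
    have h2 : ‖fieldMul hA hB (hφ.toForm hA)‖ ^ 2 ≤
        (fieldConst B).toReal * ‖sqrtMap hA hB (hφ.toForm hA)‖ ^ 2 :=
      (norm_fieldMul_sq_le hA hB _).trans (by
        gcongr
        exact norm_covGrad_le_sqrtMap hA hB _)
    have h3 := mul_le_mul_of_nonneg_left h2 hK
    have h4 := sq_nonneg ‖fieldMul hA hB (hφ.toForm hA)‖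
    rw [inv_one] at h1
    nlinarith
  obtain ⟨φ, hφ, h1, h2⟩ := exists_seq_isTest hA u
  have h3 := (((mulHil (dampBcf one_pos)).continuous.tendsto _).comp h1).norm
  have h4 := ((tendsto_sqrtMap hA hB h2).norm).const_mul √(8 + K * (fieldConst B).toReal)
  exact le_of_tendsto_of_tendsto' h3 h4 fun n => htest _ (hφ n)

theorem IsTest.cov_smul_toForm (hA : IsL2Loc A) {θ : Space → ℝ} (hθ : IsTest θ)
    {φ : Space → Spinor} (hφ : IsTest φ) {m : BoundedContinuousFunction Space ℝ}
    {d : Fin 3 → BoundedContinuousFunction Space ℝ} (hm : ∀ x, m x = θ x)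
    (hd : ∀ j x, d j x = Pauli.partialDeriv j θ x) :
    ((IsTest.smul_left hθ.1 hφ).toForm hA : Hil) = mulHil m (hφ.toForm hA) ∧
    ∀ j, covGrad A ((IsTest.smul_left hθ.1 hφ).toForm hA) j =
      mulHil m (covGrad A (hφ.toForm hA) j) -
        Complex.I • mulHil (d j) (hφ.toForm hA) := by
  constructor
  · refine Lp.ext (((IsTest.smul_left hθ.1 hφ).toForm_ae hA).trans ?_)
    filter_upwards [mulHil_ae m (hφ.toForm hA), hφ.toForm_ae hA] with x e1 e2
    rw [e1, e2, hm, Complex.coe_smul]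
  · intro j
    rw [IsTest.covGrad_toForm, IsTest.covGrad_toForm]
    refine Lp.ext (((IsTest.smul_left hθ.1 hφ).covHil_ae hA j).trans ?_)
    filter_upwards [mulHil_ae m (hφ.covHil hA j), hφ.covHil_ae hA j,
      mulHil_ae (d j) (hφ.toForm hA), hφ.toForm_ae hA,
      Lp.coeFn_smul Complex.I (mulHil (d j) (hφ.toForm hA)),
      Lp.coeFn_sub (mulHil m (hφ.covHil hA j)) (Complex.I • mulHil (d j) (hφ.toForm hA))]
      with x e1 e2 e3 e4 e5 e6
    rw [e6, Pi.sub_apply, e5, Pi.smul_apply, e1, e2, e3, e4, hm, hd,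
      cov_smul A j (hθ.differentiableAt x) (hφ.differentiableAt x), Complex.coe_smul, smul_smul]

theorem tendsto_piLp {ι : Type*} {l : Filter ι} {F : ι → PiLp 2 (fun _ : Fin 3 => Hil)}
    {G : PiLp 2 (fun _ : Fin 3 => Hil)}
    (h : ∀ j, Filter.Tendsto (fun n => F n j) l (nhds (G j))) : Filter.Tendsto F l (nhds G) :=
  ((PiLp.continuous_toLp 2 (fun _ : Fin 3 => Hil)).tendsto (WithLp.ofLp G)).comp
    (tendsto_pi_nhds.2 h)

/-- If `(p - A) φₙ` converges in `L²` and `φₙ` converges to an `L²` function in a weighted `L²` norm,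
then the limit lies in the form domain. -/
theorem exists_form_of_tendsto_damp (hA : IsL2Loc A) {φ : ℕ → Space → Spinor}
    (hφ : ∀ n, IsTest (φ n)) {w : Hil} {G : PiLp 2 (fun _ : Fin 3 => Hil)}
    (h1 : Filter.Tendsto (fun n => mulHil (dampBcf one_pos) ((hφ n).toForm hA)) Filter.atTop
      (nhds (mulHil (dampBcf one_pos) w)))
    (h2 : Filter.Tendsto (fun n => covGrad A ((hφ n).toForm hA)) Filter.atTop (nhds G)) :
    ∃ u : formDomain A, (u : Hil) = w ∧ covGrad A u = G := by
  obtain ⟨θ, hθ, hθb, hθt, hθd⟩ := exists_cutoff_seq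
  choose C hC using fun j => (hθd j).1
  choose m hm using fun k => exists_bcf (hθ k).continuous (hθ k).2
  choose d hd using fun k j => exists_bcf ((hθ k).partialDeriv j).continuous
    ((hθ k).partialDeriv j).2
  -- On a compact support division by the weight is bounded, so weighted convergence becomes `L²`
  -- convergence after a cutoff.
  have hinv : ∀ f : Space → ℝ, IsTest f → ∃ n : BoundedContinuousFunction Space ℝ,
      ∀ x, n x * dampBcf one_pos x = f x := by
    intro f hf
    obtain ⟨n, hn⟩ := exists_bcf (f := fun x => f x * (1 + 1 * bracket x))
      (hf.continuous.mul (by have := contDiff_bracket.continuous; fun_prop)) hf.2.mul_right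
    refine ⟨n, fun x => ?_⟩
    rw [hn, dampBcf_apply, mul_assoc, mul_comm (1 + 1 * bracket x), damp_mul one_pos, mul_one]
  have hconv : ∀ (f : Space → ℝ), IsTest f → ∀ p : BoundedContinuousFunction Space ℝ,
      (∀ x, p x = f x) → Filter.Tendsto (fun n => mulHil p ((hφ n).toForm hA)) Filter.atTop
        (nhds (mulHil p w)) := by
    intro f hf p hp
    obtain ⟨n, hn⟩ := hinv f hf
    have hn' : ∀ x, n x * dampBcf one_pos x = p x := fun x => (hn x).trans (hp x).symm
    have := ((mulHil n).continuous.tendsto _).comp h1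
    rw [mulHil_mulHil hn'] at this
    exact this.congr fun k => by rw [Function.comp_apply, mulHil_mulHil hn']
  -- The limit in `n` is taken for a fixed cutoff. The cutoff is removed afterwards, where the
  -- commutator term vanishes because `w` is in `L²`.
  have hk : ∀ k, ∃ u : formDomain A, (u : Hil) = mulHil (m k) w ∧
      covGrad A u = WithLp.toLp 2 fun j => mulHil (m k) (G j) - Complex.I • mulHil (d k j) w := by
    intro k
    refine exists_form_of_tendsto hA
      (q := fun n => (IsTest.smul_left (hθ k).1 (hφ n)).toForm hA) (l := Filter.atTop) ?_ ?_
    · simp only [fun n => (IsTest.cov_smul_toForm hA (hθ k) (hφ n) (hm k) (hd k)).1]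
      exact hconv _ (hθ k) _ (hm k)
    · refine tendsto_piLp fun j => ?_
      simp only [fun n => (IsTest.cov_smul_toForm hA (hθ k) (hφ n) (hm k) (hd k)).2 j]
      refine Filter.Tendsto.sub ?_ ((hconv _ ((hθ k).partialDeriv j) _ (hd k j)).const_smul _)
      exact ((mulHil (m k)).continuous.tendsto _).comp
        (((PiLp.continuous_apply 2 (fun _ : Fin 3 => Hil) j).tendsto G).comp h2)
  choose u hu1 hu2 using hk
  have hone : ∀ f : Hil, Filter.Tendsto (fun k => mulHil (m k) f) Filter.atTop (nhds f) := by
    intro f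
    have := tendsto_mulHil (m := m) (C := 1) (a := 1) (fun k x => by rw [hm]; exact hθb k x)
      (fun x => by simpa only [hm] using hθt x) f
    simpa using this
  refine exists_form_of_tendsto hA (q := u) (l := Filter.atTop) ?_ ?_
  · simp only [hu1]
    exact hone w
  · refine tendsto_piLp fun j => ?_
    simp only [hu2]
    have h3 := tendsto_mulHil (m := fun k => d k j) (C := C j) (a := 0)
      (fun k x => by rw [hd]; exact hC j k x) (fun x => by simpa only [hd] using (hθd j).2 x) w
    have h4 := (hone (G j)).sub (h3.const_smul Complex.I)
    simpa using h4

/-- A fixed vector of `S* S` is in the range of `(P_A + |B|)^{1/2}`. -/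
theorem exists_sqrtMap_eq_of_fixed (hA : IsL2Loc A) (hB : MemLp B (3 / 2) volume)
    (hcurl : HasWeakCurl A B)
    (hdecay : ∃ β > (0 : ℝ), ∃ C ≥ (0 : ℝ), ∃ r₀ ≥ (0 : ℝ),
      ∀ᵐ x : Space, r₀ ≤ ‖x‖ → ‖B x‖ ≤ C * ‖x‖ ^ (-2 - β)) {f : Hil}
    (hf : ContinuousLinearMap.adjoint (opS A B) (opS A B f) = f) :
    ∃ u : formDomain A, sqrtMap hA hB u = f := by
  obtain ⟨g, hg, hgf⟩ := mem_closure_iff_seq_limit.1 (dense_sqrtMap_toForm hA hB f)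
  choose φ hφ hgφ using hg
  obtain rfl : g = fun n => sqrtMap hA hB ((hφ n).toForm hA) := funext hgφ
  obtain ⟨K, hK, hKb⟩ := exists_norm_damp_le hA hB hcurl hdecay
  obtain ⟨C, hC, hCb⟩ := exists_norm_damp_one_le hA hB hcurl hdecay
  have hcauchy := hgf.cauchySeq
  obtain ⟨G, hG⟩ : ∃ G, Filter.Tendsto (fun n => covGrad A ((hφ n).toForm hA)) Filter.atTop
      (nhds G) := by
    refine cauchySeq_tendsto_of_complete (Metric.cauchySeq_iff'.2 fun ε hε => ?_)
    obtain ⟨N, hN⟩ := Metric.cauchySeq_iff'.1 hcauchy ε hε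
    refine ⟨N, fun n hn => lt_of_le_of_lt ?_ (hN n hn)⟩
    rw [dist_eq_norm, dist_eq_norm, ← covGrad_sub, ← map_sub]
    exact norm_covGrad_le_sqrtMap hA hB _
  -- `W` is the limit in the damped norm; the candidate for the form domain is `W` divided by the
  -- weight, not yet known to be in `L²`.
  obtain ⟨W, hW⟩ : ∃ W, Filter.Tendsto
      (fun n => mulHil (dampBcf one_pos) ((hφ n).toForm hA : Hil)) Filter.atTop (nhds W) := by
    refine cauchySeq_tendsto_of_complete (Metric.cauchySeq_iff'.2 fun ε hε => ?_)
    obtain ⟨N, hN⟩ := Metric.cauchySeq_iff'.1 hcauchy (ε / (C + 1)) (by positivity)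
    refine ⟨N, fun n hn => ?_⟩
    have h1 := hN n hn
    rw [dist_eq_norm, ← map_sub, lt_div_iff₀ (by positivity)] at h1
    rw [dist_eq_norm, ← map_sub, ← Submodule.coe_sub]
    refine (hCb _).trans_lt (lt_of_le_of_lt ?_ h1)
    rw [mul_comm]
    gcongr
    linarith
  have hS : Filter.Tendsto (fun n => fieldMul hA hB ((hφ n).toForm hA)) Filter.atTop
      (nhds (opS A B f)) :=
    (((opS A B).continuous.tendsto f).comp hgf).congr fun n => opS_sqrtMap hA hB _
  -- The energy is `‖D φ_n‖² - ‖S D φ_n‖²`, with limit `‖f‖² - ‖S f‖²`. This is zero because `f` is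
  -- fixed by `S* S`.
  have hP : Filter.Tendsto
      (fun n => (pauliForm A B ((hφ n).toForm hA) ((hφ n).toForm hA)).re) Filter.atTop (nhds 0) := by
    have h1 := (hgf.norm.pow 2).sub (hS.norm.pow 2)
    have h2 : ‖f‖ ^ 2 - ‖opS A B f‖ ^ 2 = 0 := by
      have h3 := ContinuousLinearMap.adjoint_inner_right (opS A B) f (opS A B f)
      rw [hf, inner_self_eq_norm_sq_to_K, inner_self_eq_norm_sq_to_K] at h3
      rw [sub_eq_zero]
      exact_mod_cast h3
    rw [h2] at h1
    exact h1.congr fun n => (re_pauliForm_self hA hB _).symm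
  -- The quotient of the weights for `ε = 1 / (k + 1)` and `ε = 1`. It is bounded by `k + 1` and
  -- tends to the inverse of the weight for `ε = 1`.
  have hexm : ∀ k : ℕ, ∃ p : BoundedContinuousFunction Space ℝ, ∀ x,
      p x = damp (1 / ((k : ℝ) + 1)) x * (1 + 1 * bracket x) := by
    intro k
    have hε : (0 : ℝ) < 1 / ((k : ℝ) + 1) := by positivity
    have hc : Continuous fun x => damp (1 / ((k : ℝ) + 1)) x * (1 + 1 * bracket x) :=
      (contDiff_damp hε).continuous.mul
        (by have := contDiff_bracket.continuous; fun_prop)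
    refine ⟨BoundedContinuousFunction.ofNormedAddCommGroup _ hc ((k : ℝ) + 1) fun x => ?_,
      fun x => rfl⟩
    have hb := bracket_pos x
    have hd := damp_pos hε x
    rw [Real.norm_of_nonneg (by positivity)]
    have h1 := damp_mul hε x
    have h2 : 1 + 1 * bracket x ≤ ((k : ℝ) + 1) * (1 + 1 / ((k : ℝ) + 1) * bracket x) := by
      have : ((k : ℝ) + 1) * (1 + 1 / ((k : ℝ) + 1) * bracket x) = (k + 1) + bracket x := by
        field_simp
      rw [this]
      linarith [(Nat.cast_nonneg k : (0 : ℝ) ≤ k)]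
    calc damp (1 / ((k : ℝ) + 1)) x * (1 + 1 * bracket x)
        ≤ damp (1 / ((k : ℝ) + 1)) x * (((k : ℝ) + 1) * (1 + 1 / ((k : ℝ) + 1) * bracket x)) := by
          gcongr
      _ = (k + 1) * (damp (1 / ((k : ℝ) + 1)) x * (1 + 1 / ((k : ℝ) + 1) * bracket x)) := by ring
      _ = k + 1 := by rw [h1, mul_one]
  choose p hp using hexm
  -- With `k` fixed, the limit `n → ∞` kills the energy despite its factor `8 (k + 1)²`. The
  -- remaining bound is uniform in `k`, as Fatou's lemma needs.
  have hpb : ∀ k, ‖mulHil (p k) W‖ ^ 2 ≤ K * ‖opS A B f‖ ^ 2 := by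
    intro k
    have hε : (0 : ℝ) < 1 / ((k : ℝ) + 1) := by positivity
    have h1 := ((((mulHil (p k)).continuous.tendsto W).comp hW).norm).pow 2
    have h2 := (hP.const_mul (8 * ((1 / ((k : ℝ) + 1))⁻¹) ^ 2)).add
      ((hS.norm.pow 2).const_mul K)
    rw [mul_zero, zero_add] at h2
    refine le_of_tendsto_of_tendsto' h1 h2 fun n => ?_
    rw [Function.comp_apply, mulHil_mulHil (p := dampBcf hε) fun x => ?_]
    · exact hKb _ (hφ n) _ hε
    · rw [hp, dampBcf_apply, dampBcf_apply, mul_assoc, mul_comm (1 + 1 * bracket x),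
        damp_mul one_pos, mul_one]
  have hw : MemLp (fun x => ((1 + 1 * bracket x : ℝ) : ℂ) • (W : Space → Spinor) x) 2 := by
    have hm : AEStronglyMeasurable
        fun x => ((1 + 1 * bracket x : ℝ) : ℂ) • (W : Space → Spinor) x :=
      (Complex.continuous_ofReal.comp (by
        have := contDiff_bracket.continuous
        fun_prop : Continuous fun x => 1 + 1 * bracket x)).aestronglyMeasurable.smul
        (Lp.aestronglyMeasurable W)
    refine memLp_two_of_lintegral hm (ne_top_of_le_ne_top
      (ENNReal.ofReal_ne_top (r := K * ‖opS A B f‖ ^ 2)) ?_)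
    have hlim : ∀ x, Filter.Tendsto (fun k => p k x) Filter.atTop (nhds (1 + 1 * bracket x)) := by
      intro x
      have h0 : Filter.Tendsto (fun k : ℕ => (1 + 1 / ((k : ℝ) + 1) * bracket x)⁻¹ *
          (1 + 1 * bracket x)) Filter.atTop (nhds ((1 + 0 * bracket x)⁻¹ * (1 + 1 * bracket x))) :=
        (((tendsto_one_div_add_atTop_nhds_zero_nat.mul_const _).const_add 1).inv₀
          (by simp)).mul_const _
      rw [show (1 + 0 * bracket x)⁻¹ * (1 + 1 * bracket x) = 1 + 1 * bracket x by simp] at h0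
      exact h0.congr fun k => (hp k x).symm
    have hpt : ∀ x, ‖((1 + 1 * bracket x : ℝ) : ℂ) • (W : Space → Spinor) x‖ₑ ^ 2 =
        Filter.liminf (fun k => ‖((p k x : ℝ) : ℂ) • (W : Space → Spinor) x‖ₑ ^ 2)
          Filter.atTop := by
      intro x
      refine (Filter.Tendsto.liminf_eq ?_).symm
      have h1 := (((Complex.continuous_ofReal.tendsto _).comp (hlim x)).smul_const
        ((W : Space → Spinor) x)).enorm
      exact ((ENNReal.continuous_pow 2).tendsto _).comp h1
    simp only [hpt]
    refine (lintegral_liminf_le' fun k => (memLp_mul (p k) W).1.enorm.pow_const 2).trans ?_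
    refine Filter.liminf_le_of_frequently_le' (Filter.Eventually.of_forall fun k => ?_).frequently
    refine le_trans (le_of_eq ?_) (ENNReal.ofReal_le_ofReal (hpb k))
    rw [ofReal_norm_sq]
    refine lintegral_congr_ae ?_
    filter_upwards [mulHil_ae (p k) W] with x hx
    rw [hx]
  have hwW : mulHil (dampBcf one_pos) (hw.toLp _) = W := by
    refine Lp.ext ((mulHil_ae _ _).trans ?_)
    filter_upwards [hw.coeFn_toLp] with x hx
    rw [hx, smul_smul, ← Complex.ofReal_mul, dampBcf_apply, damp_mul one_pos, Complex.ofReal_one,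
      one_smul]
  rw [← hwW] at hW
  obtain ⟨u, -, hu⟩ := exists_form_of_tendsto_damp hA hφ hW hG
  rw [← hu] at hG
  exact ⟨u, tendsto_nhds_unique (tendsto_sqrtMap hA hB hG) hgf⟩

/-! ### The two implications -/

/-- A form domain vector whose image is fixed by `S* S` is a zero mode. -/
theorem hasZeroMode_of_fixed (hA : IsL2Loc A) (hB : MemLp B (3 / 2) volume) {u : formDomain A}
    (hu : sqrtMap hA hB u ≠ 0) (h : ContinuousLinearMap.adjoint (opS A B)
      (opS A B (sqrtMap hA hB u)) = sqrtMap hA hB u) : HasZeroMode A B := by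
  refine ⟨u, fun h0 => hu ?_, u, rfl, fun v => ?_⟩
  · rw [Submodule.coe_eq_zero] at h0
    rw [h0, map_zero]
  · rw [← inner_one_sub_adjoint_opS hA hB, h, sub_self, inner_zero_right, inner_zero_right]

/-- The normalised vector `D u` competes in the infimum with value zero, since `(1 - S* S) D u` is
orthogonal to the dense range of `D`. -/
theorem delta_eq_zero_of_hasZeroMode (hA : IsL2Loc A) (hB : MemLp B (3 / 2) volume)
    (h : HasZeroMode A B) : delta A B = 0 := by
  obtain ⟨_, hu0, u, rfl, hu⟩ := h
  have hpos : sqrtMap hA hB u ≠ 0 := fun h0 =>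
    hu0 (by rw [sqrtMap_injective hA hB (h0.trans (map_zero _).symm), Submodule.coe_zero])
  have hfix : sqrtMap hA hB u -
      ContinuousLinearMap.adjoint (opS A B) (opS A B (sqrtMap hA hB u)) = 0 := by
    refine (denseRange_sqrtMap hA hB).eq_zero_of_inner_right ℂ fun v => ?_
    rw [inner_one_sub_adjoint_opS]
    exact (hu v).trans (inner_zero_right _)
  refine le_antisymm (csInf_le ⟨0, ?_⟩ ?_) (Real.sInf_nonneg ?_)
  · rintro _ ⟨f, -, -, rfl⟩
    exact norm_nonneg _
  · let c : ℂ := ((‖sqrtMap hA hB u‖⁻¹ : ℝ) : ℂ)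
    refine ⟨sqrtMap hA hB (c • u), ?_, ⟨toPreTilde hA hB (c • u), opU_sqrtMap hA hB _⟩, ?_⟩
    · rw [map_smul, norm_smul, Complex.norm_real, norm_inv, norm_norm,
        inv_mul_cancel₀ (norm_ne_zero_iff.2 hpos)]
    · rw [map_smul, map_smul, map_smul, ← smul_sub, hfix, smul_zero, norm_zero]
  · rintro _ ⟨f, -, -, rfl⟩
    exact norm_nonneg _

theorem exists_sqrtMap_ne_zero (hA : IsL2Loc A) (hB : MemLp B (3 / 2) volume) :
    ∃ u : formDomain A, sqrtMap hA hB u ≠ 0 := by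
  by_contra! h
  have h0 : ∀ f : Hil, f = 0 := fun f => by
    have := denseRange_sqrtMap hA hB f
    have hr : Set.range (sqrtMap hA hB) ⊆ {0} := by
      rintro _ ⟨u, rfl⟩
      exact h u
    simpa using closure_mono hr this
  have h1 := h0 (indicatorConstLp 2 (measurableSet_ball (x := (0 : Space)) (ε := 1))
    measure_ball_lt_top.ne (EuclideanSpace.single 0 1))
  rw [← norm_eq_zero, norm_indicatorConstLp (by simp) (by simp)] at h1
  simp only [PiLp.norm_single, norm_one, one_mul, ENNReal.toReal_ofNat] at h1
  rw [Real.rpow_eq_zero measureReal_nonneg (by norm_num), measureReal_def,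
    ENNReal.toReal_eq_zero_iff] at h1
  rcases h1 with h1 | h1
  · exact (Metric.measure_ball_pos volume (0 : Space) one_pos).ne' h1
  · exact measure_ball_lt_top.ne h1

/-- Compactness makes the infimum attained, by a vector that a priori need not lie in the range of
`D`. The weighted estimate shows that it does. -/
theorem hasZeroMode_of_delta_eq_zero (hA : IsL2Loc A) (hB : MemLp B (3 / 2) volume)
    (hcurl : HasWeakCurl A B)
    (hdecay : ∃ β > (0 : ℝ), ∃ C ≥ (0 : ℝ), ∃ r₀ ≥ (0 : ℝ),
      ∀ᵐ x : Space, r₀ ≤ ‖x‖ → ‖B x‖ ≤ C * ‖x‖ ^ (-2 - β)) (h : delta A B = 0) :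
    HasZeroMode A B := by
  -- Needed because the infimum of the empty set of reals is `0` by convention, which would carry no
  -- information.
  have hne : {r : ℝ | ∃ f : Hil, ‖f‖ = 1 ∧
      (∃ u : PreTilde (pauliTildeSqrt A B), opU A B f = (u : Tilde (pauliTildeSqrt A B))) ∧
      r = ‖f - ContinuousLinearMap.adjoint (opS A B) (opS A B f)‖}.Nonempty := by
    obtain ⟨u, hu⟩ := exists_sqrtMap_ne_zero hA hB
    let c : ℂ := ((‖sqrtMap hA hB u‖⁻¹ : ℝ) : ℂ)
    refine ⟨_, sqrtMap hA hB (c • u), ?_, ⟨toPreTilde hA hB (c • u), opU_sqrtMap hA hB _⟩, rfl⟩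
    rw [map_smul, norm_smul, Complex.norm_real, norm_inv, norm_norm,
      inv_mul_cancel₀ (norm_ne_zero_iff.2 hu)]
  have hex : ∀ n : ℕ, ∃ f : Hil, ‖f‖ = 1 ∧
      ‖f - ContinuousLinearMap.adjoint (opS A B) (opS A B f)‖ < 1 / ((n : ℝ) + 1) := by
    intro n
    obtain ⟨_, ⟨f, hf, -, rfl⟩, hlt⟩ := exists_lt_of_csInf_lt hne
      (h.trans_lt (by positivity : (0 : ℝ) < 1 / ((n : ℝ) + 1)))
    exact ⟨f, hf, hlt⟩
  choose f hf1 hf2 using hex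
  -- Supplies the instance argument behind the separability of `L²`, which the weak subsequence
  -- requires.
  have : Fact ((2 : ℝ≥0∞) ≠ ⊤) := ⟨by simp⟩
  obtain ⟨g, k, hk, hw⟩ := exists_weak_subseq (fun n => (hf1 n).le)
  have hS : Filter.Tendsto (fun n => opS A B (f (k n) - g)) Filter.atTop (nhds 0) := by
    refine tendsto_opS_of_weak hA hB (r := 1 + ‖g‖) (fun n => ?_) fun h => ?_
    · exact (norm_sub_le _ _).trans (by rw [hf1])
    · have h1 := (hw h).sub_const ⟪g, h⟫_ℂ
      rw [sub_self] at h1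
      exact h1.congr fun n => by rw [inner_sub_left]
  have hSS : Filter.Tendsto
      (fun n => ContinuousLinearMap.adjoint (opS A B) (opS A B (f (k n)))) Filter.atTop
      (nhds (ContinuousLinearMap.adjoint (opS A B) (opS A B g))) := by
    have h1 := (((ContinuousLinearMap.adjoint (opS A B)).continuous.tendsto 0).comp hS).add_const
      (ContinuousLinearMap.adjoint (opS A B) (opS A B g))
    rw [map_zero, zero_add] at h1
    exact h1.congr fun n => by simp only [Function.comp_apply, map_sub, sub_add_cancel]
  have hdiff : Filter.Tendsto
      (fun n => f (k n) - ContinuousLinearMap.adjoint (opS A B) (opS A B (f (k n)))) Filter.atTop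
      (nhds 0) := by
    refine Filter.Tendsto.comp (g := fun n => f n -
      ContinuousLinearMap.adjoint (opS A B) (opS A B (f n))) ?_ hk.tendsto_atTop
    exact squeeze_zero_norm (fun n => (hf2 n).le) tendsto_one_div_add_atTop_nhds_zero_nat
  have hlim : Filter.Tendsto (fun n => f (k n)) Filter.atTop
      -- Norm convergence of `S* S f_n` forces that of `f_n`, so no mass is lost and the limit keeps
      -- norm one.
      (nhds (ContinuousLinearMap.adjoint (opS A B) (opS A B g))) := by
    have h1 := hdiff.add hSS
    rw [zero_add] at h1
    exact h1.congr fun n => sub_add_cancel _ _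
  have hg : ContinuousLinearMap.adjoint (opS A B) (opS A B g) = g := by
    refine ext_inner_right ℂ fun v => ?_
    exact tendsto_nhds_unique (hlim.inner tendsto_const_nhds) (hw v)
  have hg1 : ‖g‖ = 1 := by
    rw [hg] at hlim
    exact tendsto_nhds_unique hlim.norm (by simp [hf1])
  obtain ⟨u, rfl⟩ := exists_sqrtMap_eq_of_fixed hA hB hcurl hdecay hg
  exact hasZeroMode_of_fixed hA hB (norm_ne_zero_iff.1 (by rw [hg1]; exact one_ne_zero)) hg

end Pauli

end

theorem theorem1 (A B : Pauli.Space → Pauli.Space)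
    (hA : Pauli.IsL2Loc A) (hB : MemLp B (3 / 2) volume) (hcurl : Pauli.HasWeakCurl A B)
    (hdecay : ∃ β > (0 : ℝ), ∃ C ≥ (0 : ℝ), ∃ r₀ ≥ (0 : ℝ),
      ∀ᵐ x : Pauli.Space, r₀ ≤ ‖x‖ → ‖B x‖ ≤ C * ‖x‖ ^ (-2 - β)) :
    Pauli.delta A B = 0 ↔ Pauli.HasZeroMode A B := by
  exact ⟨Pauli.hasZeroMode_of_delta_eq_zero hA hB hcurl hdecay,
    Pauli.delta_eq_zero_of_hasZeroMode hA hB⟩
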